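/- Let $p$ be an odd prime and let $G$ be a finite group whose Sylow $p$-subgroups have order $p$ and are not normal. Fix $x\in G$ of order $p$, set $\mathbf U=\langle x\rangle$ and $N=N_G(\mathbf U)$. Let $M$ be an indecomposable finite-dimensional $\mathbb F_pG$-module which is minimally active (that is, $x$ acts on $M$ with at most one non-trivial Jordan block), and on which $\mathbf U$ acts faithfully. Terminology. A vertex of an indecomposable $\mathbb F_pG$-module $V$ is a minimal subgroup $P\le G$ such that $V$ is relatively $P$-projective (every surjection of $\mathbb F_pG$-modules onto $V$ that splits over $P$ splits over $G$). A source of $V$ is an indecomposable $\mathbb F_pP$-module $T$ such that $V$ is a direct summand of $\operatorname{Ind}_P^G T$. The module $V$ is trivial-source if the trivial module $\mathbb F_p$ of a vertex is a source. The Green correspondent of $V$ is the indecomposable summand of $V|_{N_G(P)}$ with vertex $P$, unique up to isomorphism. A module is absolutely simple if it remains simple after every extension of the ground field. The Brauer character $\chi_M$ assigns to $g\in G$ of order prime to $p$ the sum of the Teichmüller lifts, in the Witt vectors $W(\overline{\mathbb F}_p)\supseteq\mathbb Z_p$, of the eigenvalues of $g$ on $M$, counted with multiplicity. Then the following hold.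 (a) Either $\dim M<p$ and $M|_{\mathbf U}$ is indecomposable; or $\dim M=p$, $M|_{\mathbf U}$ is indecomposable and free, and $M$ is projective; or $\dim M>p$, $M$ is trivial-source, and $M|_{\mathbf U}$ is isomorphic to the direct sum of one copy of $\mathbb F_p\mathbf U$ and a module with trivial action. (b) $M$ is trivial-source if and only if $\dim M\ge p$. (c) If $\dim M\ge p+2$, then $M$ is simple and absolutely simple. (d) If $M$ is simple and trivial-source, then there is a $\mathbb Z_pG$-lattice $\Lambda$ (free of finite rank over $\mathbb Z_p$) such that $\Lambda/p\Lambda\cong M$ and $\mathbb Q_p\otimes_{\mathbb Z_p}\Lambda$ is a simple $\mathbb Q_pG$-module. Moreover, $\Lambda$ can be chosen so that $\mathbb Q_p\otimes_{\mathbb Z_p}\Lambda$ is absolutely simple and its character agrees with $\chi_M$ on all elements of order prime to $p$; thus $\chi_M$ extends to an absolutely irreducible ordinary character of $G$. (e) If $\dim M>p$, then $M$ has vertex $\mathbf U$, and its Green correspondent (an $\mathbb F_pN$-module) exists and is simple. -/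

import Mathlib

open scoped MonoidAlgebra TensorProduct

universe u v w

noncomputable section

namespace MinActive

section Groups

/-- The class of finite groups whose Sylow `p`-subgroups have order `p` and are not normal. -/
def InClassG (p : ℕ) (G : Type u) [Group G] : Prop :=
  Finite G ∧ ∀ P : Sylow p G, Nat.card P = p ∧ ¬ (P : Subgroup G).Normal

end Groups

section Reps

variable {k : Type*} [Field k] {G : Type u} [Group G]
  {V : Type v} [AddCommGroup V] [Module k V]
  {W : Type w} [AddCommGroup W] [Module k W]

/-- The restriction of a representation of `G` to a subgroup `H`. -/
abbrev res (H : Subgroup G) (ρ : Representation k G V) : Representation k H V :=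
  MonoidHom.comp ρ H.subtype

/-- `ρ` is indecomposable: it is nonzero, and it is not the direct sum of two nonzero
subrepresentations. -/
def IsIndecomposable (ρ : Representation k G V) : Prop :=
  Nontrivial V ∧
    ∀ A B : Subrepresentation ρ, IsCompl A B → A = ⊥ ∨ B = ⊥

/-- `ρ` is isomorphic to a direct summand of `σ`. -/
def IsSummand (ρ : Representation k G V) (σ : Representation k G W) : Prop :=
  ∃ (i : Representation.IntertwiningMap ρ σ) (r : Representation.IntertwiningMap σ ρ),
    ∀ v, r (i v) = v

/-- `ρ` is relatively `P`-projective: each surjection of representations of `G` onto `ρ` which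
splits over `P` also splits over `G`. -/
def IsRelativelyProjective (P : Subgroup G) (ρ : Representation k G V) : Prop :=
  ∀ (X : Type v) [AddCommGroup X] [Module k X] (σ : Representation k G X)
    (f : Representation.IntertwiningMap σ ρ), Function.Surjective f →
    (∃ s : Representation.IntertwiningMap (res P ρ) (res P σ), ∀ v, f (s v) = v) →
    ∃ s : Representation.IntertwiningMap ρ σ, ∀ v, f (s v) = v

/-- `P` is a vertex of `ρ`: a minimal subgroup such that `ρ` is relatively `P`-projective. -/
def IsVertex (P : Subgroup G) (ρ : Representation k G V) : Prop :=
  Minimal (fun Q : Subgroup G => IsRelativelyProjective Q ρ) P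

/-- For a vertex `P` of `ρ`, the representation `τ` of `P` is a source of `ρ`: it is indecomposable
and `ρ` is a direct summand of the representation of `G` induced from `τ`. -/
def IsSource (P : Subgroup G) (ρ : Representation k G V) (τ : Representation k P W) : Prop :=
  IsVertex P ρ ∧ IsIndecomposable τ ∧ IsSummand ρ (Representation.ind P.subtype τ)

/-- `ρ` is a trivial-source representation: the one-dimensional trivial representation of a vertex
is a source of `ρ`. -/
def IsTrivialSource (ρ : Representation k G V) : Prop :=
  ∃ P : Subgroup G, IsSource P ρ (Representation.trivial k P k)

/-- For a vertex `P` of `ρ`, the representation `τ` of `N_G(P)` is the Green correspondent of `ρ`: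
it is an indecomposable summand of the restriction of `ρ` to `N_G(P)` and has vertex `P`. -/
def IsGreenCorrespondent (P : Subgroup G) (ρ : Representation k G V)
    (τ : Representation k (Subgroup.normalizer (P : Set G)) W) : Prop :=
  IsVertex P ρ ∧ IsIndecomposable τ ∧
    IsVertex (P.subgroupOf (Subgroup.normalizer (P : Set G))) τ ∧
    IsSummand τ (res (Subgroup.normalizer (P : Set G)) ρ)

/-- The basis `b`, whose vectors are grouped in blocks of sizes `d i`, puts the endomorphism `f`
in Jordan normal form with all eigenvalues equal to `1`: on the `i`-th block, `f` is the Jordan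
block of size `d i` with eigenvalue `1`. -/
def IsUnipotentJordanBasis {ι : Type*} {d : ι → ℕ} (f : Module.End k V)
    (b : Module.Basis (Σ i, Fin (d i)) k V) : Prop :=
  ∀ (i : ι) (j : Fin (d i)), f (b ⟨i, j⟩) = b ⟨i, j⟩ +
    if 0 < j.val then b ⟨i, ⟨j.val - 1, (Nat.sub_le _ _).trans_lt j.isLt⟩⟩ else 0

/-- The action of `x` on `ρ` has at most one non-trivial Jordan block. (For `x` of order `p`,
where `p` is the characteristic, all eigenvalues of `x` are `1`, so that the blocks with
non-trivial action are those of size at least `2`.) -/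
def IsMinimallyActive (x : G) (ρ : Representation k G V) : Prop :=
  ∃ (n : ℕ) (d : Fin n → ℕ) (b : Module.Basis (Σ i, Fin (d i)) k V),
    IsUnipotentJordanBasis (ρ x) b ∧ {i | 2 ≤ d i}.Subsingleton

end Reps

section Scalars

/-- Extension of scalars of a representation from `R` to an `R`-algebra `K`. -/
def extendScalars {R : Type*} [CommRing R] (K : Type*) [CommRing K] [Algebra R K]
    {G : Type u} [Group G] {V : Type v} [AddCommGroup V] [Module R V]
    (ρ : Representation R G V) : Representation K G (K ⊗[R] V) where
  toFun g := (ρ g).baseChange K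
  map_one' := by
    ext v
    simp
  map_mul' g h := by
    ext v
    simp

/-- `ρ` is absolutely irreducible: it stays irreducible over each extension of its field. -/
def IsAbsolutelyIrreducible {k : Type v} [Field k] {G : Type u} [Group G] {V : Type w}
    [AddCommGroup V] [Module k V] (ρ : Representation k G V) : Prop :=
  ∀ (K : Type v) [Field K] [Algebra k K], (extendScalars K ρ).IsIrreducible

variable {p : ℕ} [Fact p.Prime] {G : Type u} [Group G]
  {M : Type v} [AddCommGroup M] [Module (ZMod p) M]

/-- `ρ` is the reduction modulo `p` of the representation `Λ` over `ℤ_p`: there is an equivariant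
surjection from `Λ` onto `ρ`, semilinear over `ℤ_p → 𝔽_p`, with kernel `p Λ`. -/
def IsReductionModP {L : Type w} [AddCommGroup L] [Module ℤ_[p] L]
    (Λ : Representation ℤ_[p] G L) (ρ : Representation (ZMod p) G M) : Prop :=
  ∃ π : L →ₛₗ[(PadicInt.toZMod : ℤ_[p] →+* ZMod p)] M,
    Function.Surjective π ∧ (∀ y, π y = 0 ↔ ∃ z, y = (p : ℤ_[p]) • z) ∧
    ∀ g y, π (Λ g y) = ρ g (π y)

/-- The Brauer character of `ρ` at `g`, an element of the Witt vectors of an algebraic closure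
of `𝔽_p`: the sum of the Teichmüller lifts of the eigenvalues of `g`, with multiplicities. (It is
only used at the elements `g` of order prime to `p`.) -/
def brauerCharacter [FiniteDimensional (ZMod p) M] (ρ : Representation (ZMod p) G M) (g : G) :
    WittVector p (AlgebraicClosure (ZMod p)) :=
  (((ρ g).charpoly.aroots (AlgebraicClosure (ZMod p))).map (WittVector.teichmuller p)).sum

/-- The canonical embedding of `ℤ_p = W(𝔽_p)` into the Witt vectors of an algebraic closure
of `𝔽_p`. -/
def padicIntToWitt (p : ℕ) [Fact p.Prime] :
    ℤ_[p] →+* WittVector p (AlgebraicClosure (ZMod p)) :=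
  (WittVector.map (algebraMap (ZMod p) (AlgebraicClosure (ZMod p)))).comp
    (WittVector.equiv p).symm.toRingHom

/-- The Brauer character of `ρ` is extended by the character of `Λ`: the two agree at all elements
of order prime to `p`. -/
def CharacterExtendsBrauer {L : Type w} [AddCommGroup L] [Module ℤ_[p] L]
    [FiniteDimensional (ZMod p) M]
    (Λ : Representation ℤ_[p] G L) (ρ : Representation (ZMod p) G M) : Prop :=
  ∀ g : G, ¬ p ∣ orderOf g →
    padicIntToWitt p (LinearMap.trace ℤ_[p] L (Λ g)) = brauerCharacter ρ g

end Scalars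

end MinActive

end

/-! Write X for the action of x minus 1; then X^p = 0 and X^(p-1) is the norm of U. Minimal activity
enters only through the fact that D = ker X ⊓ im X lies in a line (`exists_ker_inf_range_le`);
faithfulness makes D nonzero. Since U acts trivially on ker X and [N : U] is prime to p, Maschke
averaging yields an N-equivariant idempotent e that kills im X and whose image complements D in ker
X (`exists_isTrivialPartProjection`).

The engine is a dichotomy for N-equivariant idempotents f of M, a concrete form of the Green
correspondence (`conjNorm_or_isUnit_relTrace`). Call an endomorphism a norm if it is a trace from
the trivial subgroup to U. As U meets its conjugates outside N trivially, Mackey's formula writes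
Tr_U^G f as [N : U] f plus a norm, and by Fitting's lemma this trace is nilpotent or invertible.
Working modulo the ideal of norms, either f is a norm, or Tr f is invertible and 1 - f is a norm.
Norms send fixed vectors into im X^(p-1). If e ≠ 0, then e is not a norm, so Tr e is invertible, M
is a summand of a module induced from the trivial module of U, and D lies in im X^(p-1).

Hence X^(p-1) = 0 forces e = 0 and a single Jordan block of size below p. If X^(p-1) ≠ 0, the
restriction to U is free of rank one plus a trivial module of dimension rank e, and M is projective
when e = 0. Conversely, a trivial-source module has X^(p-1) ≠ 0
(`eq_zero_of_isSummand_ind_trivial`). This settles (a) and (b).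

For e ≠ 0 the dichotomy, applied to summands of im e, shows that im e is a simple N-module, and it
is a Green correspondent; a further use of it shows that every Green correspondent is simple. If
rank e ≥ 2, comparing a submodule with im e and using that Tr e is invertible gives simplicity of M
(`isIrreducible`). The operator X^(p-1) has rank one and comes from the group algebra, so for simple
M the group algebra maps onto End M, which is absolute simplicity. For (d), the idempotent matrix
cutting M out of a permutation module is lifted to ℤ_p; Nakayama's lemma carries surjectivity onto
the endomorphism ring up to the lattice, and Teichmüller lifts compare the characters. -/

noncomputable section

namespace MinActive

/-! ### Relative traces and Mackey's formula -/

section RelTrace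

variable {k : Type*} [CommRing k] {G : Type*} [Group G] {A : Type*} [AddCommGroup A] [Module k A]

/-- The relative trace from a subgroup `P` to `G`, computed with the coset representatives
`Quotient.out`; it only deserves its name on `P`-invariant vectors. -/
def relTrace (α : Representation k G A) (P : Subgroup G) [Finite (G ⧸ P)] : A →ₗ[k] A :=
  letI := Fintype.ofFinite (G ⧸ P)
  ∑ c : G ⧸ P, α c.out

variable (α : Representation k G A) (P : Subgroup G)

theorem relTrace_apply [Fintype (G ⧸ P)] (a : A) :
    relTrace α P a = ∑ c : G ⧸ P, α c.out a := by
  rw [relTrace, LinearMap.sum_apply]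
  congr!

variable {α P} in
theorem apply_eq_of_mk_eq {a : A} (ha : ∀ h ∈ P, α h a = a) {g g' : G}
    (hg : (g : G ⧸ P) = g') : α g a = α g' a := by
  rw [← mul_inv_cancel_left g g', map_mul α g, Module.End.mul_apply,
    ha _ (QuotientGroup.eq.1 hg)]

variable {α P} in
theorem apply_out_smul {a : A} (ha : ∀ h ∈ P, α h a = a) (g : G) (c : G ⧸ P) :
    α (g • c).out a = α g (α c.out a) := by
  rw [← Module.End.mul_apply, ← map_mul]
  apply apply_eq_of_mk_eq ha
  rw [QuotientGroup.out_eq', ← smul_eq_mul, ← MulAction.Quotient.smul_coe, QuotientGroup.out_eq']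

theorem apply_relTrace [Finite (G ⧸ P)] {a : A} (ha : ∀ h ∈ P, α h a = a) (g : G) :
    α g (relTrace α P a) = relTrace α P a := by
  have := Fintype.ofFinite (G ⧸ P)
  rw [relTrace_apply, map_sum]
  refine Fintype.sum_equiv (MulAction.toPerm g) _ _ fun c => ?_
  rw [MulAction.toPerm_apply, apply_out_smul ha]

/-- An equivariant function whose values vanish outside the free orbits sums to a norm. -/
theorem exists_sum_eq_norm {U T : Type*} [Group U] [Fintype U] [Fintype T] [MulAction U T]
    (β : Representation k U A) (F : T → A) (hF : ∀ (u : U) t, F (u • t) = β u (F t))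
    (hfree : ∀ t, F t ≠ 0 → ∀ u : U, u • t = t → u = 1) :
    ∃ b, ∑ t, F t = β.norm b := by
  classical
  let r : T → T := fun t => (Quotient.mk (MulAction.orbitRel U T) t).out
  have hr (t : T) : ∃ u : U, u • r t = t := by
    have : (MulAction.orbitRel U T) (r t) t := Quotient.mk_out (s := MulAction.orbitRel U T) t
    obtain ⟨u, hu⟩ := MulAction.orbitRel_apply.1 ((MulAction.orbitRel U T).symm this)
    exact ⟨u, hu⟩
  have hru (u : U) (t : T) : r (u • t) = r t := by
    have : Quotient.mk (MulAction.orbitRel U T) (u • t) = Quotient.mk (MulAction.orbitRel U T) t :=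
      Quotient.sound (s := MulAction.orbitRel U T) ⟨u, rfl⟩
    simp only [r, this]
  have hF0 (u : U) (t : T) : F (u • t) ≠ 0 ↔ F t ≠ 0 := by
    rw [hF, not_iff_not]
    refine ⟨fun h => ?_, fun h => by rw [h, map_zero]⟩
    rw [← β.inv_self_apply u (F t), h, map_zero]
  -- The witness sums F over orbit representatives. Terms with F = 0 are discarded before comparing:
  -- only on the remaining, free orbits is (u, t) ↦ u • t injective.
  refine ⟨∑ t with r t = t, F t, ?_⟩
  rw [Representation.norm, LinearMap.sum_apply]
  simp_rw [map_sum]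
  rw [← Finset.sum_product', ← Finset.sum_filter_ne_zero,
    ← Finset.sum_filter_ne_zero (s := Finset.univ ×ˢ _)]
  symm
  refine Finset.sum_bij (fun a _ => a.1 • a.2) ?_ ?_ ?_ ?_
  · rintro ⟨u, t⟩ h
    simp only [Finset.mem_filter, Finset.mem_product, Finset.mem_univ, true_and] at h ⊢
    rw [hF]
    exact h.2
  · rintro ⟨u, t⟩ h ⟨u', t'⟩ h' heq
    simp only [Finset.mem_filter, Finset.mem_product, Finset.mem_univ, true_and] at h h' heq
    have htt : t = t' := by rw [← h.1, ← h'.1, ← hru u t, heq, hru]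
    subst htt
    have h1 : F t ≠ 0 := by rw [← hF0 u, hF]; exact h.2
    have h2 := hfree t h1 (u'⁻¹ * u) (by rw [mul_smul, heq, inv_smul_smul])
    rw [inv_mul_eq_one] at h2
    rw [h2]
  · intro t ht
    simp only [Finset.mem_filter, Finset.mem_univ, true_and] at ht
    obtain ⟨u, hu⟩ := hr t
    refine ⟨(u, r t), ?_, hu⟩
    simp only [Finset.mem_filter, Finset.mem_product, Finset.mem_univ, true_and]
    refine ⟨?_, ?_⟩
    · rw [← hru u (r t), hu]
    · rw [← hF, hu]; exact ht
  · rintro ⟨u, t⟩ h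
    rw [hF]

/-- Mackey's formula for a subgroup which meets its conjugates outside `N` trivially. -/
theorem exists_relTrace_eq_add_norm {U N : Subgroup G} [Finite (G ⧸ U)] [Fintype U]
    (hUN : U ≤ N) (hTI : ∀ g ∉ N, ∀ u ∈ U, g⁻¹ * u * g ∈ U → u = 1) {a : A}
    (ha : ∀ g ∈ N, α g a = a) :
    ∃ b, relTrace α U a = U.relIndex N • a +
      Representation.norm (α.comp U.subtype) b := by
  classical
  have := Fintype.ofFinite (G ⧸ U)
  have haU : ∀ g ∈ U, α g a = a := fun g hg => ha g (hUN hg)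
  have hmem (u : U) (c : G ⧸ U) : (u • c).out ∈ N ↔ c.out ∈ N := by
    have h : (((u : G) * c.out : G) : G ⧸ U) = ((u • c).out : G) := by
      rw [QuotientGroup.out_eq', ← smul_eq_mul, ← MulAction.Quotient.smul_coe,
        QuotientGroup.out_eq']
      rfl
    have h2 := hUN (QuotientGroup.eq.1 h)
    constructor
    · intro h3
      have := N.mul_mem (N.inv_mem (hUN u.2)) (N.mul_mem h3 (N.inv_mem h2))
      convert this using 1
      group
    · intro h3
      have := N.mul_mem (N.mul_mem (hUN u.2) h3) h2
      convert this using 1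
      group
  -- The stabilizer in U of a coset gU is U ⊓ gUg⁻¹, trivial for g outside N, so these cosets add up
  -- to a norm. Cosets inside N are zeroed out here; each of them contributes a.
  obtain ⟨b, hb⟩ := exists_sum_eq_norm (T := G ⧸ U) (α.comp U.subtype)
    (fun c => if c.out ∈ N then 0 else α c.out a)
    (by
      intro u c
      simp only [hmem]
      split_ifs
      · simp
      · exact apply_out_smul haU (u : G) c)
    (by
      intro c hc u hu
      have hcN : c.out ∉ N := by
        intro h
        simp [h] at hc
      have h : (c.out : G ⧸ U) = (((u : G) * c.out : G) : G ⧸ U) := by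
        rw [QuotientGroup.out_eq', ← smul_eq_mul, ← MulAction.Quotient.smul_coe,
          QuotientGroup.out_eq']
        exact hu.symm
      have h2 := QuotientGroup.eq.1 h
      rw [← mul_assoc] at h2
      exact Subtype.ext (hTI _ hcN u u.2 h2))
  refine ⟨b, ?_⟩
  rw [← hb, relTrace_apply]
  have hcard : (Finset.univ.filter fun c : G ⧸ U => c.out ∈ N).card = U.relIndex N := by
    rw [Subgroup.relIndex, Subgroup.index, ← Fintype.card_subtype, ← Nat.card_eq_fintype_card]
    symm
    refine Nat.card_congr (Equiv.ofBijective (fun c : N ⧸ U.subgroupOf N =>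
      (⟨(c.out : G), ?_⟩ : {c : G ⧸ U // c.out ∈ N})) ⟨?_, ?_⟩)
    · have h : ((c.out : G) : G ⧸ U) = (((c.out : G) : G ⧸ U).out : G) := by
        rw [QuotientGroup.out_eq']
      have h2 := N.mul_mem c.out.2 (hUN (QuotientGroup.eq.1 h))
      rwa [mul_inv_cancel_left] at h2
    · intro c d hcd
      have h := QuotientGroup.eq.1 (Subtype.ext_iff.1 hcd)
      rw [← QuotientGroup.out_eq' c, ← QuotientGroup.out_eq' d]
      exact QuotientGroup.eq.2 (by simpa [Subgroup.mem_subgroupOf] using h)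
    · rintro ⟨c, hc⟩
      refine ⟨((⟨c.out, hc⟩ : N) : N ⧸ U.subgroupOf N), Subtype.ext ?_⟩
      refine Eq.trans ?_ (QuotientGroup.out_eq' c)
      have h := QuotientGroup.eq.1 (QuotientGroup.out_eq'
        ((⟨c.out, hc⟩ : N) : N ⧸ U.subgroupOf N))
      exact QuotientGroup.eq.2 (by simpa [Subgroup.mem_subgroupOf] using h)
  rw [← hcard, ← Finset.sum_const, Finset.sum_filter, ← Finset.sum_add_distrib]
  refine Finset.sum_congr rfl fun c _ => ?_
  split_ifs with h
  · rw [ha _ h, add_zero]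
  · rw [zero_add]

end RelTrace

/-! ### Traces of endomorphisms -/

section Conj

variable {k : Type*} [Field k] {G : Type*} [Group G] {V : Type*} [AddCommGroup V] [Module k V]
  (ρ : Representation k G V)

/-- The conjugation action of `G` on the endomorphisms of a representation. -/
abbrev conj : Representation k G (Module.End k V) := Representation.linHom ρ ρ

variable {ρ}

theorem conj_apply (g : G) (f : Module.End k V) : conj ρ g f = ρ g * f * ρ g⁻¹ := rfl

theorem conj_eq_self_iff {g : G} {f : Module.End k V} : conj ρ g f = f ↔ Commute (ρ g) f := by
  rw [conj_apply]
  constructor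
  · intro h
    rw [commute_iff_eq]
    conv_rhs => rw [← h]
    rw [mul_assoc, ← map_mul, inv_mul_cancel, map_one, mul_one]
  · intro h
    rw [h.eq, mul_assoc, ← map_mul, mul_inv_cancel, map_one, mul_one]

theorem commute_relTrace (P : Subgroup G) [Finite (G ⧸ P)] {f : Module.End k V}
    (hf : ∀ h ∈ P, Commute (ρ h) f) (g : G) : Commute (ρ g) (relTrace (conj ρ) P f) :=
  conj_eq_self_iff.1 (apply_relTrace _ _ (fun h hh => conj_eq_self_iff.2 (hf h hh)) g)

variable {U : Subgroup G} [Fintype U]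

variable (ρ U) in
/-- The trace map from the trivial subgroup to `U` on endomorphisms. -/
abbrev conjNorm : Module.End k (Module.End k V) :=
  Representation.norm ((conj ρ).comp U.subtype)

theorem conjNorm_apply (b : Module.End k V) :
    conjNorm ρ U b = ∑ u : U, ρ u * b * ρ (u : G)⁻¹ := by
  rw [conjNorm, Representation.norm, LinearMap.sum_apply]
  rfl

/-- An f commuting with U passes through each conjugation. With `mul_conjNorm` this makes the norms
stable under multiplication by U-endomorphisms on either side. -/
theorem conjNorm_mul {f : Module.End k V} (hf : ∀ h ∈ U, Commute (ρ h) f) (b : Module.End k V) :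
    conjNorm ρ U b * f = conjNorm ρ U (b * f) := by
  simp only [conjNorm_apply, Finset.sum_mul]
  refine Finset.sum_congr rfl fun u _ => ?_
  simp only [mul_assoc]
  rw [(hf _ (U.inv_mem u.2)).eq]

theorem mul_conjNorm {f : Module.End k V} (hf : ∀ h ∈ U, Commute (ρ h) f) (b : Module.End k V) :
    f * conjNorm ρ U b = conjNorm ρ U (f * b) := by
  simp only [conjNorm_apply, Finset.mul_sum]
  refine Finset.sum_congr rfl fun u _ => ?_
  simp only [← mul_assoc]
  rw [(hf _ u.2).eq]

/-- The inner factor `ρ u⁻¹` disappears on a fixed vector. This turns statements about endomorphisms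
that are norms into statements about vectors that are norms. -/
theorem conjNorm_apply_of_fixed (b : Module.End k V) {v : V} (hv : ∀ u ∈ U, ρ u v = v) :
    conjNorm ρ U b v = Representation.norm (ρ.comp U.subtype) (b v) := by
  rw [conjNorm_apply, Representation.norm, LinearMap.sum_apply, LinearMap.sum_apply]
  refine Finset.sum_congr rfl fun u _ => ?_
  rw [Module.End.mul_apply, hv _ (U.inv_mem u.2)]
  rfl

end Conj

/-! ### Fitting's lemma and the dichotomy for idempotents -/

section Fitting

variable {k : Type*} [Field k] {G : Type u} [Group G] {V : Type v} [AddCommGroup V] [Module k V]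
  [FiniteDimensional k V] {ρ : Representation k G V}

/-- Fitting's lemma for an indecomposable representation. -/
theorem IsIndecomposable.isNilpotent_or_isUnit (hρ : IsIndecomposable ρ) {f : Module.End k V}
    (hf : ∀ g, Commute (ρ g) f) : IsNilpotent f ∨ IsUnit f := by
  obtain ⟨n, hn⟩ := Filter.eventually_atTop.1 f.eventually_isCompl_ker_pow_range_pow
  -- The exponent n + 1 is positive, so that invertibility of the power gives that of f.
  have hc := hn (n + 1) (Nat.le_succ n)
  have hfp (g : G) (v : V) : (f ^ (n + 1)) (ρ g v) = ρ g ((f ^ (n + 1)) v) := by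
    have := ((hf g).pow_right (n + 1)).eq
    rw [← Module.End.mul_apply, ← this, Module.End.mul_apply]
  let A : Subrepresentation ρ := ⟨LinearMap.ker (f ^ (n + 1)), fun g v hv => by
    rw [LinearMap.mem_ker] at hv ⊢
    rw [hfp, hv, map_zero]⟩
  let B : Subrepresentation ρ := ⟨LinearMap.range (f ^ (n + 1)), by
    rintro g v ⟨w, rfl⟩
    exact ⟨ρ g w, hfp g w⟩⟩
  have hAB : IsCompl A B := by
    refine ⟨disjoint_iff.2 ?_, codisjoint_iff.2 ?_⟩
    · exact Subrepresentation.toSubmodule_injective (disjoint_iff.1 hc.1)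
    · exact Subrepresentation.toSubmodule_injective (codisjoint_iff.1 hc.2)
  rcases hρ.2 A B hAB with h | h
  · right
    have h1 : LinearMap.ker (f ^ (n + 1)) = ⊥ := congrArg Subrepresentation.toSubmodule h
    have h2 := (LinearMap.isUnit_iff_ker_eq_bot _).2 h1
    exact isUnit_pow_succ_iff.1 h2
  · left
    have h1 : LinearMap.range (f ^ (n + 1)) = ⊥ := congrArg Subrepresentation.toSubmodule h
    exact ⟨n + 1, LinearMap.range_eq_bot.1 h1⟩

/-- The endomorphism ring is local. If the sum w is invertible and `f i` is not, then w⁻¹ `f i` is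
nilpotent, so the remaining terms still sum to a unit. -/
theorem IsIndecomposable.exists_isUnit_of_sum (hρ : IsIndecomposable ρ) {ι : Type*}
    (s : Finset ι) (f : ι → Module.End k V) (hf : ∀ i ∈ s, ∀ g, Commute (ρ g) (f i))
    (hs : IsUnit (∑ i ∈ s, f i)) : ∃ i ∈ s, IsUnit (f i) := by
  classical
  have := hρ.1
  induction s using Finset.induction with
  | empty => simp at hs
  | insert i s hi ih =>
    rw [Finset.sum_insert hi] at hs
    by_cases h : IsUnit (f i)
    · exact ⟨i, Finset.mem_insert_self _ _, h⟩
    obtain ⟨w, hw⟩ := hs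
    have hwc (g : G) : Commute (ρ g) (w : Module.End k V) := by
      rw [hw]
      exact (hf i (Finset.mem_insert_self _ _) g).add_right
        (Commute.sum_right _ _ _ fun j hj => hf j (Finset.mem_insert_of_mem hj) g)
    have hnil : IsNilpotent ((↑w⁻¹ : Module.End k V) * f i) := by
      refine (hρ.isNilpotent_or_isUnit fun g => ?_).resolve_right fun h' => h ?_
      · exact (hwc g).units_inv_right.mul_right (hf i (Finset.mem_insert_self _ _) g)
      · rwa [Units.isUnit_units_mul] at h'
    have h1 : (↑w⁻¹ : Module.End k V) * ∑ j ∈ s, f j = 1 - ↑w⁻¹ * f i := by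
      rw [eq_sub_iff_add_eq, add_comm, ← mul_add, ← hw, Units.inv_mul]
    have h2 : IsUnit (∑ j ∈ s, f j) := by
      rw [← Units.isUnit_units_mul w⁻¹, h1]
      exact hnil.isUnit_one_sub
    obtain ⟨j, hj, hju⟩ := ih (fun j hj => hf j (Finset.mem_insert_of_mem hj)) h2
    exact ⟨j, Finset.mem_insert_of_mem hj, hju⟩

/-- An idempotent which is equivariant under `N` is projective as an endomorphism over `U`, or its
complement is and its relative trace is invertible. -/
theorem IsIndecomposable.conjNorm_or_isUnit_relTrace (hρ : IsIndecomposable ρ) {U N : Subgroup G}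
    [Finite (G ⧸ U)] [Fintype U] (hUN : U ≤ N)
    (hTI : ∀ g ∉ N, ∀ u ∈ U, g⁻¹ * u * g ∈ U → u = 1) (hidx : (U.relIndex N : k) ≠ 0)
    {e : Module.End k V} (he : IsIdempotentElem e) (heN : ∀ g ∈ N, Commute (ρ g) e) :
    (∃ b, e = conjNorm ρ U b) ∨
      (IsUnit (relTrace (conj ρ) U e) ∧ ∃ b, 1 - e = conjNorm ρ U b) := by
  have heU : ∀ g ∈ U, Commute (ρ g) e := fun g hg => heN g (hUN hg)
  obtain ⟨b, hb⟩ := exists_relTrace_eq_add_norm (conj ρ) hUN hTI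
    (fun g hg => conj_eq_self_iff.2 (heN g hg))
  -- J plays the role of the ideal of U-endomorphisms that factor through projectives.
  let J : Submodule k (Module.End k V) := LinearMap.range (conjNorm ρ U)
  have hJl {a c : Module.End k V} (ha : ∀ g ∈ U, Commute (ρ g) a) (hc : c ∈ J) : a * c ∈ J := by
    obtain ⟨d, rfl⟩ := hc
    exact ⟨a * d, (mul_conjNorm ha d).symm⟩
  have hJr {a c : Module.End k V} (ha : ∀ g ∈ U, Commute (ρ g) a) (hc : c ∈ J) : c * a ∈ J := by
    obtain ⟨d, rfl⟩ := hc
    exact ⟨d * a, (conjNorm_mul ha d).symm⟩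
  let t : Module.End k V := relTrace (conj ρ) U e
  -- With this scaling Mackey's formula reads f ≡ e modulo J, while f commutes with all of G.
  let f : Module.End k V := (U.relIndex N : k)⁻¹ • t
  have ht : ∀ g, Commute (ρ g) t := commute_relTrace U heU
  have hf : ∀ g, Commute (ρ g) f := fun g => (ht g).smul_right _
  have hfe : f - e ∈ J := by
    refine ⟨(U.relIndex N : k)⁻¹ • b, ?_⟩
    rw [map_smul, eq_sub_iff_add_eq]
    symm
    have h1 : (U.relIndex N : k)⁻¹ • (U.relIndex N • e) = e := by
      rw [← Nat.cast_smul_eq_nsmul k, smul_smul, inv_mul_cancel₀ hidx, one_smul]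
    calc f = (U.relIndex N : k)⁻¹ • (U.relIndex N • e + conjNorm ρ U b) := congrArg ((U.relIndex N : k)⁻¹ • ·) hb
      _ = _ := by rw [smul_add, h1, add_comm]
  rcases hρ.isNilpotent_or_isUnit hf with ⟨n, hn⟩ | hu
  · left
    -- All positive powers of f are congruent to the idempotent e, so nilpotency of f puts e in J.
    have hpow : ∀ m : ℕ, f ^ (m + 1) - e ∈ J := by
      intro m
      induction m with
      | zero => simpa using hfe
      | succ m ih =>
        have : f ^ (m + 1 + 1) - e = (f ^ (m + 1) - e) * f + e * (f - e) := by
          rw [pow_succ f (m + 1), sub_mul, mul_sub, he.eq]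
          abel
        rw [this]
        exact J.add_mem (hJr (fun g _ => hf g) ih) (hJl heU hfe)
    have h0 := hpow n
    rw [pow_succ, hn, zero_mul, zero_sub, neg_mem_iff] at h0
    obtain ⟨c, hc⟩ := h0
    exact ⟨c, hc.symm⟩
  · right
    refine ⟨?_, ?_⟩
    · have : IsUnit ((U.relIndex N : k) • f) := hu.smul (Units.mk0 _ hidx)
      rwa [smul_smul, mul_inv_cancel₀ hidx, one_smul] at this
    · obtain ⟨w, hw⟩ := hu
      have hwi : ∀ g ∈ U, Commute (ρ g) (↑w⁻¹ : Module.End k V) := fun g _ =>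
        Commute.units_inv_right (by rw [hw]; exact hf g)
      -- Modulo J, f is idempotent as well as invertible, hence congruent to 1; therefore e ≡ 1.
      have h1 : f * f - f ∈ J := by
        have : f * f - f = f * (f - e) + (f - e) * e - (f - e) := by
          rw [mul_sub, sub_mul, he.eq]
          abel
        rw [this]
        exact J.sub_mem (J.add_mem (hJl (fun g _ => hf g) hfe) (hJr heU hfe)) hfe
      have h2 : f - 1 ∈ J := by
        have := hJl hwi h1
        rwa [mul_sub, ← mul_assoc, ← hw, Units.inv_mul, one_mul, hw] at this
      have h3 : 1 - e ∈ J := by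
        have := J.sub_mem hfe h2
        rwa [sub_sub_sub_cancel_left] at this
      obtain ⟨c, hc⟩ := h3
      exact ⟨c, hc.symm⟩

end Fitting

/-! ### Averaging over cosets -/

section Average

variable {k : Type*} [Field k] {G : Type*} [Group G] {V W : Type*} [AddCommGroup V] [Module k V]
  [AddCommGroup W] [Module k W] {ρ : Representation k G V} {σ : Representation k G W}
  {Q : Subgroup G} [Finite (G ⧸ Q)]

variable (Q) in
/-- The average over the cosets of `Q` of a `Q`-equivariant map. -/
def average (s : V →ₗ[k] W) (hs : ∀ h ∈ Q, Representation.linHom ρ σ h s = s) :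
    Representation.IntertwiningMap ρ σ where
  toLinearMap := (Q.index : k)⁻¹ • relTrace (Representation.linHom ρ σ) Q s
  isIntertwining' g := by
    have := apply_relTrace (Representation.linHom ρ σ) Q hs g
    rw [LinearMap.smul_comp, LinearMap.comp_smul]
    congr 1
    conv_lhs => rw [← this]
    rw [Representation.linHom_apply, LinearMap.comp_assoc, LinearMap.comp_assoc,
      ← Module.End.mul_eq_comp, ← map_mul, inv_mul_cancel, map_one]
    rfl

theorem average_apply [Fintype (G ⧸ Q)] (s : V →ₗ[k] W)
    (hs : ∀ h ∈ Q, Representation.linHom ρ σ h s = s) (v : V) :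
    average Q s hs v = (Q.index : k)⁻¹ • ∑ c : G ⧸ Q, σ c.out (s (ρ c.out⁻¹ v)) := by
  change (Q.index : k)⁻¹ • (relTrace (Representation.linHom ρ σ) Q s v) = _
  rw [relTrace_apply, LinearMap.sum_apply]
  rfl

theorem average_apply_eq_of_forall {s : V →ₗ[k] W}
    (hs : ∀ h ∈ Q, Representation.linHom ρ σ h s = s) (hQ : (Q.index : k) ≠ 0)
    {v : V} {w : W} (h : ∀ g, σ g (s (ρ g⁻¹ v)) = w) : average Q s hs v = w := by
  have := Fintype.ofFinite (G ⧸ Q)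
  rw [average_apply]
  simp only [h, Finset.sum_const, Finset.card_univ]
  rw [← Nat.card_eq_fintype_card, ← Subgroup.index, ← Nat.cast_smul_eq_nsmul k, smul_smul,
    inv_mul_cancel₀ hQ, one_smul]

theorem average_apply_mem {s : V →ₗ[k] W}
    (hs : ∀ h ∈ Q, Representation.linHom ρ σ h s = s) (S : Submodule k W)
    {v : V} (h : ∀ g, σ g (s (ρ g⁻¹ v)) ∈ S) : average Q s hs v ∈ S := by
  have := Fintype.ofFinite (G ⧸ Q)
  rw [average_apply]
  exact S.smul_mem _ (S.sum_mem fun c _ => h _)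

theorem comp_average {s : V →ₗ[k] W}
    (hs : ∀ h ∈ Q, Representation.linHom ρ σ h s = s) (hQ : (Q.index : k) ≠ 0)
    (f : Representation.IntertwiningMap σ ρ) (hf : ∀ v, f (s v) = v) (v : V) :
    f (average Q s hs v) = v := by
  have := Fintype.ofFinite (G ⧸ Q)
  have h (c : G ⧸ Q) : f (σ c.out (s (ρ c.out⁻¹ v))) = v := by
    rw [f.isIntertwining, hf, Representation.self_inv_apply]
  rw [average_apply, map_smul, map_sum]
  simp only [h, Finset.sum_const, Finset.card_univ]
  rw [← Nat.card_eq_fintype_card, ← Subgroup.index, ← Nat.cast_smul_eq_nsmul k, smul_smul,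
    inv_mul_cancel₀ hQ, one_smul]

/-- A surjection onto a representation which is projective over a subgroup `Q` of invertible index
splits. -/
theorem exists_section_of_conjNorm [Fintype Q] (hQ : (Q.index : k) ≠ 0) {φ : Module.End k V}
    (hφ : conjNorm ρ Q φ = 1) (f : Representation.IntertwiningMap σ ρ) (s : V →ₗ[k] W)
    (hs : ∀ v, f (s v) = v) :
    ∃ s' : Representation.IntertwiningMap ρ σ, ∀ v, f (s' v) = v := by
  -- Tracing s ∘ φ up to Q gives a Q-equivariant section, because f is equivariant and the trace of
  -- φ is 1. Invertibility of the index then allows averaging up to G.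
  let t : V →ₗ[k] W :=
    Representation.norm ((Representation.linHom ρ σ).comp Q.subtype) (s ∘ₗ φ)
  have ht : ∀ h ∈ Q, Representation.linHom ρ σ h t = t := fun h hh =>
    Representation.self_norm_apply ((Representation.linHom ρ σ).comp Q.subtype) ⟨h, hh⟩ _
  refine ⟨average Q t ht, comp_average ht hQ f fun v => ?_⟩
  have h2 := congrArg (fun g : Module.End k V => g v) hφ
  simp only [conjNorm_apply, Module.End.one_apply, LinearMap.sum_apply] at h2
  conv_rhs => rw [← h2]
  change f ((Representation.norm ((Representation.linHom ρ σ).comp Q.subtype) (s ∘ₗ φ)) v) = _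
  rw [Representation.norm, LinearMap.sum_apply, LinearMap.sum_apply, map_sum]
  refine Finset.sum_congr rfl fun q _ => ?_
  change f (σ q (s (φ (ρ (q : G)⁻¹ v)))) = _
  rw [f.isIntertwining, hs]
  rfl

/-- The canonical free cover of the module has a k-linear section; the previous splitting criterion
turns it into a k[G]-linear one. -/
theorem projective_of_conjNorm [Fintype Q] (hQ : (Q.index : k) ≠ 0) {φ : Module.End k V}
    (hφ : conjNorm ρ Q φ = 1) : Module.Projective k[G] ρ.asModule := by
  let X := ρ.asModule →₀ k[G]
  let π : X →ₗ[k[G]] ρ.asModule := Finsupp.linearCombination k[G] id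
  let σ : Representation k G X := Representation.ofModule' X
  have hσ (g : G) (x : X) : σ g x = (MonoidAlgebra.of k G g) • x := rfl
  let f : Representation.IntertwiningMap σ ρ :=
    { toFun := fun x => ρ.asModuleEquiv (π x)
      map_add' := fun x y => by rw [map_add, map_add]
      map_smul' := fun c x => by
        rw [RingHom.id_apply, ← map_smul]
        congr 1
        exact LinearMap.map_smul_of_tower π c x
      isIntertwining' := fun g => LinearMap.ext fun x => by
        change ρ.asModuleEquiv (π (σ g x)) = ρ g (ρ.asModuleEquiv (π x))
        rw [hσ, map_smul, Representation.asModuleEquiv_map_smul, Representation.asAlgebraHom_of] }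
  have hf : Function.Surjective f := fun v =>
    ⟨Finsupp.single (ρ.asModuleEquiv.symm v) 1, by
      change ρ.asModuleEquiv (Finsupp.linearCombination k[G] id _) = v
      rw [Finsupp.linearCombination_single, one_smul]
      rfl⟩
  obtain ⟨s, hs⟩ := f.toLinearMap.exists_rightInverse_of_surjective (LinearMap.range_eq_top.2 hf)
  obtain ⟨s', hs'⟩ := exists_section_of_conjNorm hQ hφ f s fun v => LinearMap.congr_fun hs v
  refine ⟨{ toFun := fun v => s' (ρ.asModuleEquiv v)
            map_add' := fun v w => by rw [map_add, map_add]
            map_smul' := fun c v => ?_ }, fun v => ?_⟩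
  · induction c using MonoidAlgebra.induction_linear with
    | zero => simp
    | add x y hx hy => simp only [add_smul, map_add] at hx hy ⊢; rw [hx, hy]
    | single g a =>
      have h1 : MonoidAlgebra.single g a = a • MonoidAlgebra.of k G g := by simp
      rw [h1, smul_assoc, map_smul, map_smul, Representation.asModuleEquiv_map_smul,
        Representation.asAlgebraHom_of, s'.isIntertwining, hσ, RingHom.id_apply,
        smul_assoc]
  · exact ρ.asModuleEquiv.injective (hs' (ρ.asModuleEquiv v))

end Average

/-! ### Relative projectivity and Higman's criterion -/

section RelProj

variable {k : Type*} [Field k] {G : Type u} [Group G] {V : Type v} [AddCommGroup V] [Module k V]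
  {ρ : Representation k G V}

theorem isRelativelyProjective_of_index_ne_zero (P : Subgroup G) [Finite (G ⧸ P)]
    (hP : (P.index : k) ≠ 0) : IsRelativelyProjective P ρ := by
  intro X _ _ σ f _ ⟨s, hs⟩
  have h : ∀ h ∈ P, Representation.linHom ρ σ h s.toLinearMap = s.toLinearMap := by
    intro h hh
    ext v
    have := s.isIntertwining _ _ (⟨h, hh⟩ : P) (ρ h⁻¹ v)
    change s (ρ h (ρ h⁻¹ v)) = σ h (s (ρ h⁻¹ v)) at this
    rw [Representation.self_inv_apply] at this
    exact this.symm
  exact ⟨average P s.toLinearMap h, comp_average h hP f hs⟩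

theorem isRelativelyProjective_bot_of_conjNorm {Q : Subgroup G} [Finite (G ⧸ Q)] [Fintype Q]
    (hQ : (Q.index : k) ≠ 0) {φ : Module.End k V} (hφ : conjNorm ρ Q φ = 1) :
    IsRelativelyProjective ⊥ ρ := by
  intro X _ _ σ f _ ⟨s, hs⟩
  exact exists_section_of_conjNorm hQ hφ f s.toLinearMap hs

/-- Transitivity of the trace: Q acts freely on G by left translation, so the sum over G groups into
a Q-norm. -/
theorem norm_mem_range_norm [Fintype G] {A : Type*} [AddCommGroup A] [Module k A]
    (α : Representation k G A) (Q : Subgroup G) [Fintype Q] (a : A) :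
    α.norm a ∈ LinearMap.range (Representation.norm (α.comp Q.subtype)) := by
  obtain ⟨b, hb⟩ := exists_sum_eq_norm (T := G) (α.comp Q.subtype) (fun g => α g a)
    (fun u t => by
      change α (u * t) a = _
      rw [map_mul]
      rfl)
    (fun t _ u hu => by
      have : (u : G) * t = t := hu
      exact Subtype.ext (mul_eq_right.1 this))
  refine ⟨b, ?_⟩
  rw [← hb, Representation.norm, LinearMap.sum_apply]

/-- Higman's criterion for the trivial subgroup, obtained by splitting the surjection from the
coinduced module of functions on G. -/
theorem IsRelativelyProjective.exists_norm_conj_eq_one [Fintype G]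
    (hρ : IsRelativelyProjective ⊥ ρ) : ∃ φ, (conj ρ).norm φ = 1 := by
  classical
  let E := Fintype.equivFin G
  -- Functions on G under right translation, indexed by `Fin` so that the module stays in the
  -- universe of V demanded by relative projectivity.
  let σ : Representation k G (Fin (Fintype.card G) → V) :=
    { toFun := fun g => LinearMap.funLeft k V fun i => E (E.symm i * g)
      map_one' := by
        ext
        simp [LinearMap.funLeft_apply]
      map_mul' := fun g h => by
        refine LinearMap.ext fun F => funext fun i => ?_
        simp [LinearMap.funLeft_apply, mul_assoc] }
  have hσ (g h : G) (F : Fin (Fintype.card G) → V) : σ g F (E h) = F (E (h * g)) := by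
    change F (E (E.symm (E h) * g)) = _
    rw [Equiv.symm_apply_apply]
  let f : Representation.IntertwiningMap σ ρ :=
    { toLinearMap := ∑ h : G, ρ h⁻¹ ∘ₗ LinearMap.proj (E h)
      isIntertwining' := fun g => by
        refine LinearMap.ext fun F => ?_
        simp only [LinearMap.comp_apply, LinearMap.sum_apply, LinearMap.proj_apply, map_sum]
        refine Fintype.sum_equiv (Equiv.mulRight g) _ _ fun h => ?_
        rw [hσ, Equiv.coe_mulRight, mul_inv_rev, ← Module.End.mul_apply, ← map_mul,
          mul_inv_cancel_left] }
  have hf (F : Fin (Fintype.card G) → V) : f F = ∑ h : G, ρ h⁻¹ (F (E h)) := by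
    change (∑ h : G, ρ h⁻¹ ∘ₗ LinearMap.proj (E h)) F = _
    simp only [LinearMap.comp_apply, LinearMap.sum_apply, LinearMap.proj_apply]
  let s0 : V →ₗ[k] (Fin (Fintype.card G) → V) := LinearMap.single k (fun _ => V) (E 1)
  have hs0 (v : V) : f (s0 v) = v := by
    rw [hf, Finset.sum_eq_single 1]
    · simp [s0]
    · intro h _ hh
      have : E h ≠ E 1 := fun h' => hh (E.injective h')
      simp [s0, Pi.single_eq_of_ne this]
    · simp
  obtain ⟨s, hs⟩ := hρ _ σ f (fun v => ⟨s0 v, hs0 v⟩)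
    ⟨{ toLinearMap := s0
       isIntertwining' := fun g => by
        obtain rfl : g = 1 := Subsingleton.elim _ _
        rw [map_one, map_one]
        rfl }, hs0⟩
  -- Equivariance determines the section by its value at 1, and the section identity then says that
  -- φ has trace 1.
  let φ : Module.End k V := LinearMap.proj (E 1) ∘ₗ s.toLinearMap
  have hsφ (h : G) (v : V) : s v (E h) = φ (ρ h v) := by
    change _ = s (ρ h v) (E 1)
    rw [s.isIntertwining, hσ, one_mul]
  refine ⟨φ, ?_⟩
  ext v
  rw [Module.End.one_apply]
  conv_rhs => rw [← hs v, hf]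
  rw [Representation.norm, LinearMap.sum_apply, LinearMap.sum_apply]
  refine Fintype.sum_equiv (Equiv.inv G) _ _ fun g => ?_
  rw [hsφ, Equiv.inv_apply, inv_inv]
  rfl

/-- Fixed vectors of a subgroup on a `⊥`-projective representation are norms. -/
theorem IsRelativelyProjective.mem_range_norm [Finite G] (hρ : IsRelativelyProjective ⊥ ρ)
    (Q : Subgroup G) [Fintype Q] {v : V} (hv : ∀ h ∈ Q, ρ h v = v) :
    v ∈ LinearMap.range (Representation.norm (ρ.comp Q.subtype)) := by
  have := Fintype.ofFinite G
  obtain ⟨φ, h1⟩ := hρ.exists_norm_conj_eq_one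
  obtain ⟨ψ, hψ⟩ := norm_mem_range_norm (conj ρ) Q φ
  refine ⟨ψ v, ?_⟩
  rw [← conjNorm_apply_of_fixed ψ hv, conjNorm, hψ, h1, Module.End.one_apply]

end RelProj

/-! ### Jordan blocks -/

section Jordan

variable {k : Type*} [Field k] {V : Type*} [AddCommGroup V] [Module k V]

theorem IsUnipotentJordanBasis.repr_sub_one {n : ℕ} {d : Fin n → ℕ} {f : Module.End k V}
    {b : Module.Basis (Σ i, Fin (d i)) k V} (hb : IsUnipotentJordanBasis f b) (v : V)
    (i : Fin n) (j : Fin (d i)) :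
    b.repr ((f - 1) v) ⟨i, j⟩ =
      if h : j.val + 1 < d i then b.repr v ⟨i, ⟨j.val + 1, h⟩⟩ else 0 := by
  have key : b.coord ⟨i, j⟩ ∘ₗ (f - 1) =
      if h : j.val + 1 < d i then b.coord ⟨i, ⟨j.val + 1, h⟩⟩ else 0 := by
    refine b.ext ?_
    rintro ⟨i', j'⟩
    have h1 : (f - 1) (b ⟨i', j'⟩) = if 0 < j'.val then
        b ⟨i', ⟨j'.val - 1, (Nat.sub_le _ _).trans_lt j'.isLt⟩⟩ else 0 := by
      rw [LinearMap.sub_apply, hb i' j', Module.End.one_apply, add_sub_cancel_left]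
    rw [LinearMap.comp_apply, h1]
    by_cases hi : i' = i
    · subst hi
      split_ifs with h2 h3 h3
      · simp only [Module.Basis.coord_apply, Module.Basis.repr_self, Finsupp.single_apply,
          Sigma.mk.injEq, heq_eq_eq, true_and, Fin.ext_iff]
        congr 1
        exact propext (by omega)
      · simp only [Module.Basis.coord_apply, Module.Basis.repr_self, Finsupp.single_apply,
          Sigma.mk.injEq, heq_eq_eq, true_and, Fin.ext_iff, LinearMap.zero_apply]
        rw [if_neg]
        have := j'.isLt
        omega
      · simp only [map_zero, Module.Basis.coord_apply, Module.Basis.repr_self,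
          Finsupp.single_apply, Sigma.mk.injEq, heq_eq_eq, true_and, Fin.ext_iff]
        rw [if_neg]
        omega
      · simp
    · split_ifs <;> simp [hi]
  have := LinearMap.congr_fun key v
  rw [LinearMap.comp_apply, Module.Basis.coord_apply] at this
  rw [this]
  split_ifs <;> simp

/-- A kernel vector is supported at the bottom of the blocks, and an image vector has no coordinate
at the top of a block. A vector of both kinds is supported at the bottom of blocks of size at least
2, and there is at most one such block. -/
theorem IsMinimallyActive.exists_ker_inf_range_le {G : Type u} [Group G] {x : G}
    {ρ : Representation k G V} (h : IsMinimallyActive x ρ) :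
    ∃ b : V, LinearMap.ker (ρ x - 1) ⊓ LinearMap.range (ρ x - 1) ≤ k ∙ b := by
  obtain ⟨n, d, b, hb, hd⟩ := h
  have hsupp (v : V) (hv : v ∈ LinearMap.ker (ρ x - 1) ⊓ LinearMap.range (ρ x - 1))
      (i : Fin n) (j : Fin (d i)) (hij : b.repr v ⟨i, j⟩ ≠ 0) : j.val = 0 ∧ 2 ≤ d i := by
    obtain ⟨hv, w, rfl⟩ := hv
    constructor
    · by_contra hj
      have h1 := hb.repr_sub_one ((ρ x - 1) w) i ⟨j.val - 1, by omega⟩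
      rw [LinearMap.mem_ker.1 hv] at h1
      have h2 : j.val - 1 + 1 = j.val := by omega
      simp only [h2, map_zero, Finsupp.coe_zero, Pi.zero_apply, j.isLt, dif_pos] at h1
      exact hij h1.symm
    · by_contra h2
      rw [hb.repr_sub_one, dif_neg (by omega)] at hij
      exact hij rfl
  by_cases h : ∃ i, 2 ≤ d i
  · obtain ⟨i, hi⟩ := h
    refine ⟨b ⟨i, ⟨0, by omega⟩⟩, fun v hv => ?_⟩
    rw [Submodule.mem_span_singleton]
    refine ⟨b.repr v ⟨i, ⟨0, by omega⟩⟩, b.repr.injective (Finsupp.ext ?_)⟩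
    rintro ⟨i', j'⟩
    rw [map_smul, Module.Basis.repr_self, Finsupp.smul_single, smul_eq_mul, mul_one]
    by_cases hij : b.repr v ⟨i', j'⟩ = 0
    · by_cases heq : (⟨i', j'⟩ : Σ i, Fin (d i)) = ⟨i, ⟨0, by omega⟩⟩
      · rw [heq, Finsupp.single_eq_same]
      · rw [hij, Finsupp.single_eq_of_ne heq]
    · obtain ⟨h1, h2⟩ := hsupp v hv i' j' hij
      obtain rfl : i' = i := hd h2 hi
      have heq : (⟨i', j'⟩ : Σ i, Fin (d i)) = ⟨i', ⟨0, by omega⟩⟩ := by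
        congr 1
        exact Fin.ext h1
      rw [heq, Finsupp.single_eq_same]
  · refine ⟨0, fun v hv => ?_⟩
    have : v = 0 := b.repr.injective (Finsupp.ext fun ⟨i, j⟩ => by
      by_contra hij
      exact h ⟨i, (hsupp v hv i j (by simpa using hij)).2⟩)
    rw [this]
    exact Submodule.zero_mem _

variable {X : Module.End k V}

theorem exists_pow_apply_mem_ker (hX : IsNilpotent X) {v : V} (hv : v ≠ 0) :
    ∃ j : ℕ, (X ^ j) v ≠ 0 ∧ (X ^ j) v ∈ LinearMap.ker X := by
  classical
  obtain ⟨n, hn⟩ := hX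
  have hex : ∃ n : ℕ, (X ^ n) v = 0 := ⟨n, by rw [hn]; rfl⟩
  have h0 : Nat.find hex ≠ 0 := by
    intro h
    have := Nat.find_spec hex
    rw [h, pow_zero, Module.End.one_apply] at this
    exact hv this
  refine ⟨Nat.find hex - 1, Nat.find_min hex (by omega), ?_⟩
  rw [LinearMap.mem_ker, ← Module.End.mul_apply, ← pow_succ', Nat.sub_add_cancel (by omega)]
  exact Nat.find_spec hex

theorem pow_apply_mem {S : Submodule k V} (hS : ∀ v ∈ S, X v ∈ S) (j : ℕ) {v : V} (hv : v ∈ S) :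
    (X ^ j) v ∈ S := by
  induction j with
  | zero => simpa using hv
  | succ j ih => rw [pow_succ', Module.End.mul_apply]; exact hS _ ih

/-- The map X : im X^j → im X^(j+1), for j ≥ 1, has kernel inside ker X ⊓ im X, so ranks of
successive powers drop by at most one; count down from X^(r+1) = 0. -/
theorem finrank_range_le [FiniteDimensional k V] {r : ℕ} (hr : X ^ (r + 1) = 0) {b : V}
    (hb : LinearMap.ker X ⊓ LinearMap.range X ≤ k ∙ b) :
    Module.finrank k (LinearMap.range X) ≤ r := by
  have key : ∀ i, i ≤ r → Module.finrank k (LinearMap.range (X ^ (r + 1 - i))) ≤ i := by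
    intro i
    induction i with
    | zero =>
      intro _
      rw [Nat.sub_zero, hr, LinearMap.range_zero, finrank_bot]
    | succ i ih =>
      intro hi
      obtain ⟨j, hj⟩ : ∃ j, r + 1 - (i + 1) = j + 1 := ⟨r - i - 1, by omega⟩
      have hj' : r + 1 - i = j + 2 := by omega
      have h1 := ih (by omega)
      rw [hj'] at h1
      rw [hj]
      let f := X.domRestrict (LinearMap.range (X ^ (j + 1)))
      have h2 := LinearMap.finrank_range_add_finrank_ker f
      have h3 : LinearMap.range f = LinearMap.range (X ^ (j + 2)) := by
        rw [LinearMap.range_domRestrict, pow_succ' X (j + 1), Module.End.mul_eq_comp,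
          LinearMap.range_comp]
      have h4 : Module.finrank k (LinearMap.ker f) ≤ 1 := by
        let g : LinearMap.ker f →ₗ[k] (k ∙ b) :=
          LinearMap.codRestrict _ (Submodule.subtype _ ∘ₗ Submodule.subtype _) (by
            rintro ⟨⟨v, hv⟩, hv'⟩
            refine hb ⟨hv', ?_⟩
            obtain ⟨w, rfl⟩ := hv
            exact ⟨(X ^ j) w, by
              change X ((X ^ j) w) = (X ^ (j + 1)) w
              rw [pow_succ']
              rfl⟩)
        have hg : Function.Injective g := by
          rintro ⟨⟨v, hv⟩, hv'⟩ ⟨⟨w, hw⟩, hw'⟩ h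
          have : v = w := congrArg Subtype.val h
          subst this
          rfl
        calc _ ≤ Module.finrank k (k ∙ b) := LinearMap.finrank_le_finrank_of_injective hg
          _ ≤ 1 := (finrank_span_le_card ({b} : Set V)).trans (by simp)
      rw [h3] at h2
      omega
  have := key r le_rfl
  rwa [Nat.add_sub_cancel_left, pow_one] at this

end Jordan

/-! ### A cyclic group of order p in characteristic p -/

section Cyclic

variable {p : ℕ} [Fact p.Prime] {k : Type*} [Field k] [CharP k p] {G : Type*} [Group G]
  {V : Type*} [AddCommGroup V] [Module k V] {ρ : Representation k G V} {x : G}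

theorem sub_one_pow_eq_zero (hx : orderOf x = p) : (ρ x - 1) ^ p = 0 := by
  cases subsingleton_or_nontrivial V
  · exact Subsingleton.elim _ _
  have := charP_of_injective_algebraMap (algebraMap k (Module.End k V)).injective p
  rw [sub_pow_char_of_commute p (Commute.one_right _), one_pow, ← map_pow, ← hx, pow_orderOf_eq_one,
    map_one, sub_self]

/-- In characteristic p, (T - 1)^(p-1) = 1 + T + ⋯ + T^(p-1). -/
theorem norm_zpowers_eq (hx : orderOf x = p) [Fintype (Subgroup.zpowers x)] :
    Representation.norm (ρ.comp (Subgroup.zpowers x).subtype) = (ρ x - 1) ^ (p - 1) := by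
  have hp := (Fact.out : p.Prime)
  have h1 : (Polynomial.X - 1 : Polynomial k) ^ (p - 1) =
      ∑ i ∈ Finset.range p, Polynomial.X ^ i := by
    have h2 : (Polynomial.X - 1 : Polynomial k) ≠ 0 := Polynomial.X_sub_C_ne_zero (1 : k)
    refine mul_right_cancel₀ h2 ?_
    rw [geom_sum_mul, ← pow_succ, Nat.sub_add_cancel hp.one_le, sub_pow_char, one_pow]
  have h3 := congrArg (Polynomial.aeval (ρ x)) h1
  simp only [map_pow, map_sub, Polynomial.aeval_X, map_one, map_sum] at h3
  rw [h3, Representation.norm, ← Fin.sum_univ_eq_sum_range]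
  symm
  have hfin : IsOfFinOrder x := by
    rw [← orderOf_pos_iff, hx]
    exact hp.pos
  refine Fintype.sum_equiv ((finCongr hx.symm).trans (finEquivZPowers hfin)) _ _ fun i => ?_
  simp [finEquivZPowers_apply]

theorem forall_mem_zpowers_apply_eq_iff {v : V} :
    (∀ u ∈ Subgroup.zpowers x, ρ u v = v) ↔ v ∈ LinearMap.ker (ρ x - 1) := by
  rw [LinearMap.mem_ker, LinearMap.sub_apply, Module.End.one_apply, sub_eq_zero]
  refine ⟨fun h => h x (Subgroup.mem_zpowers x), fun h u hu => ?_⟩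
  have : Subgroup.zpowers x ≤
      { carrier := {g | ρ g v = v}
        one_mem' := by simp
        mul_mem' := fun {a b} ha hb => by
          change ρ (a * b) v = v
          rw [map_mul, Module.End.mul_apply, show ρ b v = v from hb, show ρ a v = v from ha]
        inv_mem' := fun {a} ha => by
          change ρ a⁻¹ v = v
          rw [Representation.inv_apply_eq_iff]
          exact (show ρ a v = v from ha).symm } := by
    rw [Subgroup.zpowers_le]
    exact h
  exact this hu

theorem apply_sub_mem_range {u : G} (hu : u ∈ Subgroup.zpowers x) (v : V) :
    ρ u v - v ∈ LinearMap.range (ρ x - 1) := by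
  have : Subgroup.zpowers x ≤
      { carrier := {g | ∀ v, ρ g v - v ∈ LinearMap.range (ρ x - 1)}
        one_mem' := fun v => by
          rw [map_one, Module.End.one_apply, sub_self]
          exact Submodule.zero_mem _
        mul_mem' := fun {a b} ha hb v => by
          have := (LinearMap.range (ρ x - 1)).add_mem (ha (ρ b v)) (hb v)
          rwa [sub_add_sub_cancel, ← Module.End.mul_apply, ← map_mul] at this
        inv_mem' := fun {a} ha v => by
          have := (LinearMap.range (ρ x - 1)).neg_mem (ha (ρ a⁻¹ v))
          rwa [Representation.self_inv_apply, neg_sub] at this } := by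
    rw [Subgroup.zpowers_le]
    exact fun v => ⟨v, rfl⟩
  exact this hu v

variable {n : G} (hn : n ∈ Subgroup.normalizer (Subgroup.zpowers x : Set G))
include hn

theorem normalizer_apply_mem_ker {v : V} (hv : v ∈ LinearMap.ker (ρ x - 1)) :
    ρ n v ∈ LinearMap.ker (ρ x - 1) := by
  rw [← forall_mem_zpowers_apply_eq_iff] at hv ⊢
  intro u hu
  have h1 := hv (n⁻¹ * u * n) ((Subgroup.mem_normalizer_iff''.1 hn u).1 hu)
  conv_rhs => rw [← h1]
  simp only [← Module.End.mul_apply, ← map_mul]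
  congr 2
  group

theorem normalizer_apply_mem_range {v : V} (hv : v ∈ LinearMap.range (ρ x - 1)) :
    ρ n v ∈ LinearMap.range (ρ x - 1) := by
  obtain ⟨w, rfl⟩ := hv
  have h1 := apply_sub_mem_range (ρ := ρ)
    ((Subgroup.mem_normalizer_iff.1 hn x).1 (Subgroup.mem_zpowers x)) (ρ n w)
  convert h1 using 1
  rw [LinearMap.sub_apply, Module.End.one_apply, map_sub]
  simp only [← Module.End.mul_apply, ← map_mul]
  congr 3
  group

end Cyclic

/-! ### Summands of permutation modules -/

section InducedTrivial

variable {k : Type*} [Field k] {G : Type*} [Group G] (P : Subgroup G)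

variable (k) in
/-- The image in the representation induced from the trivial representation of `P` of the basis
vector of `k[G]` belonging to `g`. -/
def indBasis (g : G) : Representation.IndV P.subtype (Representation.trivial k P k) :=
  Representation.IndV.mk P.subtype (Representation.trivial k P k) g 1

theorem indBasis_mul {q : G} (hq : q ∈ P) (g : G) : indBasis k P (q * g) = indBasis k P g := by
  have := Representation.Coinvariants.mk_self_apply
    (Representation.tprod ((Representation.leftRegular k G).comp P.subtype)
      (Representation.trivial k P k)) ⟨q, hq⟩ (MonoidAlgebra.single g (1 : k) ⊗ₜ[k] (1 : k))
  simp only [Representation.tprod_apply, TensorProduct.map_tmul, MonoidHom.comp_apply,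
    Representation.ofMulAction_single, Representation.trivial_apply] at this
  exact this

theorem ind_indBasis (g h : G) :
    Representation.ind P.subtype (Representation.trivial k P k) g (indBasis k P h) =
      indBasis k P (h * g⁻¹) :=
  Representation.ind_mk _ _ _ _ _

variable {P} in
theorem ind_hom_ext {W : Type*} [AddCommGroup W] [Module k W]
    {f f' : Representation.IndV P.subtype (Representation.trivial k P k) →ₗ[k] W}
    (h : ∀ g, f (indBasis k P g) = f' (indBasis k P g)) : f = f' :=
  Representation.IndV.hom_ext _ _ fun g => LinearMap.ext_ring (h g)

variable {W : Type*} [AddCommGroup W] [Module k W]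

variable (k) in
/-- The linear map on an induced trivial representation with prescribed values on the basis. -/
def indLift (F : G → W) (hF : ∀ q ∈ P, ∀ g, F (q * g) = F g) :
    Representation.IndV P.subtype (Representation.trivial k P k) →ₗ[k] W :=
  Representation.Coinvariants.lift _
    ((Finsupp.linearCombination k F ∘ₗ (MonoidAlgebra.coeffLinearEquiv k).toLinearMap) ∘ₗ
      (TensorProduct.rid k k[G]).toLinearMap) (by
        rintro ⟨q, hq⟩
        refine TensorProduct.ext (MonoidAlgebra.lhom_ext' fun g => LinearMap.ext_ring
          (LinearMap.ext_ring ?_))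
        simp [hF q hq])

theorem indLift_indBasis (F : G → W) (hF : ∀ q ∈ P, ∀ g, F (q * g) = F g) (g : G) :
    indLift k P F hF (indBasis k P g) = F g := by
  change Finsupp.linearCombination k F ((MonoidAlgebra.coeffLinearEquiv k)
    (TensorProduct.rid k k[G] (MonoidAlgebra.single g (1 : k) ⊗ₜ[k] (1 : k)))) = F g
  simp

variable {V : Type*} [AddCommGroup V] [Module k V] {ρ : Representation k G V}

theorem conj_smulRight (g : G) (v : V) (l : V →ₗ[k] k) :
    conj ρ g (l.smulRight v) = (l ∘ₗ ρ g⁻¹).smulRight (ρ g v) := by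
  ext m
  simp

variable {P} in
theorem commute_smulRight {v : V} {l : V →ₗ[k] k} (hv : ∀ h ∈ P, ρ h v = v)
    (hl : ∀ h ∈ P, ∀ m, l (ρ h m) = l m) (h : G) (hh : h ∈ P) :
    Commute (ρ h) (l.smulRight v : Module.End k V) := by
  rw [← conj_eq_self_iff, conj_smulRight, hv h hh]
  congr 1
  ext m
  exact hl _ (P.inv_mem hh) m

variable {P} in
theorem dual_apply_inv_out_smul {l : V →ₗ[k] k} (hl : ∀ h ∈ P, ∀ m, l (ρ h m) = l m) (g : G)
    (c : G ⧸ P) (m : V) : l (ρ (g • c).out⁻¹ (ρ g m)) = l (ρ c.out⁻¹ m) := by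
  have hmk : (g • c).out⁻¹ * (g * c.out) ∈ P := by
    refine QuotientGroup.eq.1 ?_
    rw [QuotientGroup.out_eq', ← smul_eq_mul, ← MulAction.Quotient.smul_coe,
      QuotientGroup.out_eq']
  rw [← hl _ hmk (ρ c.out⁻¹ m)]
  simp only [← Module.End.mul_apply, ← map_mul]
  congr 3
  group

theorem relTrace_smulRight_apply [Fintype (G ⧸ P)] (v : V) (l : V →ₗ[k] k) (m : V) :
    relTrace (conj ρ) P (l.smulRight v : Module.End k V) m =
      ∑ c : G ⧸ P, l (ρ c.out⁻¹ m) • ρ c.out v := by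
  rw [relTrace_apply, LinearMap.sum_apply]
  refine Finset.sum_congr rfl fun c _ => ?_
  rw [conj_smulRight]
  rfl

-- The maps m ↦ ∑ l(c⁻¹ m) [c] and [c] ↦ c v are equivariant, and their composite is exactly the
-- relative trace of the rank-one map l ⊗ v. Dividing by this unit gives the retraction.
variable {P} in
theorem isSummand_ind_trivial_of_isUnit [Finite (G ⧸ P)] {v : V} {l : V →ₗ[k] k}
    (hv : ∀ h ∈ P, ρ h v = v) (hl : ∀ h ∈ P, ∀ m, l (ρ h m) = l m)
    (hu : IsUnit (relTrace (conj ρ) P (l.smulRight v : Module.End k V))) :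
    IsSummand ρ (Representation.ind P.subtype (Representation.trivial k P k)) := by
  have := Fintype.ofFinite (G ⧸ P)
  obtain ⟨w, hw⟩ := hu
  have hwc (g : G) : Commute (ρ g) (↑w⁻¹ : Module.End k V) :=
    Commute.units_inv_right (by rw [hw]; exact commute_relTrace P (commute_smulRight hv hl) g)
  let α := Representation.linHom ρ (Representation.ind P.subtype (Representation.trivial k P k))
  let i₀ : V →ₗ[k] Representation.IndV P.subtype (Representation.trivial k P k) :=
    l.smulRight (indBasis k P 1)
  have hi₀ : ∀ h ∈ P, α h i₀ = i₀ := by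
    intro h hh
    ext m
    change Representation.ind P.subtype (Representation.trivial k P k) h
      (l (ρ h⁻¹ m) • indBasis k P 1) = l m • indBasis k P 1
    rw [map_smul, ind_indBasis, hl _ (P.inv_mem hh), one_mul, ← mul_one h⁻¹,
      indBasis_mul P (P.inv_mem hh)]
  let i : V →ₗ[k] Representation.IndV P.subtype (Representation.trivial k P k) := relTrace α P i₀
  have hi (g : G) : i ∘ₗ ρ g =
      Representation.ind P.subtype (Representation.trivial k P k) g ∘ₗ i := by
    have := apply_relTrace α P hi₀ g
    conv_lhs => rw [show i = relTrace α P i₀ from rfl, ← this]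
    change (_ ∘ₗ i ∘ₗ ρ g⁻¹) ∘ₗ ρ g = _
    rw [LinearMap.comp_assoc, LinearMap.comp_assoc, ← Module.End.mul_eq_comp (ρ g⁻¹), ← map_mul,
      inv_mul_cancel, map_one]
    rfl
  let r : Representation.IndV P.subtype (Representation.trivial k P k) →ₗ[k] V :=
    indLift k P (fun g => ρ g⁻¹ v) (fun q hq g => by
      rw [mul_inv_rev, map_mul, Module.End.mul_apply, hv _ (P.inv_mem hq)])
  have hr (g : G) : r ∘ₗ Representation.ind P.subtype (Representation.trivial k P k) g =
      ρ g ∘ₗ r := by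
    refine ind_hom_ext fun h => ?_
    rw [LinearMap.comp_apply, LinearMap.comp_apply, ind_indBasis, indLift_indBasis,
      indLift_indBasis, mul_inv_rev, inv_inv, map_mul, Module.End.mul_apply]
  have hri (m : V) : r (i m) = (w : Module.End k V) m := by
    rw [hw, relTrace_smulRight_apply]
    change r ((relTrace α P i₀) m) = _
    rw [relTrace_apply, LinearMap.sum_apply, map_sum]
    refine Finset.sum_congr rfl fun c _ => ?_
    change r (Representation.ind P.subtype (Representation.trivial k P k) c.out
      (l (ρ c.out⁻¹ m) • indBasis k P 1)) = _
    rw [map_smul, map_smul, ind_indBasis, indLift_indBasis, one_mul, inv_inv]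
  refine ⟨⟨i, hi⟩, ⟨(↑w⁻¹ : Module.End k V) ∘ₗ r, fun g => ?_⟩, fun m => ?_⟩
  · rw [LinearMap.comp_assoc, hr, ← LinearMap.comp_assoc, ← LinearMap.comp_assoc]
    congr 1
    exact (hwc g).eq.symm
  · change (↑w⁻¹ : Module.End k V) (r (i m)) = m
    rw [hri, ← Module.End.mul_apply, Units.inv_mul, Module.End.one_apply]

/-- The indicator function of P reads off the coefficient of the trivial coset; its translates read
off all the others. -/
theorem indBasis_expansion [Fintype (G ⧸ P)] [DecidablePred (· ∈ P)]
    (hF : ∀ q ∈ P, ∀ g, (if q * g ∈ P then 1 else 0 : k) = if g ∈ P then 1 else 0)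
    (y : Representation.IndV P.subtype (Representation.trivial k P k)) :
    ∑ c : G ⧸ P, indLift k P (fun g => if g ∈ P then (1 : k) else 0) hF
      (Representation.ind P.subtype (Representation.trivial k P k) c.out⁻¹ y) •
        indBasis k P c.out⁻¹ = y := by
  suffices h : ∑ c : G ⧸ P, (indLift k P (fun g => if g ∈ P then (1 : k) else 0) hF ∘ₗ
      Representation.ind P.subtype (Representation.trivial k P k) c.out⁻¹).smulRight
        (indBasis k P c.out⁻¹) = LinearMap.id by
    have := LinearMap.congr_fun h y
    rw [LinearMap.sum_apply] at this
    exact this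
  refine ind_hom_ext fun h => ?_
  rw [LinearMap.sum_apply, LinearMap.id_apply, Finset.sum_eq_single ((h⁻¹ : G) : G ⧸ P)]
  · have h1 : h * ((h⁻¹ : G) : G ⧸ P).out ∈ P := by
      have := QuotientGroup.eq.1 (QuotientGroup.out_eq' ((h⁻¹ : G) : G ⧸ P)).symm
      rwa [inv_inv] at this
    rw [LinearMap.smulRight_apply, LinearMap.comp_apply, ind_indBasis, indLift_indBasis, inv_inv,
      if_pos h1, one_smul]
    conv_rhs => rw [← indBasis_mul P (P.inv_mem h1)]
    congr 1
    group
  · intro c _ hc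
    rw [LinearMap.smulRight_apply, LinearMap.comp_apply, ind_indBasis, indLift_indBasis, inv_inv,
      if_neg, zero_smul]
    intro h1
    apply hc
    rw [← QuotientGroup.out_eq' c]
    symm
    exact QuotientGroup.eq.2 (by rwa [inv_inv])
  · simp

-- Take for v the image of the trivial coset under the retraction, and for l its coefficient after
-- the embedding.
variable {P} in
theorem IsSummand.exists_relTrace_eq_one [Finite (G ⧸ P)]
    (h : IsSummand ρ (Representation.ind P.subtype (Representation.trivial k P k))) :
    ∃ (v : V) (l : V →ₗ[k] k), (∀ h ∈ P, ρ h v = v) ∧ (∀ h ∈ P, ∀ m, l (ρ h m) = l m) ∧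
      relTrace (conj ρ) P (l.smulRight v : Module.End k V) = 1 := by
  classical
  have := Fintype.ofFinite (G ⧸ P)
  obtain ⟨i, r, hir⟩ := h
  have hF : ∀ q ∈ P, ∀ g, (if q * g ∈ P then 1 else 0 : k) = if g ∈ P then 1 else 0 := by
    intro q hq g
    simp only [P.mul_mem_cancel_left hq]
  let f := indLift k P (fun g => if g ∈ P then (1 : k) else 0) hF
  refine ⟨r (indBasis k P 1), f ∘ₗ i.toLinearMap, fun h hh => ?_, fun h hh m => ?_, ?_⟩
  · rw [← r.isIntertwining, ind_indBasis, one_mul, ← mul_one h⁻¹, indBasis_mul P (P.inv_mem hh)]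
  · change f (i (ρ h m)) = f (i m)
    rw [i.isIntertwining]
    generalize i m = y
    suffices hs : f ∘ₗ Representation.ind P.subtype (Representation.trivial k P k) h = f from
      LinearMap.congr_fun hs y
    refine ind_hom_ext fun g => ?_
    rw [LinearMap.comp_apply, ind_indBasis, indLift_indBasis, indLift_indBasis]
    simp only [P.mul_mem_cancel_right (P.inv_mem hh)]
  · ext m
    rw [relTrace_smulRight_apply, Module.End.one_apply]
    conv_rhs => rw [← hir m, ← indBasis_expansion P hF (i m), map_sum]
    refine Finset.sum_congr rfl fun c _ => ?_
    rw [map_smul, ← r.isIntertwining, ind_indBasis, one_mul, ← i.isIntertwining]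
    rfl

end InducedTrivial

/-! ### Recognizing trivial-source modules -/

section TrivialSource

variable {k : Type*} [Field k] {G : Type u} [Group G] {V : Type v} [AddCommGroup V] [Module k V]
  {ρ : Representation k G V}

theorem isIndecomposable_trivial : IsIndecomposable (Representation.trivial k G k) := by
  refine ⟨inferInstance, fun A B h => ?_⟩
  rcases eq_bot_or_eq_top A.toSubmodule with hA | hA
  · exact Or.inl (Subrepresentation.toSubmodule_injective hA)
  · right
    have h1 : A = ⊤ := Subrepresentation.toSubmodule_injective hA
    rw [h1] at h
    exact top_disjoint.1 h.1

/-- A basis of im e splits e into rank-one maps with P-fixed vectors and P-invariant functionals.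
Their traces sum to a unit, so by locality one of them is already a unit. -/
theorem IsIndecomposable.isSummand_ind_trivial [FiniteDimensional k V] (hρ : IsIndecomposable ρ)
    {P : Subgroup G} [Finite (G ⧸ P)] {e : Module.End k V} (hl : ∀ h ∈ P, ρ h * e = e)
    (hr : ∀ h ∈ P, e * ρ h = e) (hu : IsUnit (relTrace (conj ρ) P e)) :
    IsSummand ρ (Representation.ind P.subtype (Representation.trivial k P k)) := by
  let b := Module.finBasis k (LinearMap.range e)
  let l : Fin _ → V →ₗ[k] k := fun j => b.coord j ∘ₗ e.rangeRestrict
  have he : e = ∑ j, (l j).smulRight (b j : V) := by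
    ext m
    have := congrArg Subtype.val (b.sum_repr (e.rangeRestrict m))
    rw [LinearMap.sum_apply]
    refine this.symm.trans ?_
    rw [AddSubmonoidClass.coe_finsetSum]
    rfl
  have hv (j) : ∀ h ∈ P, ρ h (b j) = b j := by
    intro h hh
    obtain ⟨m, hm⟩ := (b j).2
    rw [← hm, ← Module.End.mul_apply, hl h hh]
  have hlj (j) : ∀ h ∈ P, ∀ m, l j (ρ h m) = l j m := by
    intro h hh m
    have : e.rangeRestrict (ρ h m) = e.rangeRestrict m := Subtype.ext (by
      change (e * ρ h) m = e m
      rw [hr h hh])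
    change b.coord j (e.rangeRestrict (ρ h m)) = _
    rw [this]
    rfl
  rw [he, map_sum] at hu
  obtain ⟨j, -, hj⟩ := hρ.exists_isUnit_of_sum _ _
    (fun j _ => commute_relTrace P (commute_smulRight (hv j) (hlj j))) hu
  exact isSummand_ind_trivial_of_isUnit (hv j) (hlj j) hj

/-- The fixed vectors which come from augmentation vanish in a summand of a permutation module on
which the norm of `U` vanishes. -/
theorem eq_zero_of_isSummand_ind_trivial {p : ℕ} [Fact p.Prime] {P : Subgroup G} [Finite (G ⧸ P)]
    (hP : IsSummand ρ (Representation.ind P.subtype (Representation.trivial k P k))) {x : G}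
    (hx : orderOf x = p) [Fintype (Subgroup.zpowers x)]
    (hnorm : Representation.norm (ρ.comp (Subgroup.zpowers x).subtype) = 0) {m : V}
    (hm : m ∈ LinearMap.ker (ρ x - 1) ⊓ LinearMap.range (ρ x - 1)) : m = 0 := by
  have := Fintype.ofFinite (G ⧸ P)
  obtain ⟨v, l, hv, hl, h1⟩ := hP.exists_relTrace_eq_one
  obtain ⟨hm, w, hw⟩ := hm
  have hfix := forall_mem_zpowers_apply_eq_iff.2 hm
  -- Here m = ∑ l(c⁻¹ m) c v over the cosets. If some u ≠ 1 in ⟨x⟩ fixes c, so does x, and the term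
  -- vanishes: m = x w - w, and l ∘ c⁻¹ is x-invariant. The free orbits sum to a norm, which is 0.
  obtain ⟨b, hb⟩ := exists_sum_eq_norm (T := G ⧸ P) (ρ.comp (Subgroup.zpowers x).subtype)
    (fun c => l (ρ c.out⁻¹ m) • ρ c.out v)
    (by
      intro u c
      change l (ρ ((u : G) • c).out⁻¹ m) • ρ ((u : G) • c).out v = ρ u _
      rw [apply_out_smul hv, map_smul]
      conv_lhs => rw [← hfix u u.2, dual_apply_inv_out_smul hl])
    (by
      intro c hc u hu
      by_contra hu1
      apply hc
      have hx' := mem_zpowers_of_prime_card (p := p) (by rw [Nat.card_zpowers, hx]) hu1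
        (g' := ⟨x, Subgroup.mem_zpowers x⟩)
      have hstab : (⟨x, Subgroup.mem_zpowers x⟩ : Subgroup.zpowers x) ∈
          MulAction.stabilizer (Subgroup.zpowers x) c :=
        (Subgroup.zpowers_le.2 (MulAction.mem_stabilizer_iff.2 hu)) hx'
      have hxc : x • c = c := hstab
      have := dual_apply_inv_out_smul hl x c w
      rw [hxc] at this
      rw [← hw, LinearMap.sub_apply, map_sub, map_sub, this, Module.End.one_apply, sub_self,
        zero_smul])
  have h2 := LinearMap.congr_fun h1 m
  rw [relTrace_smulRight_apply, hb, hnorm] at h2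
  exact h2.symm

end TrivialSource

/-! ### Spanning the endomorphism ring and absolute irreducibility -/

section Span

/-- The matrix units over K are base changes of matrix units over R. -/
theorem span_extendScalars {R : Type*} [CommRing R] (K : Type*) [CommRing K] [Algebra R K]
    {G : Type u} [Group G] {V : Type v} [AddCommGroup V] [Module R V] {ι : Type*} [Finite ι]
    (b : Module.Basis ι R V) (ρ : Representation R G V)
    (h : Submodule.span R (Set.range ρ) = ⊤) :
    Submodule.span K (Set.range (extendScalars K ρ)) = ⊤ := by
  classical
  have := Fintype.ofFinite ι
  have hbc (f : Module.End R V) :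
      f.baseChange K ∈ Submodule.span K (Set.range (extendScalars K ρ)) := by
    have hf : f ∈ Submodule.span R (Set.range ρ) := h ▸ Submodule.mem_top
    induction hf using Submodule.span_induction with
    | mem f hf =>
      obtain ⟨g, rfl⟩ := hf
      exact Submodule.subset_span ⟨g, rfl⟩
    | zero => rw [LinearMap.baseChange_zero]; exact Submodule.zero_mem _
    | add f f' _ _ hf hf' => rw [LinearMap.baseChange_add]; exact Submodule.add_mem _ hf hf'
    | smul r f _ hf =>
      rw [LinearMap.baseChange_smul, ← algebraMap_smul K r]
      exact Submodule.smul_mem _ _ hf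
  rw [eq_top_iff]
  intro f _
  let B := b.baseChange K
  have hf : f = ∑ i, ∑ j, B.repr (f (B j)) i • ((b.coord j).smulRight (b i)).baseChange K := by
    refine B.ext fun j => ?_
    simp only [LinearMap.sum_apply, LinearMap.smul_apply, B, Module.Basis.baseChange_apply,
      LinearMap.baseChange_tmul, LinearMap.smulRight_apply, Module.Basis.coord_apply,
      Module.Basis.repr_self, Finsupp.single_apply]
    conv_lhs => rw [← B.sum_repr (f (1 ⊗ₜ[R] b j))]
    refine Finset.sum_congr rfl fun i _ => ?_
    rw [Finset.sum_eq_single j]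
    · simp [B]
    · intro j' _ hj'
      rw [if_neg hj'.symm, zero_smul, TensorProduct.tmul_zero, smul_zero]
    · simp
  rw [hf]
  exact Submodule.sum_mem _ fun i _ => Submodule.sum_mem _ fun j _ =>
    Submodule.smul_mem _ _ (hbc _)

variable {k : Type v} [Field k] {G : Type u} [Group G] {V : Type w} [AddCommGroup V] [Module k V]
  {ρ : Representation k G V}

theorem isIrreducible_of_span_eq_top [Nontrivial V]
    (h : Submodule.span k (Set.range ρ) = ⊤) : ρ.IsIrreducible := by
  have : Nontrivial (Subrepresentation ρ) :=
    ⟨⟨⊥, ⊤, fun h => bot_ne_top (congrArg Subrepresentation.toSubmodule h)⟩⟩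
  refine ⟨fun S => ?_⟩
  by_cases hS : S.toSubmodule = ⊥
  · exact Or.inl (Subrepresentation.toSubmodule_injective hS)
  right
  obtain ⟨v, hv, hv0⟩ := Submodule.exists_mem_ne_zero_of_ne_bot hS
  refine Subrepresentation.toSubmodule_injective (eq_top_iff.2 fun w _ => ?_)
  obtain ⟨f, hf⟩ : ∃ f : Module.Dual k V, f v = 1 := by
    obtain ⟨f, hf⟩ : ∃ f : Module.Dual k V, f v ≠ 0 := by
      by_contra! h
      exact hv0 ((Module.forall_dual_apply_eq_zero_iff k v).1 h)
    exact ⟨(f v)⁻¹ • f, by simp [hf]⟩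
  have key : ∀ a ∈ Submodule.span k (Set.range ρ), a v ∈ S.toSubmodule := by
    intro a ha
    induction ha using Submodule.span_induction with
    | mem f hf =>
      obtain ⟨g, rfl⟩ := hf
      exact S.apply_mem_toSubmodule g hv
    | zero => exact Submodule.zero_mem _
    | add f f' _ _ hf hf' => exact Submodule.add_mem _ hf hf'
    | smul r f _ hf => exact Submodule.smul_mem _ _ hf
  have := key (f.smulRight w) (h ▸ Submodule.mem_top)
  rwa [LinearMap.smulRight_apply, hf, one_smul] at this

theorem isAbsolutelyIrreducible_of_span_eq_top [FiniteDimensional k V] [Nontrivial V]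
    (h : Submodule.span k (Set.range ρ) = ⊤) : IsAbsolutelyIrreducible ρ := fun K _ _ => by
  have : Nontrivial (K ⊗[k] V) := Module.FaithfullyFlat.lTensor_nontrivial k K V
  exact isIrreducible_of_span_eq_top (span_extendScalars K (Module.finBasis k V) ρ h)

/-- An irreducible representation for which the group algebra contains an operator of rank one is
absolutely irreducible. -/
theorem span_eq_top_of_smulRight_mem [FiniteDimensional k V] (hρ : ρ.IsIrreducible) {v : V}
    {l : Module.Dual k V} (hv : v ≠ 0) (hl : l ≠ 0)
    (hvl : l.smulRight v ∈ Submodule.span k (Set.range ρ)) :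
    Submodule.span k (Set.range ρ) = ⊤ := by
  have hleft (g : G) {a : Module.End k V} (ha : a ∈ Submodule.span k (Set.range ρ)) :
      ρ g * a ∈ Submodule.span k (Set.range ρ) := by
    induction ha using Submodule.span_induction with
    | mem f hf =>
      obtain ⟨h, rfl⟩ := hf
      exact Submodule.subset_span ⟨g * h, map_mul ρ g h⟩
    | zero => rw [mul_zero]; exact Submodule.zero_mem _
    | add f f' _ _ hf hf' => rw [mul_add]; exact Submodule.add_mem _ hf hf'
    | smul r f _ hf => rw [mul_smul_comm]; exact Submodule.smul_mem _ _ hf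
  have hright (g : G) {a : Module.End k V} (ha : a ∈ Submodule.span k (Set.range ρ)) :
      a * ρ g ∈ Submodule.span k (Set.range ρ) := by
    induction ha using Submodule.span_induction with
    | mem f hf =>
      obtain ⟨h, rfl⟩ := hf
      exact Submodule.subset_span ⟨h * g, map_mul ρ h g⟩
    | zero => rw [zero_mul]; exact Submodule.zero_mem _
    | add f f' _ _ hf hf' => rw [add_mul]; exact Submodule.add_mem _ hf hf'
    | smul r f _ hf => rw [smul_mul_assoc]; exact Submodule.smul_mem _ _ hf
  -- The vectors w for which l ⊗ w comes from the group algebra; they include v, so irreducibility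
  -- makes this everything.
  let A : Subrepresentation ρ :=
    { toSubmodule :=
        (Submodule.span k (Set.range ρ)).comap (LinearMap.smulRightₗ l)
      apply_mem_toSubmodule := fun g w hw => by
        have := hleft g hw
        rw [Submodule.mem_comap]
        convert this using 1
        ext m
        simp }
  have hA : A = ⊤ := (hρ.eq_bot_or_eq_top A).resolve_left fun h => hv (by
    have : v ∈ A.toSubmodule := hvl
    rw [h] at this
    exact (Submodule.mem_bot k).1 this)
  have hA' (w : V) : l.smulRight w ∈ Submodule.span k (Set.range ρ) := by
    have : w ∈ A.toSubmodule := by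
      rw [hA]
      exact Submodule.mem_top
    exact this
  -- The dual argument: the functionals that work for all w contain l and are stable under G, so
  -- their common kernel is a proper subrepresentation, hence 0.
  let D : Submodule k (Module.Dual k V) :=
    { carrier := {m | ∀ w, (m : V →ₗ[k] k).smulRight w ∈ Submodule.span k (Set.range ρ)}
      add_mem' := fun {m m'} hm hm' w => by
        have := Submodule.add_mem _ (hm w) (hm' w)
        convert this using 1
        ext y
        simp [add_smul]
      zero_mem' := fun w => by
        convert Submodule.zero_mem (Submodule.span k (Set.range ρ))
        ext m
        simp
      smul_mem' := fun c m hm w => by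
        have := Submodule.smul_mem _ c (hm w)
        convert this using 1
        ext y
        simp [mul_smul] }
  have hDg (g : G) {m : Module.Dual k V} (hm : m ∈ D) : m ∘ₗ ρ g ∈ D := fun w => hright g (hm w)
  let E : Subrepresentation ρ :=
    { toSubmodule := D.dualCoannihilator
      apply_mem_toSubmodule := fun g w hw => by
        rw [Submodule.mem_dualCoannihilator] at hw ⊢
        exact fun m hm => hw _ (hDg g hm) }
  have hE : E = ⊥ := (hρ.eq_bot_or_eq_top E).resolve_right fun h => hl (by
    ext w
    have : w ∈ E.toSubmodule := by
      rw [h]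
      exact Submodule.mem_top
    exact (Submodule.mem_dualCoannihilator w).1 this l hA')
  have hD : D = ⊤ := by
    rw [← Subspace.dualCoannihilator_dualAnnihilator_eq (W := D),
      show D.dualCoannihilator = ⊥ from congrArg Subrepresentation.toSubmodule hE,
      Submodule.dualAnnihilator_bot]
  rw [eq_top_iff]
  intro f _
  let b := Module.finBasis k V
  have hf : f = ∑ j, (b.coord j).smulRight (f (b j)) := by
    refine b.ext fun j => ?_
    rw [LinearMap.sum_apply, Finset.sum_eq_single j]
    · simp
    · intro j' _ hj'
      simp [Finsupp.single_eq_of_ne hj']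
    · simp
  rw [hf]
  refine Submodule.sum_mem _ fun j _ => ?_
  have : b.coord j ∈ D := hD ▸ Submodule.mem_top
  exact this _

end Span

/-! ### Lattices and their reduction modulo p -/

section Reduction

variable {p : ℕ} [Fact p.Prime] {G : Type u} [Group G] {M : Type v} [AddCommGroup M]
  [Module (ZMod p) M] {L : Type w} [AddCommGroup L] [Module ℤ_[p] L]
  {π : L →ₛₗ[(PadicInt.toZMod : ℤ_[p] →+* ZMod p)] M} {ι : Type*}

theorem toZMod_eq_zero_iff {a : ℤ_[p]} : PadicInt.toZMod a = 0 ↔ ∃ c, a = p * c := by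
  rw [← RingHom.mem_ker, PadicInt.ker_toZMod, PadicInt.maximalIdeal_eq_span_p,
    Ideal.mem_span_singleton]
  rfl

theorem toZMod_surjective : Function.Surjective (PadicInt.toZMod : ℤ_[p] →+* ZMod p) :=
  ZMod.ringHom_surjective _

/-- The basis of the reduction modulo `p` given by a basis of a lattice. -/
def reductionBasis [Finite ι] (b : Module.Basis ι ℤ_[p] L) (hπ : Function.Surjective π)
    (hker : ∀ y, π y = 0 ↔ ∃ z, y = (p : ℤ_[p]) • z) : Module.Basis ι (ZMod p) M :=
  letI := Fintype.ofFinite ι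
  Module.Basis.mk (v := fun i => π (b i)) (by
    rw [Fintype.linearIndependent_iff]
    intro c hc
    choose d hd using fun i => toZMod_surjective (p := p) (c i)
    have h1 : π (∑ i, d i • b i) = 0 := by
      rw [map_sum, ← hc]
      exact Finset.sum_congr rfl fun i _ => by rw [LinearMap.map_smulₛₗ, hd]
    obtain ⟨z, hz⟩ := (hker _).1 h1
    intro i
    have h2 := congrArg (fun y => b.repr y i) hz
    simp only [map_sum, map_smul, Module.Basis.repr_self, Finsupp.smul_single, smul_eq_mul,
      mul_one, Finsupp.coe_finsetSum, Finset.sum_apply, Finsupp.smul_apply] at h2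
    rw [Finset.sum_eq_single i (fun j _ hj => Finsupp.single_eq_of_ne hj.symm) (by simp),
      Finsupp.single_eq_same] at h2
    rw [← hd, toZMod_eq_zero_iff]
    exact ⟨_, h2⟩) (by
    intro m _
    obtain ⟨y, rfl⟩ := hπ m
    rw [← b.sum_repr y, map_sum]
    refine Submodule.sum_mem _ fun i _ => ?_
    rw [LinearMap.map_smulₛₗ]
    exact Submodule.smul_mem _ _ (Submodule.subset_span ⟨i, rfl⟩))

theorem reductionBasis_apply [Finite ι] (b : Module.Basis ι ℤ_[p] L)
    (hπ : Function.Surjective π) (hker : ∀ y, π y = 0 ↔ ∃ z, y = (p : ℤ_[p]) • z) (i : ι) :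
    reductionBasis b hπ hker i = π (b i) := by
  simp [reductionBasis]

theorem reductionBasis_repr [Finite ι] (b : Module.Basis ι ℤ_[p] L)
    (hπ : Function.Surjective π) (hker : ∀ y, π y = 0 ↔ ∃ z, y = (p : ℤ_[p]) • z) (y : L) (i : ι) :
    (reductionBasis b hπ hker).repr (π y) i = PadicInt.toZMod (b.repr y i) := by
  classical
  have := Fintype.ofFinite ι
  conv_lhs => rw [← b.sum_repr y, map_sum, map_sum]
  rw [Finsupp.coe_finsetSum, Finset.sum_apply, Finset.sum_eq_single i]
  · rw [LinearMap.map_smulₛₗ, ← reductionBasis_apply b hπ hker, map_smul, Module.Basis.repr_self]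
    simp
  · intro j _ hj
    rw [LinearMap.map_smulₛₗ, ← reductionBasis_apply b hπ hker, map_smul, Module.Basis.repr_self]
    simp [Finsupp.single_eq_of_ne hj.symm]
  · simp

/-- Nakayama's lemma over ℤ_p: modulo p, every endomorphism of the lattice agrees with a combination
of group elements. -/
theorem IsReductionModP.span_eq_top [Finite ι] (b : Module.Basis ι ℤ_[p] L)
    {Λ : Representation ℤ_[p] G L} {ρ : Representation (ZMod p) G M} (h : IsReductionModP Λ ρ)
    (hρ : Submodule.span (ZMod p) (Set.range ρ) = ⊤) :
    Submodule.span ℤ_[p] (Set.range Λ) = ⊤ := by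
  obtain ⟨π, hπ, hker, hg⟩ := h
  have := Module.Finite.of_basis b
  have := Module.Free.of_basis b
  rw [eq_top_iff]
  refine Submodule.le_of_le_smul_of_le_jacobson_bot (I := IsLocalRing.maximalIdeal ℤ_[p])
    Module.Finite.fg_top (IsLocalRing.maximalIdeal_le_jacobson _) ?_
  intro f _
  let B := reductionBasis b hπ hker
  let f' : Module.End (ZMod p) M := B.constr (ZMod p) fun i => π (f (b i))
  have hf' : ∀ a ∈ Submodule.span (ZMod p) (Set.range ρ),
      ∃ s ∈ Submodule.span ℤ_[p] (Set.range Λ), ∀ y, π (s y) = a (π y) := by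
    intro a ha
    induction ha using Submodule.span_induction with
    | mem a ha =>
      obtain ⟨g, rfl⟩ := ha
      exact ⟨Λ g, Submodule.subset_span ⟨g, rfl⟩, hg g⟩
    | zero => exact ⟨0, Submodule.zero_mem _, by simp⟩
    | add a a' _ _ ha ha' =>
      obtain ⟨s, hs, hsa⟩ := ha
      obtain ⟨s', hs', hsa'⟩ := ha'
      exact ⟨s + s', Submodule.add_mem _ hs hs', fun y => by
        rw [LinearMap.add_apply, map_add, hsa, hsa', LinearMap.add_apply]⟩
    | smul c a _ ha =>
      obtain ⟨s, hs, hsa⟩ := ha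
      obtain ⟨d, rfl⟩ := toZMod_surjective c
      exact ⟨d • s, Submodule.smul_mem _ _ hs, fun y => by
        rw [LinearMap.smul_apply, LinearMap.map_smulₛₗ, hsa, LinearMap.smul_apply]⟩
  obtain ⟨s, hs, hsf⟩ := hf' f' (hρ ▸ Submodule.mem_top)
  have h1 (i : ι) : ∃ z, (f - s) (b i) = (p : ℤ_[p]) • z := by
    rw [← hker, LinearMap.sub_apply, map_sub, hsf, ← reductionBasis_apply b hπ hker,
      Module.Basis.constr_basis, sub_self]
  choose z hz using h1
  have h2 : f = s + (p : ℤ_[p]) • b.constr ℤ_[p] z := by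
    refine b.ext fun i => ?_
    rw [LinearMap.add_apply, LinearMap.smul_apply, Module.Basis.constr_basis, ← hz,
      LinearMap.sub_apply, add_sub_cancel]
  rw [h2]
  refine Submodule.add_mem_sup hs (Submodule.smul_mem_smul ?_ Submodule.mem_top)
  rw [PadicInt.maximalIdeal_eq_span_p]
  exact Ideal.mem_span_singleton_self _

end Reduction

/-! ### Brauer characters -/

section BrauerCharacter

variable {p : ℕ} [Fact p.Prime]

/-- Both sides are ring homomorphisms into characteristic p, and each p-adic integer is a natural
number modulo p. -/
theorem constantCoeff_padicIntToWitt (a : ℤ_[p]) :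
    WittVector.constantCoeff (padicIntToWitt p a) =
      algebraMap (ZMod p) (AlgebraicClosure (ZMod p)) (PadicInt.toZMod a) := by
  obtain ⟨n, hn⟩ := ZMod.natCast_zmod_surjective (PadicInt.toZMod a)
  have h0 : PadicInt.toZMod (a - (n : ℤ_[p])) = 0 := by rw [map_sub, map_natCast, hn, sub_self]
  obtain ⟨c, hc⟩ := toZMod_eq_zero_iff.1 h0
  rw [sub_eq_iff_eq_add] at hc
  rw [hc]
  simp only [map_add, map_mul, map_natCast, CharP.cast_eq_zero, zero_mul, zero_add]

/-- Over an algebraic closure of the fraction field, eigenvalues of A are n-th roots of unity. As p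
does not divide n, all of these are powers of the Teichmüller lift of one primitive n-th root of
unity. -/
theorem exists_charpoly_eq_prod_teichmuller {ι : Type*} [Fintype ι] [DecidableEq ι]
    (A : Matrix ι ι (WittVector p (AlgebraicClosure (ZMod p)))) {n : ℕ} (hn : ¬ p ∣ n)
    (hA : A ^ n = 1) :
    ∃ Z : Multiset (AlgebraicClosure (ZMod p)),
      A.charpoly = (Z.map fun z => Polynomial.X - Polynomial.C (WittVector.teichmuller p z)).prod := by
  let F := AlgebraicClosure (ZMod p)
  let W := WittVector p F
  let L := AlgebraicClosure (FractionRing W)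
  have hinjL : Function.Injective (algebraMap W L) := by
    rw [IsScalarTower.algebraMap_eq W (FractionRing W) L]
    exact (algebraMap (FractionRing W) L).injective.comp (IsFractionRing.injective W _)
  have hn0 : NeZero (n : ZMod p) := ⟨fun h => hn ((ZMod.natCast_eq_zero_iff n p).1 h)⟩
  have hn1 : NeZero n := ⟨fun h => hn (h ▸ dvd_zero p)⟩
  obtain ⟨ζ, hζ⟩ := HasEnoughRootsOfUnity.exists_primitiveRoot F n
  have hteich : Function.Injective (WittVector.teichmuller p : F →* W) := fun a b hab => by
    rw [← WittVector.teichmuller_coeff_zero p a, ← WittVector.teichmuller_coeff_zero p b, hab]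
  have hω : IsPrimitiveRoot (algebraMap W L (WittVector.teichmuller p ζ)) n :=
    (hζ.map_of_injective hteich).map_of_injective hinjL
  let AL := A.map (algebraMap W L)
  have hAL : AL ^ n = 1 := by
    have := congrArg (RingHom.mapMatrix (algebraMap W L)) hA
    rwa [map_pow, map_one] at this
  have hroot : ∀ μ ∈ AL.charpoly.roots,
      ∃ z : F, algebraMap W L (WittVector.teichmuller p z) = μ := by
    intro μ hμ
    have h1 := Polynomial.isRoot_of_mem_roots hμ
    rw [← Matrix.charpoly_toLin', ← Module.End.hasEigenvalue_iff_isRoot_charpoly] at h1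
    obtain ⟨v, hv⟩ := h1.exists_hasEigenvector
    have h2 := hv.pow_apply n
    rw [← Matrix.toLin'_pow, hAL, Matrix.toLin'_one, LinearMap.id_apply] at h2
    have h3 : μ ^ n = 1 := by
      have h4 : (μ ^ n - 1) • v = 0 := by rw [sub_smul, ← h2, one_smul, sub_self]
      exact sub_eq_zero.1 ((smul_eq_zero.1 h4).resolve_right hv.2)
    obtain ⟨i, -, hi⟩ := hω.eq_pow_of_pow_eq_one h3
    exact ⟨ζ ^ i, by rw [map_pow, map_pow, hi]⟩
  choose! z hz using hroot
  refine ⟨AL.charpoly.roots.map z, Polynomial.map_injective _ hinjL ?_⟩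
  rw [← Matrix.charpoly_map]
  change AL.charpoly = _
  conv_lhs => rw [(IsAlgClosed.splits AL.charpoly).eq_prod_roots_of_monic (Matrix.charpoly_monic _)]
  rw [Polynomial.map_multiset_prod, Multiset.map_map, Multiset.map_map]
  congr 1
  refine Multiset.map_congr rfl fun μ hμ => ?_
  simp [hz μ hμ]

/-- The characteristic polynomial on the lattice has Teichmüller roots; reducing it modulo p
identifies their residues with the eigenvalues on M. The trace is then read off the second
coefficient. -/
theorem IsReductionModP.characterExtendsBrauer {G : Type u} [Group G] {M : Type v}
    [AddCommGroup M] [Module (ZMod p) M] [FiniteDimensional (ZMod p) M] {L : Type w}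
    [AddCommGroup L] [Module ℤ_[p] L] {ι : Type*} [Finite ι] (b : Module.Basis ι ℤ_[p] L)
    {Λ : Representation ℤ_[p] G L} {ρ : Representation (ZMod p) G M} (h : IsReductionModP Λ ρ) :
    CharacterExtendsBrauer Λ ρ := by
  classical
  have := Fintype.ofFinite ι
  intro g hg
  obtain ⟨π, hπ, hker, hπg⟩ := h
  let F := AlgebraicClosure (ZMod p)
  let A := LinearMap.toMatrix b b (Λ g)
  let B := reductionBasis b hπ hker
  have hAn : A ^ orderOf g = 1 := by
    change LinearMap.toMatrix b b (Λ g) ^ orderOf g = 1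
    rw [LinearMap.toMatrix_pow, ← map_pow, pow_orderOf_eq_one, map_one, LinearMap.toMatrix_one]
  have hB : LinearMap.toMatrix B B (ρ g) = A.map PadicInt.toZMod := by
    ext i j
    rw [LinearMap.toMatrix_apply, reductionBasis_apply, ← hπg, reductionBasis_repr,
      Matrix.map_apply]
    exact congrArg _ (LinearMap.toMatrix_apply b b (Λ g) i j).symm
  obtain ⟨Z, hZ⟩ := exists_charpoly_eq_prod_teichmuller (A.map (padicIntToWitt p)) hg (by
    have := congrArg (RingHom.mapMatrix (padicIntToWitt p)) hAn
    rwa [map_pow, map_one] at this)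
  have h1 : (ρ g).charpoly.map (algebraMap (ZMod p) F) =
      (Z.map fun z => Polynomial.X - Polynomial.C z).prod := by
    rw [← LinearMap.charpoly_toMatrix (ρ g) B, hB, ← Matrix.charpoly_map]
    have h2 : (A.map PadicInt.toZMod).map (algebraMap (ZMod p) F) =
        (A.map (padicIntToWitt p)).map (WittVector.constantCoeff : WittVector p F →+* F) := by
      ext i j
      exact (constantCoeff_padicIntToWitt (A i j)).symm
    rw [h2, Matrix.charpoly_map, hZ, Polynomial.map_multiset_prod, Multiset.map_map]
    congr 1
    refine Multiset.map_congr rfl fun z _ => ?_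
    simp
  rw [brauerCharacter, Polynomial.aroots_def, h1, Polynomial.roots_multiset_prod_X_sub_C,
    LinearMap.trace_eq_matrix_trace ℤ_[p] b]
  change padicIntToWitt p (Matrix.trace A) = _
  have h3 : padicIntToWitt p (Matrix.trace A) = Matrix.trace (A.map (padicIntToWitt p)) :=
    AddMonoidHom.map_trace (padicIntToWitt p) A
  rw [h3, Matrix.trace_eq_neg_charpoly_nextCoeff, hZ]
  have := Polynomial.multiset_prod_X_sub_C_nextCoeff (Z.map (WittVector.teichmuller p))
  rw [Multiset.map_map] at this
  rw [← neg_eq_iff_eq_neg] at this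
  exact this

end BrauerCharacter

/-! ### Lifting idempotents to the p-adic integers -/

section Lifting

variable {p : ℕ} [Fact p.Prime] {G : Type*} [Group G] {S : Type*} [Fintype S] [MulAction G S]

/-- Newton's step A ↦ 3A² - 2A³ improves an approximate idempotent and preserves both G-invariance
and the reduction modulo p. Compactness then supplies an exact idempotent. -/
theorem exists_isIdempotentElem_lift (E₀ : Matrix S S (ZMod p)) (hE₀ : E₀ * E₀ = E₀)
    (hG : ∀ (g : G) c d, E₀ (g • c) (g • d) = E₀ c d) :
    ∃ E : Matrix S S ℤ_[p], E * E = E ∧ (∀ (g : G) c d, E (g • c) (g • d) = E c d) ∧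
      ∀ c d, PadicInt.toZMod (E c d) = E₀ c d := by
  classical
  obtain ⟨lift, hlift⟩ := (toZMod_surjective (p := p)).hasRightInverse
  let A₀ : Matrix S S ℤ_[p] := fun c d => lift (E₀ c d)
  have hmul {A B : Matrix S S ℤ_[p]} (hA : ∀ (g : G) c d, A (g • c) (g • d) = A c d)
      (hB : ∀ (g : G) c d, B (g • c) (g • d) = B c d) (g : G) (c d : S) :
      (A * B) (g • c) (g • d) = (A * B) c d := by
    rw [Matrix.mul_apply, Matrix.mul_apply]
    symm
    refine Fintype.sum_equiv (MulAction.toPerm g) _ _ fun s => ?_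
    rw [MulAction.toPerm_apply, hA, hB]
  -- Invariant lifts that are idempotent modulo p^(n+1): a decreasing sequence of compact sets.
  let C : ℕ → Set (S → S → ℤ_[p]) := fun n =>
    {A | (∀ (g : G) c d, A (g • c) (g • d) = A c d) ∧
      (∀ c d, ‖A c d - A₀ c d‖ ≤ (p : ℝ) ^ (-(1 : ℕ) : ℤ)) ∧
      ∀ c d, ‖(∑ s, A c s * A s d) - A c d‖ ≤ (p : ℝ) ^ (-(n + 1 : ℕ) : ℤ)}
  have hdvd (a : ℤ_[p]) (n : ℕ) :
      ‖a‖ ≤ (p : ℝ) ^ (-(n : ℕ) : ℤ) ↔ ∃ b, a = (p : ℤ_[p]) ^ n * b := by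
    rw [PadicInt.norm_le_pow_iff_mem_span_pow, Ideal.mem_span_singleton]
    rfl
  have hred {A : S → S → ℤ_[p]} :
      (∀ c d, ‖A c d - A₀ c d‖ ≤ (p : ℝ) ^ (-(1 : ℕ) : ℤ)) ↔
        ∀ c d, PadicInt.toZMod (A c d) = E₀ c d := by
    refine forall_congr' fun c => forall_congr' fun d => ?_
    rw [hdvd, pow_one, ← toZMod_eq_zero_iff, map_sub, sub_eq_zero, hlift]
  have hp1 : (1 : ℝ) < p := by exact_mod_cast (Fact.out : p.Prime).one_lt
  have hclosed (n : ℕ) : IsClosed (C n) := by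
    refine IsClosed.and ?_ (IsClosed.and ?_ ?_)
    · simp only [Set.ofPred_forall]
      exact isClosed_iInter fun g => isClosed_iInter fun c => isClosed_iInter fun d =>
        isClosed_eq (by fun_prop) (by fun_prop)
    · simp only [Set.ofPred_forall]
      exact isClosed_iInter fun c => isClosed_iInter fun d =>
        isClosed_le (by fun_prop) (by fun_prop)
    · simp only [Set.ofPred_forall]
      exact isClosed_iInter fun c => isClosed_iInter fun d =>
        isClosed_le (by fun_prop) (by fun_prop)
  have hmono (n : ℕ) : C (n + 1) ⊆ C n := by
    rintro A ⟨h1, h2, h3⟩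
    refine ⟨h1, h2, fun c d => (h3 c d).trans ?_⟩
    exact zpow_le_zpow_right₀ hp1.le (by push_cast; omega)
  have hne (n : ℕ) : (C n).Nonempty := by
    induction n with
    | zero =>
      refine ⟨A₀, fun g c d => by simp only [A₀, hG], hred.2 fun c d => hlift _, fun c d => ?_⟩
      rw [hdvd, zero_add, pow_one, ← toZMod_eq_zero_iff, map_sub, map_sum]
      simp only [map_mul, A₀, hlift _]
      rw [sub_eq_zero, ← Matrix.mul_apply, hE₀]
    | succ n ih =>
      obtain ⟨A', h1, h2, h3⟩ := ih
      let A : Matrix S S ℤ_[p] := A'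
      have hA : ∃ D : Matrix S S ℤ_[p], A * A - A = (p : ℤ_[p]) ^ (n + 1) • D := by
        simp only [hdvd] at h3
        choose D hD using h3
        refine ⟨D, ?_⟩
        ext c d
        rw [Matrix.sub_apply, Matrix.mul_apply]
        exact hD c d
      obtain ⟨D, hD⟩ := hA
      refine ⟨A * A + A * A + A * A - (A * A * A + A * A * A), fun g c d => ?_,
        hred.2 fun c d => ?_, fun c d => ?_⟩
      · have h4 := hmul h1 h1 g c d
        have h5 := hmul (hmul h1 h1) h1 g c d
        change (A * A) _ _ = _ at h4
        change (A * A * A) _ _ = _ at h5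
        simp only [Matrix.sub_apply, Matrix.add_apply, h4, h5]
        rfl
      · have h4 : A * A + A * A + A * A - (A * A * A + A * A * A) =
            A + (p : ℤ_[p]) • ((p : ℤ_[p]) ^ n • (D * (1 - 2 * A))) := by
          rw [smul_smul, ← pow_succ', ← smul_mul_assoc, ← hD]
          noncomm_ring
        rw [h4, Matrix.add_apply, Matrix.smul_apply, map_add, hred.1 h2, smul_eq_mul, map_mul,
          map_natCast, CharP.cast_eq_zero, zero_mul, add_zero]
      · rw [hdvd]
        let B : Matrix S S ℤ_[p] := A * A + A * A + A * A - (A * A * A + A * A * A)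
        -- For B = 3A² - 2A³ one has B² - B = (A² - A)² (4A² - 4A - 3), which is divisible by
        -- p^(2n+2) and so by p^(n+2).
        have h4 : B * B - B = (p : ℤ_[p]) ^ (n + 1 + 1) •
            ((p : ℤ_[p]) ^ n • (D * D * (4 * (A * A) - 4 * A - 3))) := by
          rw [smul_smul, ← pow_add, show n + 1 + 1 + n = (n + 1) + (n + 1) by omega, pow_add,
            ← smul_smul, ← smul_mul_assoc, ← smul_mul_assoc, ← mul_smul_comm, ← smul_mul_assoc,
            ← hD]
          simp only [B]
          noncomm_ring
        have h5 := congrFun (congrFun h4 c) d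
        rw [Matrix.sub_apply, Matrix.mul_apply, Matrix.smul_apply, smul_eq_mul] at h5
        exact ⟨_, h5⟩
  obtain ⟨E, hE⟩ := IsCompact.nonempty_iInter_of_sequence_nonempty_isCompact_isClosed C hmono hne
    (hclosed 0).isCompact hclosed
  rw [Set.mem_iInter] at hE
  refine ⟨E, Matrix.ext fun c d => (Matrix.mul_apply ..).trans ?_, (hE 0).1, hred.1 (hE 0).2.1⟩
  rw [← sub_eq_zero, ← norm_le_zero_iff]
  refine le_of_forall_pos_lt_add fun ε hε => ?_
  obtain ⟨n, hn⟩ := exists_pow_lt_of_lt_one hε (inv_lt_one_of_one_lt₀ hp1)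
  rw [zero_add]
  refine ((hE n).2.2 c d).trans_lt (lt_of_le_of_lt ?_ hn)
  rw [inv_pow, ← zpow_natCast, ← zpow_neg]
  exact zpow_le_zpow_right₀ hp1.le (by push_cast; omega)

end Lifting

/-! ### Lifting trivial-source modules to characteristic zero -/

section Lattice

variable {p : ℕ} [Fact p.Prime] {G : Type u} [Group G] {M : Type v} [AddCommGroup M]
  [Module (ZMod p) M] {ρ : Representation (ZMod p) G M}

/-- A direct summand of a permutation module lifts to a lattice over `ℤ_p`. -/
theorem exists_isReductionModP {P : Subgroup G} [Finite (G ⧸ P)]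
    (hP : IsSummand ρ (Representation.ind P.subtype (Representation.trivial (ZMod p) P (ZMod p)))) :
    ∃ (n : ℕ) (Λ : Representation ℤ_[p] G (Fin n → ℤ_[p])), IsReductionModP Λ ρ := by
  classical
  have := Fintype.ofFinite (G ⧸ P)
  obtain ⟨v, l, hv, hl, h1⟩ := hP.exists_relTrace_eq_one
  have hsum (m : M) : ∑ c : G ⧸ P, l (ρ c.out⁻¹ m) • ρ c.out v = m := by
    rw [← relTrace_smulRight_apply, h1, Module.End.one_apply]
  -- The matrix l(c⁻¹ d v) is the projection of the permutation module onto the copy of M; its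
  -- idempotency is the relation Tr(l ⊗ v) = 1.
  obtain ⟨E, hE, hEG, hE0⟩ := exists_isIdempotentElem_lift (p := p) (G := G) (S := G ⧸ P)
    (fun c d => l (ρ c.out⁻¹ (ρ d.out v))) (by
      refine Matrix.ext fun c d => (Matrix.mul_apply ..).trans ?_
      conv_rhs => rw [← hsum (ρ d.out v), map_sum, map_sum]
      refine Finset.sum_congr rfl fun s _ => ?_
      rw [map_smul, map_smul, smul_eq_mul, mul_comm]) (by
      intro g c d
      rw [apply_out_smul hv, dual_apply_inv_out_smul hl])
  let π₀ : ((G ⧸ P) → ℤ_[p]) →ₛₗ[(PadicInt.toZMod : ℤ_[p] →+* ZMod p)] M :=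
    { toFun := fun y => ∑ c, PadicInt.toZMod (y c) • ρ c.out v
      map_add' := fun y z => by
        simp only [Pi.add_apply, map_add, add_smul, Finset.sum_add_distrib]
      map_smul' := fun a y => by
        simp only [Pi.smul_apply, smul_eq_mul, map_mul, mul_smul, Finset.smul_sum] }
  have hπ₀ (y : (G ⧸ P) → ℤ_[p]) : π₀ y = ∑ c, PadicInt.toZMod (y c) • ρ c.out v := rfl
  have hEy (y : (G ⧸ P) → ℤ_[p]) (c : G ⧸ P) :
      PadicInt.toZMod (E.mulVecLin y c) = l (ρ c.out⁻¹ (π₀ y)) := by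
    rw [Matrix.mulVecLin_apply, Matrix.mulVec, dotProduct, map_sum, hπ₀, map_sum, map_sum]
    refine Finset.sum_congr rfl fun d _ => ?_
    rw [map_mul, hE0, map_smul, map_smul, smul_eq_mul, mul_comm]
  have hπE (y : (G ⧸ P) → ℤ_[p]) : π₀ (E.mulVecLin y) = π₀ y := by
    conv_lhs => rw [hπ₀]
    simp only [hEy, hsum]
  let perm (g : G) : ((G ⧸ P) → ℤ_[p]) →ₗ[ℤ_[p]] ((G ⧸ P) → ℤ_[p]) :=
    LinearMap.funLeft ℤ_[p] ℤ_[p] (g⁻¹ • ·)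
  have hperm (g : G) (y : (G ⧸ P) → ℤ_[p]) (c : G ⧸ P) : perm g y c = y (g⁻¹ • c) := rfl
  have hπperm (g : G) (y : (G ⧸ P) → ℤ_[p]) : π₀ (perm g y) = ρ g (π₀ y) := by
    rw [hπ₀, hπ₀, map_sum]
    symm
    refine Fintype.sum_equiv (MulAction.toPerm g) _ _ fun c => ?_
    rw [MulAction.toPerm_apply, hperm, inv_smul_smul, apply_out_smul hv, map_smul]
  have hEperm (g : G) (y : (G ⧸ P) → ℤ_[p]) :
      E.mulVecLin (perm g y) = perm g (E.mulVecLin y) := by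
    ext c
    rw [hperm]
    simp only [Matrix.mulVecLin_apply, Matrix.mulVec, dotProduct, hperm]
    symm
    refine Fintype.sum_equiv (MulAction.toPerm g) _ _ fun d => ?_
    rw [MulAction.toPerm_apply, inv_smul_smul, ← hEG g (g⁻¹ • c) d, smul_inv_smul]
  have hEE (y : (G ⧸ P) → ℤ_[p]) : E.mulVecLin (E.mulVecLin y) = E.mulVecLin y := by
    rw [Matrix.mulVecLin_apply, Matrix.mulVecLin_apply, Matrix.mulVec_mulVec, hE]
  -- The lattice is the summand of the p-adic permutation module cut out by E, later transported to
  -- coordinates.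
  let L := LinearMap.range E.mulVecLin
  have hL {y : (G ⧸ P) → ℤ_[p]} (hy : y ∈ L) : E.mulVecLin y = y := by
    obtain ⟨z, rfl⟩ := hy
    exact hEE z
  let b := Module.finBasis ℤ_[p] L
  let e := b.equivFun
  let Λ₀ : Representation ℤ_[p] G L :=
    { toFun := fun g => (perm g).restrict (p := L) (q := L) (by
        rintro _ ⟨z, rfl⟩
        exact ⟨perm g z, hEperm g z⟩)
      map_one' := by
        ext y c
        change (y : (G ⧸ P) → ℤ_[p]) ((1 : G)⁻¹ • c) = (y : (G ⧸ P) → ℤ_[p]) c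
        rw [inv_one, one_smul]
      map_mul' := fun g h => by
        ext y c
        change (y : (G ⧸ P) → ℤ_[p]) ((g * h)⁻¹ • c) = (y : (G ⧸ P) → ℤ_[p]) (h⁻¹ • g⁻¹ • c)
        rw [mul_inv_rev, mul_smul] }
  refine ⟨_, (e.conjRingEquiv : Module.End ℤ_[p] L →* _).comp Λ₀,
    (π₀.comp L.subtype).comp e.symm.toLinearMap, fun m => ?_, fun y => ?_, fun g y => ?_⟩
  · choose y hy using fun c : G ⧸ P => toZMod_surjective (p := p) (l (ρ c.out⁻¹ m))
    refine ⟨e ⟨E.mulVecLin y, y, rfl⟩, ?_⟩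
    change π₀ (e.symm (e ⟨E.mulVecLin y, y, rfl⟩)) = m
    rw [e.symm_apply_apply, hπE, hπ₀]
    simp only [hy, hsum]
  · change π₀ (e.symm y) = 0 ↔ _
    constructor
    · intro h
      -- On the range of E, the coordinates modulo p are functions of the image in M, so a zero
      -- image makes each of them divisible by p.
      have h2 : ∀ c, ∃ z, (e.symm y : (G ⧸ P) → ℤ_[p]) c = p * z := fun c => by
        rw [← toZMod_eq_zero_iff, ← hL (e.symm y).2, hEy, h, map_zero, map_zero]
      choose z hz using h2
      have h3 : (e.symm y : (G ⧸ P) → ℤ_[p]) = (p : ℤ_[p]) • z := funext hz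
      refine ⟨e ⟨E.mulVecLin z, z, rfl⟩, e.symm.injective (Subtype.ext ?_)⟩
      rw [map_smul, e.symm_apply_apply]
      change (e.symm y : (G ⧸ P) → ℤ_[p]) = (p : ℤ_[p]) • E.mulVecLin z
      rw [← map_smul, ← h3, hL (e.symm y).2]
    · rintro ⟨z, rfl⟩
      rw [map_smul, Submodule.coe_smul, LinearMap.map_smulₛₗ, map_natCast, CharP.cast_eq_zero,
        zero_smul]
  · change π₀ (e.symm (e (Λ₀ g (e.symm y)))) = ρ g (π₀ (e.symm y))
    rw [e.symm_apply_apply]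
    exact hπperm g _

/-- The lifts to characteristic zero of an irreducible representation which is a direct summand of
a permutation module and whose group algebra contains an operator of rank one. -/
theorem exists_lift_of_isSummand_ind_trivial [FiniteDimensional (ZMod p) M]
    (hρ : ρ.IsIrreducible) (hspan : Submodule.span (ZMod p) (Set.range ρ) = ⊤)
    {P : Subgroup G} [Finite (G ⧸ P)]
    (hP : IsSummand ρ (Representation.ind P.subtype (Representation.trivial (ZMod p) P (ZMod p)))) :
    ∃ (n : ℕ) (Λ : Representation ℤ_[p] G (Fin n → ℤ_[p])),
      IsReductionModP Λ ρ ∧ (extendScalars ℚ_[p] Λ).IsIrreducible ∧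
        IsAbsolutelyIrreducible (extendScalars ℚ_[p] Λ) ∧ CharacterExtendsBrauer Λ ρ := by
  obtain ⟨n, Λ, hΛ⟩ := exists_isReductionModP hP
  have h1 := span_extendScalars ℚ_[p] (Pi.basisFun ℤ_[p] (Fin n)) Λ
    (hΛ.span_eq_top (Pi.basisFun ℤ_[p] (Fin n)) hspan)
  have hM : Nontrivial M := by
    by_contra h
    rw [not_nontrivial_iff_subsingleton] at h
    exact bot_ne_top (α := Subrepresentation ρ)
      (Subrepresentation.toSubmodule_injective (Subsingleton.elim _ _))
  have hn : Nonempty (Fin n) := by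
    by_contra h
    rw [not_nonempty_iff] at h
    obtain ⟨π, hπ, -⟩ := hΛ
    exact not_subsingleton M hπ.subsingleton
  have : Nontrivial (ℚ_[p] ⊗[ℤ_[p]] (Fin n → ℤ_[p])) :=
    ((Pi.basisFun ℤ_[p] (Fin n)).baseChange ℚ_[p]).repr.toEquiv.nontrivial
  exact ⟨n, Λ, hΛ, isIrreducible_of_span_eq_top h1, isAbsolutelyIrreducible_of_span_eq_top h1,
    hΛ.characterExtendsBrauer (Pi.basisFun ℤ_[p] (Fin n))⟩

end Lattice

/-! ### The subgroup of order p and its normalizer -/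

section Groups

variable {p : ℕ} [Fact p.Prime] {G : Type*} [Group G]

theorem InClassG.not_dvd_index (hG : InClassG p G) {x : G} (hx : orderOf x = p) :
    ¬ p ∣ (Subgroup.zpowers x).index := by
  have := hG.1
  let P : Sylow p G := default
  have h1 := (P : Subgroup G).card_mul_index
  rw [(hG.2 P).1, ← (Subgroup.zpowers x).card_mul_index, Nat.card_zpowers, hx] at h1
  rw [← Nat.eq_of_mul_eq_mul_left (Fact.out : p.Prime).pos h1]
  exact P.not_dvd_index

theorem zpowers_le_normalizer (x : G) :
    Subgroup.zpowers x ≤ Subgroup.normalizer (Subgroup.zpowers x : Set G) :=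
  Subgroup.le_normalizer

/-- Any u ≠ 1 generates the group of prime order, so conjugation carrying u into it carries all of
it into itself. -/
theorem zpowers_eq_one_of_conj_mem [Finite G] {x : G} (hx : orderOf x = p) {g : G}
    (hg : g ∉ Subgroup.normalizer (Subgroup.zpowers x : Set G)) {u : G}
    (hu : u ∈ Subgroup.zpowers x) (hgu : g⁻¹ * u * g ∈ Subgroup.zpowers x) : u = 1 := by
  by_contra hu1
  apply hg
  have hx' : x ∈ Subgroup.zpowers u := by
    have := mem_zpowers_of_prime_card (G := Subgroup.zpowers x) (p := p)
      (by rw [Nat.card_zpowers, hx]) (g := ⟨u, hu⟩) (g' := ⟨x, Subgroup.mem_zpowers x⟩)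
      (fun h => hu1 (congrArg Subtype.val h))
    obtain ⟨i, hi⟩ := this
    exact ⟨i, congrArg Subtype.val hi⟩
  rw [← inv_inv g, Subgroup.inv_mem_iff]
  refine Subgroup.mem_normalizer_fintype fun y hy => ?_
  rw [inv_inv]
  have hle : Subgroup.zpowers x ≤ (Subgroup.zpowers x).comap (MulAut.conj g⁻¹).toMonoidHom := by
    refine (Subgroup.zpowers_le.2 hx').trans (Subgroup.zpowers_le.2 ?_)
    simpa using hgu
  simpa using hle hy

theorem natCast_relIndex_ne_zero {k : Type*} [Field k] {U N : Subgroup G}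
    (hU : (U.index : k) ≠ 0) (hUN : U ≤ N) : ((U.subgroupOf N).index : k) ≠ 0 := by
  intro h
  apply hU
  obtain ⟨c, hc⟩ := Subgroup.relIndex_dvd_index_of_le hUN
  rw [hc, Nat.cast_mul, Subgroup.relIndex, h, zero_mul]

end Groups

/-! ### Maschke's theorem -/

section Maschke

variable {k : Type*} [Field k] {G : Type*} [Group G] {V : Type*} [AddCommGroup V] [Module k V]
  {ρ : Representation k G V}

/-- Maschke's theorem for a representation on which a subgroup of invertible index acts
trivially. -/
theorem exists_isCompl_of_trivial (Q : Subgroup G) [Finite (G ⧸ Q)] (hQ : (Q.index : k) ≠ 0)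
    (htriv : ∀ h ∈ Q, ρ h = 1) (S : Subrepresentation ρ) :
    ∃ S' : Subrepresentation ρ, IsCompl S S' := by
  obtain ⟨C, hC⟩ := Submodule.exists_isCompl S.toSubmodule
  let q₀ : V →ₗ[k] V := S.toSubmodule.subtype ∘ₗ Submodule.projectionOnto _ _ hC
  have hq₀ (v : V) : q₀ v ∈ S.toSubmodule := (Submodule.projectionOnto _ _ hC v).2
  have hq₀' {v : V} (hv : v ∈ S.toSubmodule) : q₀ v = v :=
    congrArg Subtype.val (Submodule.projectionOnto_apply_left hC ⟨v, hv⟩)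
  have hinv : ∀ h ∈ Q, Representation.linHom ρ ρ h q₀ = q₀ := by
    intro h hh
    rw [Representation.linHom_apply, htriv h hh, htriv _ (Q.inv_mem hh)]
    rfl
  -- Averaging over the cosets suffices: as Q acts trivially, any linear projection is already
  -- Q-equivariant.
  let q := average Q q₀ hinv
  have hq (v : V) : q v ∈ S.toSubmodule :=
    average_apply_mem hinv _ fun g => S.apply_mem_toSubmodule g (hq₀ _)
  have hq' {v : V} (hv : v ∈ S.toSubmodule) : q v = v :=
    average_apply_eq_of_forall hinv hQ fun g => by
      rw [hq₀' (S.apply_mem_toSubmodule _ hv), Representation.self_inv_apply]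
  refine ⟨q.ker, disjoint_iff.2 (Subrepresentation.toSubmodule_injective (eq_bot_iff.2 ?_)),
    codisjoint_iff.2 (Subrepresentation.toSubmodule_injective (eq_top_iff.2 ?_))⟩
  · rintro v ⟨hv, hv'⟩
    have hv'' : q v = 0 := hv'
    rw [hq' hv] at hv''
    exact hv''
  · intro v _
    rw [Subrepresentation.toSubmodule_sup, ← add_sub_cancel (q v) v]
    refine Submodule.add_mem_sup (hq v) ?_
    change q (v - q v) = 0
    rw [map_sub, hq' (hq v), sub_self]

theorem IsIndecomposable.isIrreducible_of_trivial {G : Type u} [Group G] {V : Type v}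
    [AddCommGroup V] [Module k V] {ρ : Representation k G V} (hρ : IsIndecomposable ρ)
    (Q : Subgroup G) [Finite (G ⧸ Q)]
    (hQ : (Q.index : k) ≠ 0) (htriv : ∀ h ∈ Q, ρ h = 1) : ρ.IsIrreducible := by
  have := hρ.1
  have : Nontrivial (Subrepresentation ρ) :=
    ⟨⟨⊥, ⊤, fun h => bot_ne_top (congrArg Subrepresentation.toSubmodule h)⟩⟩
  refine ⟨fun S => ?_⟩
  obtain ⟨S', hS⟩ := exists_isCompl_of_trivial Q hQ htriv S
  rcases hρ.2 S S' hS with h | h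
  · exact Or.inl h
  · right
    rw [h] at hS
    exact codisjoint_bot.1 hS.2

end Maschke

/-! ### The idempotent onto the trivial part -/

section Projection

variable {k : Type*} [Field k] {G : Type u} [Group G] {V : Type v} [AddCommGroup V] [Module k V]

/-- `e` is a projection, equivariant under the normalizer of `x`, onto a complement of
`ker (x - 1) ⊓ im (x - 1)` in the fixed space of `x`, which kills the image of `x - 1`. -/
structure IsTrivialPartProjection (ρ : Representation k G V) (x : G) (e : Module.End k V) :
    Prop where
  idem : IsIdempotentElem e
  comm : ∀ g ∈ Subgroup.normalizer (Subgroup.zpowers x : Set G), Commute (ρ g) e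
  sub_one_mul : (ρ x - 1) * e = 0
  mul_sub_one : e * (ρ x - 1) = 0
  mem_range : ∀ v ∈ LinearMap.ker (ρ x - 1), e v = 0 → v ∈ LinearMap.range (ρ x - 1)

/-- Maschke is used twice for N modulo U: once to split ker X ⊓ im X off from ker X, and once to
average a linear projection onto the complement Z that kills im X. -/
theorem exists_isTrivialPartProjection (ρ : Representation k G V) [Finite G] (x : G)
    (hidx : ((Subgroup.zpowers x).index : k) ≠ 0) :
    ∃ e, IsTrivialPartProjection ρ x e := by
  let U := Subgroup.zpowers x
  let N := Subgroup.normalizer (U : Set G)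
  let X := ρ x - 1
  let τ : Representation k N V := ρ.comp N.subtype
  have hUN : U ≤ N := zpowers_le_normalizer x
  have hidxN := natCast_relIndex_ne_zero hidx hUN
  let K : Subrepresentation τ :=
    ⟨LinearMap.ker X, fun n _ hv => normalizer_apply_mem_ker n.2 hv⟩
  have hfix {v : V} (hv : v ∈ LinearMap.ker X) {u : G} (hu : u ∈ U) : ρ u v = v :=
    forall_mem_zpowers_apply_eq_iff.2 hv u hu
  let D : Subrepresentation K.toRepresentation :=
    ⟨(LinearMap.range X).comap K.toSubmodule.subtype,
      fun n _ hv => normalizer_apply_mem_range n.2 hv⟩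
  obtain ⟨Z', hZ'⟩ := exists_isCompl_of_trivial (ρ := K.toRepresentation) (U.subgroupOf N) hidxN
    (fun h hh => by
      ext v
      exact hfix v.2 hh) D
  let Z : Submodule k V := Z'.toSubmodule.map K.toSubmodule.subtype
  have hZK : Z ≤ LinearMap.ker X := by
    rintro _ ⟨v, -, rfl⟩
    exact v.2
  have hZN (n : N) {v : V} (hv : v ∈ Z) : τ n v ∈ Z := by
    obtain ⟨w, hw, rfl⟩ := hv
    exact ⟨_, Z'.apply_mem_toSubmodule n hw, rfl⟩
  have hdisj : Disjoint (LinearMap.range X) Z := by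
    rw [Submodule.disjoint_def]
    rintro _ hv ⟨w, hw, rfl⟩
    have : w ∈ D.toSubmodule ⊓ Z'.toSubmodule := ⟨hv, hw⟩
    have hbot : D.toSubmodule ⊓ Z'.toSubmodule = ⊥ :=
      congrArg Subrepresentation.toSubmodule (disjoint_iff.1 hZ'.1)
    rw [hbot, Submodule.mem_bot] at this
    rw [this, map_zero]
  obtain ⟨C, hXC, hC⟩ := hdisj.exists_isCompl
  let e₀ : V →ₗ[k] V := Z.subtype ∘ₗ Submodule.projectionOnto _ _ hC.symm
  have he₀ (v : V) : e₀ v ∈ Z := (Submodule.projectionOnto _ _ hC.symm v).2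
  have he₀Z {v : V} (hv : v ∈ Z) : e₀ v = v :=
    congrArg Subtype.val (Submodule.projectionOnto_apply_left hC.symm ⟨v, hv⟩)
  have he₀X {v : V} (hv : v ∈ LinearMap.range X) : e₀ v = 0 := by
    change ((Submodule.projectionOnto _ _ hC.symm v : Z) : V) = 0
    rw [(Submodule.projectionOnto_apply_eq_zero_iff hC.symm).2 (hXC hv)]
    rfl
  -- U fixes Z pointwise, and u v - v lies in im X, which e₀ kills.
  have hinv : ∀ h ∈ U.subgroupOf N, Representation.linHom τ τ h e₀ = e₀ := by
    intro h hh
    ext v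
    change ρ h (e₀ (ρ (h : G)⁻¹ v)) = e₀ v
    have h1 : ρ (h : G) (e₀ (ρ (h : G)⁻¹ v)) = _ := hfix (hZK (he₀ _)) hh
    rw [h1, ← sub_eq_zero, ← map_sub]
    exact he₀X (apply_sub_mem_range (U.inv_mem hh) v)
  let e := average (U.subgroupOf N) e₀ hinv
  have he (v : V) : e v ∈ Z := average_apply_mem hinv _ fun n => hZN n (he₀ _)
  have heZ {v : V} (hv : v ∈ Z) : e v = v := average_apply_eq_of_forall hinv hidxN fun n => by
    rw [he₀Z (hZN n⁻¹ hv), Representation.self_inv_apply]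
  have heX {v : V} (hv : v ∈ LinearMap.range X) : e v = 0 :=
    average_apply_eq_of_forall hinv hidxN fun n => by
      have : τ n⁻¹ v ∈ LinearMap.range X := normalizer_apply_mem_range (n⁻¹).2 hv
      rw [he₀X this, map_zero]
  refine ⟨e.toLinearMap, LinearMap.ext fun v => heZ (he v), fun g hg => ?_, ?_, ?_, ?_⟩
  · exact LinearMap.ext fun v => (e.isIntertwining _ _ (⟨g, hg⟩ : N) v).symm
  · exact LinearMap.ext fun v => hZK (he v)
  · exact LinearMap.ext fun v => heX ⟨v, rfl⟩
  · intro v hv hev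
    have htop : (⟨v, hv⟩ : K.toSubmodule) ∈ D.toSubmodule ⊔ Z'.toSubmodule := by
      have : D.toSubmodule ⊔ Z'.toSubmodule = ⊤ :=
        congrArg Subrepresentation.toSubmodule (codisjoint_iff.1 hZ'.2)
      rw [this]
      exact Submodule.mem_top
    obtain ⟨a, ha, z, hz, haz⟩ := Submodule.mem_sup.1 htop
    have haz' : (a : V) + z = v := congrArg Subtype.val haz
    have hz' : e (z : V) = z := heZ ⟨z, hz, rfl⟩
    have ha' : e (a : V) = 0 := heX ha
    have : (z : V) = 0 := by
      rw [← hz', ← zero_add (e (z : V)), ← ha', ← map_add, haz']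
      exact hev.trans ha'.symm
    rw [← haz', this, add_zero]
    exact ha

end Projection

/-- The kernel of T is stable under the nilpotent Y, so if nonzero it meets ker Y. -/
theorem injective_of_forall_mem_ker {k V W : Type*} [Field k] [AddCommGroup V] [Module k V]
    [AddCommGroup W] [Module k W] {T : W →ₗ[k] V} {Y : Module.End k W} {X : Module.End k V}
    (hT : ∀ w, T (Y w) = X (T w)) (hY : IsNilpotent Y)
    (hker : ∀ w ∈ LinearMap.ker Y, T w = 0 → w = 0) : Function.Injective T := by
  rw [injective_iff_map_eq_zero]
  intro w hw
  by_contra hw0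
  obtain ⟨j, hj, hj'⟩ := exists_pow_apply_mem_ker hY hw0
  refine hj (hker _ hj' ?_)
  have : ∀ j, T ((Y ^ j) w) = 0 := by
    intro j
    induction j with
    | zero => simpa using hw
    | succ j ih => rw [pow_succ', Module.End.mul_apply, hT, ih, map_zero]
  exact this j

/-! ### Structure of the restriction to U -/

section Structure

variable {p : ℕ} [Fact p.Prime] {k : Type*} [Field k] [CharP k p] {G : Type u} [Group G]
  {V : Type v} [AddCommGroup V] [Module k V] {ρ : Representation k G V} {x : G}

omit [CharP k p] in
theorem range_pow_sub_one_le : LinearMap.range ((ρ x - 1) ^ (p - 1)) ≤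
    LinearMap.range (ρ x - 1) := by
  have := (Fact.out : p.Prime).two_le
  rw [show p - 1 = p - 2 + 1 by omega, pow_succ']
  exact LinearMap.range_comp_le_range _ _

theorem range_pow_sub_one_le_ker (hx : orderOf x = p) :
    LinearMap.range ((ρ x - 1) ^ (p - 1)) ≤ LinearMap.ker (ρ x - 1) := by
  rintro _ ⟨v, rfl⟩
  rw [LinearMap.mem_ker, ← Module.End.mul_apply, ← pow_succ',
    Nat.sub_add_cancel (Fact.out : p.Prime).one_le, sub_one_pow_eq_zero hx]
  rfl

theorem isNilpotent_sub_one (hx : orderOf x = p) : IsNilpotent (ρ x - 1) :=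
  ⟨p, sub_one_pow_eq_zero hx⟩

theorem exists_mem_ker_inf_range (hx : orderOf x = p) (hX : ρ x ≠ 1) :
    ∃ v ∈ LinearMap.ker (ρ x - 1) ⊓ LinearMap.range (ρ x - 1), v ≠ 0 := by
  obtain ⟨v, hv⟩ : ∃ v, (ρ x - 1) v ≠ 0 := by
    by_contra! h
    exact hX (sub_eq_zero.1 (LinearMap.ext h))
  obtain ⟨j, hj, hj'⟩ := exists_pow_apply_mem_ker (isNilpotent_sub_one (ρ := ρ) hx) hv
  have hmem : ((ρ x - 1) ^ j) ((ρ x - 1) v) ∈ LinearMap.range (ρ x - 1) :=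
    pow_apply_mem (X := ρ x - 1) (fun w _ => LinearMap.mem_range_self (ρ x - 1) w) j
      (LinearMap.mem_range_self (ρ x - 1) v)
  exact ⟨_, ⟨hj', hmem⟩, hj⟩

variable [Fintype (Subgroup.zpowers x)]

theorem mem_range_pow_of_conjNorm (hx : orderOf x = p) {f b : Module.End k V}
    (hf : f = conjNorm ρ (Subgroup.zpowers x) b) {v : V} (hv : v ∈ LinearMap.ker (ρ x - 1))
    (hfv : f v = v) : v ∈ LinearMap.range ((ρ x - 1) ^ (p - 1)) := by
  rw [← norm_zpowers_eq hx, ← hfv, hf,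
    conjNorm_apply_of_fixed b (forall_mem_zpowers_apply_eq_iff.2 hv)]
  exact ⟨_, rfl⟩

omit [CharP k p] in
theorem IsIndecomposable.conjNorm_zpowers_or_isUnit_relTrace [Finite G] [FiniteDimensional k V]
    (hρ : IsIndecomposable ρ)
    (hx : orderOf x = p) (hidx : ((Subgroup.zpowers x).index : k) ≠ 0) {f : Module.End k V}
    (hf : IsIdempotentElem f)
    (hfN : ∀ g ∈ Subgroup.normalizer (Subgroup.zpowers x : Set G), Commute (ρ g) f) :
    (∃ b, f = conjNorm ρ (Subgroup.zpowers x) b) ∨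
      (IsUnit (relTrace (conj ρ) (Subgroup.zpowers x) f) ∧
        ∃ b, 1 - f = conjNorm ρ (Subgroup.zpowers x) b) :=
  hρ.conjNorm_or_isUnit_relTrace (zpowers_le_normalizer x)
    (fun _ hg _ hu hgu => zpowers_eq_one_of_conj_mem hx hg hu hgu)
    (natCast_relIndex_ne_zero hidx (zpowers_le_normalizer x)) hf hfN

namespace IsTrivialPartProjection

variable {e : Module.End k V} (he : IsTrivialPartProjection ρ x e)
include he

omit [CharP k p] [Fintype (Subgroup.zpowers x)] [Fact p.Prime] in
theorem apply_mem_ker (v : V) : e v ∈ LinearMap.ker (ρ x - 1) :=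
  LinearMap.congr_fun he.sub_one_mul v

omit [CharP k p] [Fintype (Subgroup.zpowers x)] [Fact p.Prime] in
theorem apply_of_mem_range {v : V} (hv : v ∈ LinearMap.range (ρ x - 1)) : e v = 0 := by
  obtain ⟨w, rfl⟩ := hv
  exact LinearMap.congr_fun he.mul_sub_one w

/-- If e were a norm, the vectors of im e, being fixed by x and by e, would lie in im X, which e
kills. -/
theorem isUnit_relTrace [Finite G] [FiniteDimensional k V] (hρ : IsIndecomposable ρ)
    (hx : orderOf x = p) (hidx : ((Subgroup.zpowers x).index : k) ≠ 0) (he0 : e ≠ 0) :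
    IsUnit (relTrace (conj ρ) (Subgroup.zpowers x) e) ∧
      ∃ b, 1 - e = conjNorm ρ (Subgroup.zpowers x) b := by
  refine (hρ.conjNorm_zpowers_or_isUnit_relTrace hx hidx he.idem he.comm).resolve_left ?_
  rintro ⟨b, hb⟩
  refine he0 (LinearMap.ext fun v => ?_)
  have hev : e (e v) = e v := LinearMap.congr_fun he.idem.eq v
  rw [← hev]
  exact he.apply_of_mem_range (range_pow_sub_one_le
    (mem_range_pow_of_conjNorm hx hb (he.apply_mem_ker v) hev))

/-- The norm 1 - e fixes a nonzero vector of ker X ⊓ im X, which therefore lies in im X^(p-1). -/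
theorem pow_sub_one_ne_zero [Finite G] [FiniteDimensional k V] (hρ : IsIndecomposable ρ)
    (hx : orderOf x = p) (hidx : ((Subgroup.zpowers x).index : k) ≠ 0) (hX : ρ x ≠ 1)
    (he0 : e ≠ 0) : (ρ x - 1) ^ (p - 1) ≠ 0 := by
  obtain ⟨-, b, hb⟩ := he.isUnit_relTrace hρ hx hidx he0
  obtain ⟨v, hv, hv0⟩ := exists_mem_ker_inf_range hx hX
  intro h
  have := mem_range_pow_of_conjNorm hx hb hv.1 (by
    rw [LinearMap.sub_apply, he.apply_of_mem_range hv.2, sub_zero, Module.End.one_apply])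
  rw [h, LinearMap.range_zero, Submodule.mem_bot] at this
  exact hv0 this

omit [CharP k p] [Fintype (Subgroup.zpowers x)] [Fact p.Prime] in
theorem finrank_ker [FiniteDimensional k V] {b : V}
    (hb : LinearMap.ker (ρ x - 1) ⊓ LinearMap.range (ρ x - 1) ≤ k ∙ b) :
    Module.finrank k (LinearMap.ker (ρ x - 1)) ≤ 1 + Module.finrank k (LinearMap.range e) := by
  have h : LinearMap.ker (ρ x - 1) ≤ (k ∙ b) ⊔ LinearMap.range e := by
    intro v hv
    rw [← sub_add_cancel v (e v)]
    refine Submodule.add_mem_sup (hb ?_) ⟨v, rfl⟩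
    have h1 : v - e v ∈ LinearMap.ker (ρ x - 1) := Submodule.sub_mem _ hv (he.apply_mem_ker v)
    refine ⟨h1, he.mem_range _ h1 ?_⟩
    rw [map_sub, sub_eq_zero]
    exact (LinearMap.congr_fun he.idem.eq v).symm
  calc _ ≤ _ := Submodule.finrank_mono h
    _ ≤ _ := Submodule.finrank_add_le_finrank_add_finrank _ _
    _ ≤ _ := Nat.add_le_add_right ((finrank_span_le_card ({b} : Set V)).trans (by simp)) _

/-- If the norm of `⟨x⟩` does not vanish, the restriction is the sum of a free module of rank one
and a trivial one. -/
theorem exists_equiv [FiniteDimensional k V] (hx : orderOf x = p) {b : V}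
    (hb : LinearMap.ker (ρ x - 1) ⊓ LinearMap.range (ρ x - 1) ≤ k ∙ b)
    (hp : (ρ x - 1) ^ (p - 1) ≠ 0) :
    Module.finrank k V = p + Module.finrank k (LinearMap.range e) ∧
      Nonempty ((res (Subgroup.zpowers x) ρ).Equiv
        ((Representation.leftRegular k (Subgroup.zpowers x)).prod
          (Representation.trivial k (Subgroup.zpowers x)
            (Fin (Module.finrank k (LinearMap.range e)) → k)))) := by
  let U := Subgroup.zpowers x
  let a := Module.finrank k (LinearMap.range e)
  let β := (Module.finBasis k (LinearMap.range e)).equivFun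
  let σ : Representation k U (k[U] × (Fin a → k)) :=
    (Representation.leftRegular k U).prod (Representation.trivial k U (Fin a → k))
  obtain ⟨w, hw⟩ : ∃ w, ((ρ x - 1) ^ (p - 1)) w ≠ 0 := by
    by_contra! h
    exact hp (LinearMap.ext h)
  -- The free summand is generated by a vector w not killed by the norm; the trivial summand is im
  -- e.
  let Φ : k[U] × (Fin a → k) →ₗ[k] V :=
    LinearMap.coprod
      (Fintype.linearCombination k (fun u : U => ρ u w) ∘ₗ
        (Finsupp.linearEquivFunOnFinite k k U).toLinearMap ∘ₗ
          (MonoidAlgebra.coeffLinearEquiv k).toLinearMap)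
      ((LinearMap.range e).subtype ∘ₗ β.symm.toLinearMap)
  have hΦ (f : k[U]) (c : Fin a → k) :
      Φ (f, c) = ∑ u : U, f.coeff u • ρ u w + (β.symm c : V) := rfl
  have hΦσ (u : U) (v : k[U] × (Fin a → k)) : Φ (σ u v) = ρ u (Φ v) := by
    obtain ⟨f, c⟩ := v
    change Φ (Representation.ofMulAction k U U u f, c) = _
    rw [hΦ, hΦ, map_add, map_sum]
    congr 1
    · symm
      refine Fintype.sum_equiv (Equiv.mulLeft u) _ _ fun u' => ?_
      rw [Representation.coeff_ofMulAction, Equiv.coe_mulLeft, smul_eq_mul, inv_mul_cancel_left,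
        map_smul, ← Module.End.mul_apply, ← map_mul]
      rfl
    · obtain ⟨y, hy⟩ := (β.symm c).2
      rw [← hy]
      exact (forall_mem_zpowers_apply_eq_iff.2 (he.apply_mem_ker y) u u.2).symm
  let x' : U := ⟨x, Subgroup.mem_zpowers x⟩
  have hx' : orderOf x' = p := by rw [← hx]; exact Subgroup.orderOf_mk x _
  have hinj : Function.Injective Φ := by
    refine injective_of_forall_mem_ker (Y := σ x' - 1) (X := ρ x - 1) (fun v => ?_)
      (isNilpotent_sub_one hx') ?_
    · rw [LinearMap.sub_apply, LinearMap.sub_apply, map_sub, hΦσ]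
      rfl
    · rintro ⟨f, c⟩ hfc h0
      -- Injectivity need only be checked on fixed vectors, whose k[U]-component is constant. Such a
      -- vector maps to a multiple of X^(p-1) w plus an element of im e; e kills the former and
      -- fixes the latter.
      have hgen (u : U) : u ∈ Subgroup.zpowers x' := by
        obtain ⟨i, hi⟩ := u.2
        exact ⟨i, Subtype.ext hi⟩
      have hconst (u : U) : f.coeff u = f.coeff 1 := by
        have h1 := forall_mem_zpowers_apply_eq_iff.2 hfc u (hgen u)
        have h2 : Representation.ofMulAction k U U u f = f := congrArg Prod.fst h1
        conv_lhs => rw [← h2]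
        rw [Representation.coeff_ofMulAction, smul_eq_mul, inv_mul_cancel]
      have h1 : ∑ u : U, f.coeff u • ρ u w = f.coeff 1 • ((ρ x - 1) ^ (p - 1)) w := by
        simp only [hconst]
        rw [← Finset.smul_sum, ← norm_zpowers_eq hx, Representation.norm, LinearMap.sum_apply]
        rfl
      rw [hΦ, h1] at h0
      have h2 : (β.symm c : V) = 0 := by
        obtain ⟨y, hy⟩ := (β.symm c).2
        have h3 : e (β.symm c : V) = β.symm c := by
          rw [← hy]
          exact LinearMap.congr_fun he.idem.eq y
        have h5 : e (f.coeff 1 • ((ρ x - 1) ^ (p - 1)) w) = 0 :=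
          he.apply_of_mem_range (range_pow_sub_one_le (p := p)
            (Submodule.smul_mem _ (f.coeff 1) ⟨w, rfl⟩))
        calc (β.symm c : V) = e (β.symm c) := h3.symm
          _ = e (f.coeff 1 • ((ρ x - 1) ^ (p - 1)) w + β.symm c) := by rw [map_add, h5, zero_add]
          _ = 0 := by rw [h0, map_zero]
      have hc : c = 0 := β.symm.injective (Subtype.ext (by rw [h2, map_zero]; rfl))
      rw [h2, add_zero] at h0
      have h4 : f.coeff 1 = 0 := (smul_eq_zero.1 h0).resolve_right hw
      have hf : f = 0 := by
        ext u
        rw [hconst, h4]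
        rfl
      rw [hf, hc]
      rfl
  have hcard : Fintype.card U = p := by
    rw [← Nat.card_eq_fintype_card, Nat.card_zpowers, hx]
  have hfr : Module.finrank k (k[U] × (Fin a → k)) = p + a := by
    rw [Module.finrank_prod, Module.finrank_fin_fun,
      ((MonoidAlgebra.coeffLinearEquiv k).trans
        (Finsupp.linearEquivFunOnFinite k k U)).finrank_eq, Module.finrank_fintype_fun_eq_card,
      hcard]
  have hfin : Module.Finite k (k[U] × (Fin a → k)) := Module.Finite.of_injective Φ hinj
  have h1 := LinearMap.finrank_le_finrank_of_injective hinj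
  have h2 := LinearMap.finrank_range_add_finrank_ker (ρ x - 1)
  have h3 := he.finrank_ker hb
  have hp1 := (Fact.out : p.Prime).one_le
  -- The rank of X is at most p - 1 and its nullity at most 1 + a, so the injection Φ from dimension
  -- p + a is onto.
  have h4 := finrank_range_le (X := ρ x - 1) (r := p - 1)
    (by rw [Nat.sub_add_cancel hp1]; exact sub_one_pow_eq_zero hx) hb
  have h5 : Module.finrank k V = p + a := by
    change _ ≤ 1 + a at h3
    omega
  refine ⟨h5, ⟨Representation.Equiv.symm (Representation.Equiv.mk
    (LinearEquiv.ofInjectiveOfFinrankEq Φ hinj (by rw [hfr, h5])) fun u => ?_)⟩⟩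
  exact LinearMap.ext fun v => hΦσ u v

end IsTrivialPartProjection

end Structure

/-! ### Vertices -/

section Vertex

variable {k : Type*} [Field k] {G : Type u} [Group G] {V : Type v} [AddCommGroup V] [Module k V]
  {ρ : Representation k G V}

theorem isVertex_bot (hρ : IsRelativelyProjective ⊥ ρ) : IsVertex ⊥ ρ :=
  ⟨hρ, fun _ _ _ => bot_le⟩

theorem isVertex_of_prime_card {p : ℕ} [Fact p.Prime] {Q : Subgroup G} [Finite (G ⧸ Q)]
    (hcard : Nat.card Q = p) (hidx : (Q.index : k) ≠ 0) (hbot : ¬ IsRelativelyProjective ⊥ ρ) :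
    IsVertex Q ρ := by
  refine ⟨isRelativelyProjective_of_index_ne_zero Q hidx, fun R hR hRQ => ?_⟩
  have : Fact (Nat.card Q).Prime := by rw [hcard]; infer_instance
  rcases (R.subgroupOf Q).eq_bot_or_eq_top_of_prime_card with h | h
  · rw [Subgroup.subgroupOf_eq_bot, disjoint_iff, inf_eq_left.2 hRQ] at h
    rw [h] at hR
    exact absurd hR hbot
  · exact Subgroup.subgroupOf_eq_top.1 h

theorem relTrace_bot [Fintype G] {A : Type*} [AddCommGroup A] [Module k A]
    (α : Representation k G A) (a : A) : relTrace α ⊥ a = α.norm a := by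
  have := Fintype.ofFinite (G ⧸ (⊥ : Subgroup G))
  rw [relTrace_apply, Representation.norm, LinearMap.sum_apply]
  refine Fintype.sum_bijective (fun c : G ⧸ (⊥ : Subgroup G) => c.out)
    ⟨Quotient.out_injective, fun g => ⟨(g : G ⧸ (⊥ : Subgroup G)), ?_⟩⟩ _ _ fun c => rfl
  have h := QuotientGroup.eq.1 (QuotientGroup.out_eq' (g : G ⧸ (⊥ : Subgroup G)))
  exact inv_mul_eq_one.1 (Subgroup.mem_bot.1 h)

theorem IsIndecomposable.isTrivialSource_of_isRelativelyProjective_bot [Finite G]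
    [FiniteDimensional k V] (hρ : IsIndecomposable ρ) (h : IsRelativelyProjective ⊥ ρ) :
    IsTrivialSource ρ := by
  have := Fintype.ofFinite G
  obtain ⟨φ, hφ⟩ := h.exists_norm_conj_eq_one
  refine ⟨⊥, isVertex_bot h, isIndecomposable_trivial,
    hρ.isSummand_ind_trivial (e := φ) ?_ ?_ ?_⟩
  · rintro g hg
    rw [Subgroup.mem_bot.1 hg, map_one, one_mul]
  · rintro g hg
    rw [Subgroup.mem_bot.1 hg, map_one, mul_one]
  · rw [relTrace_bot, hφ]
    exact isUnit_one

end Vertex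

/-! ### One-dimensional fixed spaces and rank-one norms -/

section Cyclic

variable {p : ℕ} [Fact p.Prime] {k : Type*} [Field k] [CharP k p] {G : Type u} [Group G]
  {V : Type v} [AddCommGroup V] [Module k V] {ρ : Representation k G V} {x : G}

/-- Every nonzero submodule contains a nonzero fixed vector, hence the line of b, so two of them
cannot be disjoint. -/
theorem isIndecomposable_res_zpowers [Nontrivial V] (hx : orderOf x = p) {b : V}
    (hb : LinearMap.ker (ρ x - 1) ≤ k ∙ b) :
    IsIndecomposable (res (Subgroup.zpowers x) ρ) := by
  refine ⟨inferInstance, fun A B hAB => ?_⟩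
  have key (A : Subrepresentation (res (Subgroup.zpowers x) ρ)) (hA : A ≠ ⊥) :
      b ∈ A.toSubmodule := by
    obtain ⟨v, hv, hv0⟩ := A.toSubmodule.ne_bot_iff.1 fun h =>
      hA (Subrepresentation.toSubmodule_injective h)
    obtain ⟨j, hj, hj'⟩ := exists_pow_apply_mem_ker (isNilpotent_sub_one (ρ := ρ) hx) hv0
    have hmem : ((ρ x - 1) ^ j) v ∈ A.toSubmodule := pow_apply_mem (fun w hw =>
      A.toSubmodule.sub_mem (A.apply_mem_toSubmodule ⟨x, Subgroup.mem_zpowers x⟩ hw) hw) j hv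
    obtain ⟨s, hs⟩ := Submodule.mem_span_singleton.1 (hb hj')
    rw [← hs] at hj hmem
    exact (A.toSubmodule.smul_mem_iff fun h => hj (by rw [h, zero_smul])).1 hmem
  by_contra! h
  have hbot : A.toSubmodule ⊓ B.toSubmodule = ⊥ :=
    congrArg Subrepresentation.toSubmodule (disjoint_iff.1 hAB.1)
  have hb0 : b ∈ A.toSubmodule ⊓ B.toSubmodule := ⟨key A h.1, key B h.2⟩
  rw [hbot, Submodule.mem_bot] at hb0
  rw [hb0, Submodule.span_zero_singleton, le_bot_iff] at hb
  obtain ⟨v, hv⟩ := exists_ne (0 : V)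
  obtain ⟨j, hj, hj'⟩ := exists_pow_apply_mem_ker (isNilpotent_sub_one (ρ := ρ) hx) hv
  rw [hb] at hj'
  exact hj hj'

theorem exists_dual_eq_one {v : V} (hv : v ≠ 0) : ∃ l : V →ₗ[k] k, l v = 1 := by
  obtain ⟨f, hf⟩ := Module.Projective.exists_dual_ne_zero k hv
  exact ⟨(f v)⁻¹ • f, by rw [LinearMap.smul_apply, smul_eq_mul, inv_mul_cancel₀ hf]⟩

theorem commute_conjNorm {U : Subgroup G} [Fintype U] (b : Module.End k V) {h : G} (hh : h ∈ U) :
    Commute (ρ h) (conjNorm ρ U b) :=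
  conj_eq_self_iff.1 (Representation.self_norm_apply ((conj ρ).comp U.subtype) ⟨h, hh⟩ b)

variable [Fintype (Subgroup.zpowers x)]

/-- With l(X^(p-1) w) = 1, the trace of l ⊗ w fixes X^(p-1) w, which spans the fixed space. It is
therefore injective, hence a unit, and dividing by it yields trace 1. -/
theorem exists_conjNorm_eq_one [FiniteDimensional k V] (hx : orderOf x = p) {b : V}
    (hb : LinearMap.ker (ρ x - 1) ≤ k ∙ b) (hp : (ρ x - 1) ^ (p - 1) ≠ 0) :
    ∃ φ, conjNorm ρ (Subgroup.zpowers x) φ = 1 := by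
  obtain ⟨w, hw⟩ : ∃ w, ((ρ x - 1) ^ (p - 1)) w ≠ 0 := by
    by_contra! h
    exact hp (LinearMap.ext h)
  obtain ⟨l, hl⟩ := exists_dual_eq_one (k := k) hw
  let n := ((ρ x - 1) ^ (p - 1)) w
  let θ := conjNorm ρ (Subgroup.zpowers x) (l.smulRight w)
  have hn : n ∈ LinearMap.ker (ρ x - 1) := range_pow_sub_one_le_ker hx ⟨w, rfl⟩
  have hθn : θ n = n := by
    rw [conjNorm_apply_of_fixed _ (forall_mem_zpowers_apply_eq_iff.2 hn), norm_zpowers_eq hx,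
      LinearMap.smulRight_apply, hl, one_smul]
  have hθ : ∀ h ∈ Subgroup.zpowers x, Commute (ρ h) θ := fun h hh => commute_conjNorm _ hh
  have hinj : Function.Injective θ := by
    refine injective_of_forall_mem_ker (Y := ρ x - 1) (X := ρ x - 1) (fun v => ?_)
      (isNilpotent_sub_one hx) fun v hv hv0 => ?_
    · have := ((hθ x (Subgroup.mem_zpowers x)).sub_left (Commute.one_left θ)).eq
      exact (LinearMap.congr_fun this v).symm
    · obtain ⟨s, hs⟩ := Submodule.mem_span_singleton.1 (hb hn)
      obtain ⟨t, ht⟩ := Submodule.mem_span_singleton.1 (hb hv)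
      have hs0 : s ≠ 0 := fun h => hw (by rw [h, zero_smul] at hs; exact hs.symm)
      have hvn : v = (t * s⁻¹) • n := by
        rw [← hs, smul_smul, mul_assoc, inv_mul_cancel₀ hs0, mul_one, ht]
      rw [hvn, map_smul, hθn, ← hvn] at hv0
      exact hv0
  obtain ⟨y, hy⟩ := (LinearMap.isUnit_iff_ker_eq_bot θ).2 (LinearMap.ker_eq_bot.2 hinj)
  refine ⟨(↑y⁻¹ : Module.End k V) * l.smulRight w, ?_⟩
  rw [← mul_conjNorm fun h hh => Commute.units_inv_right (by rw [hy]; exact hθ h hh)]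
  change (↑y⁻¹ : Module.End k V) * θ = 1
  rw [← hy, Units.inv_mul]

/-- An irreducible representation on which the norm of a cyclic subgroup of order `p` does not
vanish and has rank one is absolutely irreducible. -/
theorem span_range_eq_top_of_pow_ne_zero [FiniteDimensional k V] (hρ : ρ.IsIrreducible)
    (hx : orderOf x = p) {b : V}
    (hb : LinearMap.ker (ρ x - 1) ⊓ LinearMap.range (ρ x - 1) ≤ k ∙ b)
    (hp : (ρ x - 1) ^ (p - 1) ≠ 0) : Submodule.span k (Set.range ρ) = ⊤ := by
  obtain ⟨w, hw⟩ : ∃ w, ((ρ x - 1) ^ (p - 1)) w ≠ 0 := by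
    by_contra! h
    exact hp (LinearMap.ext h)
  obtain ⟨l, hl⟩ := exists_dual_eq_one (k := k) hw
  have hbn (v : V) : ((ρ x - 1) ^ (p - 1)) v ∈ k ∙ b :=
    hb ⟨range_pow_sub_one_le_ker hx ⟨v, rfl⟩, range_pow_sub_one_le ⟨v, rfl⟩⟩
  -- The image of X^(p-1) lies in the line of b, so the norm is itself an operator of rank one, and
  -- it is a sum of group elements.
  have heq : (l ∘ₗ (ρ x - 1) ^ (p - 1)).smulRight (((ρ x - 1) ^ (p - 1)) w) =
      (ρ x - 1) ^ (p - 1) := by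
    refine LinearMap.ext fun v => ?_
    rw [LinearMap.smulRight_apply, LinearMap.comp_apply]
    obtain ⟨s, hs⟩ := Submodule.mem_span_singleton.1 (hbn w)
    obtain ⟨t, ht⟩ := Submodule.mem_span_singleton.1 (hbn v)
    rw [← hs, map_smul, smul_eq_mul] at hl
    rw [← hs, ← ht, map_smul, smul_eq_mul, smul_smul, mul_assoc, mul_comm (l b), hl, mul_one]
  refine span_eq_top_of_smulRight_mem hρ hw (l := l ∘ₗ (ρ x - 1) ^ (p - 1)) (fun h => ?_) ?_
  · refine hp (heq.symm.trans (LinearMap.ext fun v => ?_))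
    rw [h, LinearMap.smulRight_apply, LinearMap.zero_apply, zero_smul, LinearMap.zero_apply]
  · rw [heq, ← norm_zpowers_eq hx, Representation.norm]
    exact Submodule.sum_mem _ fun u _ => Submodule.subset_span ⟨u, rfl⟩

end Cyclic

/-! ### Equivariant projections -/

section Projection

variable {k : Type*} [Field k] {G : Type u} [Group G] {V : Type v} [AddCommGroup V] [Module k V]
  {ρ : Representation k G V}

theorem exists_projection {A B : Subrepresentation ρ} (h : IsCompl A B) :
    ∃ q : Representation.IntertwiningMap ρ ρ, (∀ v, q v ∈ A.toSubmodule) ∧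
      (∀ v ∈ A.toSubmodule, q v = v) ∧ ∀ v ∈ B.toSubmodule, q v = 0 := by
  have hc : IsCompl A.toSubmodule B.toSubmodule :=
    ⟨disjoint_iff.2 (congrArg Subrepresentation.toSubmodule (disjoint_iff.1 h.1)),
      codisjoint_iff.2 (congrArg Subrepresentation.toSubmodule (codisjoint_iff.1 h.2))⟩
  let q : Module.End k V := A.toSubmodule.subtype ∘ₗ Submodule.projectionOnto _ _ hc
  have hqA (v : V) : q v ∈ A.toSubmodule := (Submodule.projectionOnto _ _ hc v).2
  have hq1 {v : V} (hv : v ∈ A.toSubmodule) : q v = v :=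
    congrArg Subtype.val (Submodule.projectionOnto_apply_left hc ⟨v, hv⟩)
  have hq0 {v : V} (hv : v ∈ B.toSubmodule) : q v = 0 :=
    congrArg Subtype.val ((Submodule.projectionOnto_apply_eq_zero_iff hc).2 hv)
  have hqB (v : V) : v - q v ∈ B.toSubmodule := by
    rw [← Submodule.projectionOnto_apply_eq_zero_iff hc, map_sub, sub_eq_zero]
    exact (Submodule.projectionOnto_apply_left hc (Submodule.projectionOnto _ _ hc v)).symm
  refine ⟨⟨q, fun g => LinearMap.ext fun v => ?_⟩, hqA, fun v hv => hq1 hv, fun v hv => hq0 hv⟩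
  change q (ρ g v) = ρ g (q v)
  conv_lhs => rw [← add_sub_cancel (q v) v]
  rw [map_add, map_add, hq1 (A.apply_mem_toSubmodule g (hqA v)),
    hq0 (B.apply_mem_toSubmodule g (hqB v)), add_zero]

theorem IsIndecomposable.eq_zero_or_eq_one [FiniteDimensional k V] (hρ : IsIndecomposable ρ)
    {f : Module.End k V} (hf : ∀ g, Commute (ρ g) f) (hff : IsIdempotentElem f) :
    f = 0 ∨ f = 1 := by
  rcases hρ.isNilpotent_or_isUnit hf with ⟨n, hn⟩ | hu
  · left
    rw [← hff.pow_succ_eq n, pow_succ, hn, zero_mul]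
  · right
    exact hu.mul_left_cancel (hff.eq.trans (mul_one f).symm)

end Projection

/-! ### The trivial part as Green correspondent -/

section TrivialPart

variable {p : ℕ} [Fact p.Prime] {k : Type*} [Field k] [CharP k p] {G : Type u} [Group G] [Finite G]
  {V : Type v} [AddCommGroup V] [Module k V] [FiniteDimensional k V] {ρ : Representation k G V}
  {x : G} {e : Module.End k V}

namespace IsTrivialPartProjection

/-- The image of the projection as a representation of the normalizer. -/
def subrepresentation (he : IsTrivialPartProjection ρ x e) :
    Subrepresentation (res (Subgroup.normalizer (Subgroup.zpowers x : Set G)) ρ) where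
  toSubmodule := LinearMap.range e
  apply_mem_toSubmodule := by
    rintro n _ ⟨v, rfl⟩
    exact ⟨ρ n v, (LinearMap.congr_fun (he.comm n n.2).eq v).symm⟩

variable (he : IsTrivialPartProjection ρ x e)
include he

omit [Finite G] [FiniteDimensional k V] in
theorem apply_of_mem {v : V} (hv : v ∈ LinearMap.range e) : e v = v := by
  obtain ⟨w, rfl⟩ := hv
  exact LinearMap.congr_fun he.idem.eq w

omit [Finite G] [FiniteDimensional k V] in
theorem eq_zero_of_mem {v : V} (hv : v ∈ LinearMap.range e)
    (hv' : v ∈ LinearMap.range (ρ x - 1)) : v = 0 := by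
  rw [← he.apply_of_mem hv, he.apply_of_mem_range hv']

omit [Finite G] [FiniteDimensional k V] in
theorem mem_ker_of_mem {v : V} (hv : v ∈ LinearMap.range e) :
    v ∈ LinearMap.ker (ρ x - 1) := by
  rw [← he.apply_of_mem hv]
  exact he.apply_mem_ker v

omit [FiniteDimensional k V] in
theorem not_isRelativelyProjective_bot (hx : orderOf x = p) (he0 : e ≠ 0) :
    ¬ IsRelativelyProjective ⊥ ρ := by
  have := Fintype.ofFinite (Subgroup.zpowers x)
  intro h
  refine he0 (LinearMap.ext fun v => ?_)
  have h1 := h.mem_range_norm (Subgroup.zpowers x)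
    (forall_mem_zpowers_apply_eq_iff.2 (he.apply_mem_ker v))
  rw [norm_zpowers_eq hx] at h1
  exact he.eq_zero_of_mem ⟨v, rfl⟩ (range_pow_sub_one_le h1)

omit [FiniteDimensional k V] in
theorem isVertex (hx : orderOf x = p) (hidx : ((Subgroup.zpowers x).index : k) ≠ 0)
    (he0 : e ≠ 0) : IsVertex (Subgroup.zpowers x) ρ :=
  isVertex_of_prime_card (by rw [Nat.card_zpowers, hx]) hidx
    (he.not_isRelativelyProjective_bot hx he0)

theorem isTrivialSource (hρ : IsIndecomposable ρ) (hx : orderOf x = p)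
    (hidx : ((Subgroup.zpowers x).index : k) ≠ 0) (he0 : e ≠ 0) : IsTrivialSource ρ := by
  have := Fintype.ofFinite (Subgroup.zpowers x)
  refine ⟨Subgroup.zpowers x, he.isVertex hx hidx he0, isIndecomposable_trivial,
    hρ.isSummand_ind_trivial (e := e) (fun h hh => LinearMap.ext fun v => ?_)
      (fun h hh => LinearMap.ext fun v => ?_) (he.isUnit_relTrace hρ hx hidx he0).1⟩
  · exact forall_mem_zpowers_apply_eq_iff.2 (he.apply_mem_ker v) h hh
  · change e (ρ h v) = e v
    rw [← sub_eq_zero, ← map_sub]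
    exact he.apply_of_mem_range (apply_sub_mem_range hh v)

omit [Finite G] [FiniteDimensional k V] in
theorem subrepresentation_apply_of_mem (n : Subgroup.normalizer (Subgroup.zpowers x : Set G))
    (hn : n ∈ (Subgroup.zpowers x).subgroupOf
      (Subgroup.normalizer (Subgroup.zpowers x : Set G))) :
    he.subrepresentation.toRepresentation n = 1 :=
  LinearMap.ext fun v => Subtype.ext
    (forall_mem_zpowers_apply_eq_iff.2 (he.mem_ker_of_mem v.2) n hn)

/-- A decomposition of im e yields an N-idempotent f of M. By the dichotomy f or 1 - f is a norm, so
the summand it fixes lies in im X; but im e meets im X only in 0. -/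
theorem isIndecomposable_subrepresentation (hρ : IsIndecomposable ρ)
    (hx : orderOf x = p) (hidx : ((Subgroup.zpowers x).index : k) ≠ 0) (he0 : e ≠ 0) :
    IsIndecomposable he.subrepresentation.toRepresentation := by
  have := Fintype.ofFinite (Subgroup.zpowers x)
  refine ⟨Submodule.nontrivial_iff_ne_bot.2 fun h => he0 (LinearMap.range_eq_bot.1 h),
    fun A B hAB => ?_⟩
  obtain ⟨q, hqA, hq1, hq0⟩ := exists_projection hAB
  let π : V →ₗ[k] he.subrepresentation.toSubmodule := e.rangeRestrict
  let f : Module.End k V :=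
    he.subrepresentation.toSubmodule.subtype ∘ₗ q.toLinearMap ∘ₗ π
  have hf (v : V) : f v = q (π v) := rfl
  have hfz (z : he.subrepresentation.toSubmodule) : f z = q z := by
    rw [hf]
    congr 2
    exact Subtype.ext (he.apply_of_mem z.2)
  have hff : IsIdempotentElem f := LinearMap.ext fun v => by
    change f (f v) = f v
    rw [hf v, hfz]
    exact congrArg Subtype.val (hq1 _ (hqA _))
  have hfN : ∀ g ∈ Subgroup.normalizer (Subgroup.zpowers x : Set G), Commute (ρ g) f := by
    refine fun g hg => LinearMap.ext fun v => ?_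
    change ρ g (f v) = f (ρ g v)
    rw [hf, hf]
    have h1 : π (ρ g v) =
        he.subrepresentation.toRepresentation ⟨g, hg⟩ (π v) :=
      Subtype.ext (LinearMap.congr_fun (he.comm g hg).eq v).symm
    rw [h1]
    exact (congrArg Subtype.val (q.isIntertwining _ _ ⟨g, hg⟩ (π v))).symm
  rcases hρ.conjNorm_zpowers_or_isUnit_relTrace hx hidx hff hfN with ⟨b, hb⟩ | ⟨-, b, hb⟩
  · left
    refine Subrepresentation.toSubmodule_injective ((Submodule.eq_bot_iff _).2 fun z hz => ?_)
    refine Subtype.ext (he.eq_zero_of_mem z.2 (range_pow_sub_one_le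
      (mem_range_pow_of_conjNorm hx hb (he.mem_ker_of_mem z.2) ?_)))
    rw [hfz, hq1 z hz]
  · right
    refine Subrepresentation.toSubmodule_injective ((Submodule.eq_bot_iff _).2 fun z hz => ?_)
    refine Subtype.ext (he.eq_zero_of_mem z.2 (range_pow_sub_one_le
      (mem_range_pow_of_conjNorm hx hb (he.mem_ker_of_mem z.2) ?_)))
    rw [LinearMap.sub_apply, hfz, hq0 z hz]
    exact sub_zero (z : V)

theorem isIrreducible_subrepresentation (hρ : IsIndecomposable ρ)
    (hx : orderOf x = p) (hidx : ((Subgroup.zpowers x).index : k) ≠ 0) (he0 : e ≠ 0) :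
    he.subrepresentation.toRepresentation.IsIrreducible :=
  (he.isIndecomposable_subrepresentation hρ hx hidx he0).isIrreducible_of_trivial _
    (natCast_relIndex_ne_zero hidx (zpowers_le_normalizer x)) he.subrepresentation_apply_of_mem

-- U acts trivially on im e, so its norm there is multiplication by p, that is 0; relative
-- projectivity over the trivial subgroup would make every vector a norm.
omit [Fact p.Prime] [FiniteDimensional k V] in
theorem not_isRelativelyProjective_bot_subrepresentation (hx : orderOf x = p) (he0 : e ≠ 0) :
    ¬ IsRelativelyProjective ⊥ he.subrepresentation.toRepresentation := by
  intro h
  let N := Subgroup.normalizer (Subgroup.zpowers x : Set G)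
  let Q : Subgroup N := (Subgroup.zpowers x).subgroupOf N
  have := Fintype.ofFinite Q
  have hcard : Fintype.card Q = p := by
    rw [← Nat.card_eq_fintype_card, Nat.card_congr
      (Subgroup.subgroupOfEquivOfLe (zpowers_le_normalizer x)).toEquiv, Nat.card_zpowers, hx]
  refine he0 (LinearMap.ext fun v => ?_)
  obtain ⟨z, hz⟩ := h.mem_range_norm Q (v := (⟨e v, v, rfl⟩ : he.subrepresentation.toSubmodule))
    fun n hn => by rw [he.subrepresentation_apply_of_mem n hn, Module.End.one_apply]
  have hnorm : Representation.norm (he.subrepresentation.toRepresentation.comp Q.subtype) = 0 := by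
    have h1 (n : Q) : (he.subrepresentation.toRepresentation.comp Q.subtype) n = 1 :=
      he.subrepresentation_apply_of_mem n n.2
    rw [Representation.norm]
    simp only [h1, Finset.sum_const, Finset.card_univ, hcard]
    rw [← Nat.cast_smul_eq_nsmul k, CharP.cast_eq_zero, zero_smul]
  rw [hnorm] at hz
  exact (congrArg Subtype.val hz).symm

theorem isGreenCorrespondent (hρ : IsIndecomposable ρ)
    (hx : orderOf x = p) (hidx : ((Subgroup.zpowers x).index : k) ≠ 0) (he0 : e ≠ 0) :
    IsGreenCorrespondent (Subgroup.zpowers x) ρ he.subrepresentation.toRepresentation := by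
  refine ⟨he.isVertex hx hidx he0, he.isIndecomposable_subrepresentation hρ hx hidx he0,
    isVertex_of_prime_card (p := p) ?_ (natCast_relIndex_ne_zero hidx (zpowers_le_normalizer x))
      (he.not_isRelativelyProjective_bot_subrepresentation hx he0),
    ⟨(LinearMap.range e).subtype, fun n => rfl⟩,
    ⟨e.rangeRestrict, fun n => LinearMap.ext fun v => ?_⟩, fun z => ?_⟩
  · rw [Nat.card_congr
      (Subgroup.subgroupOfEquivOfLe (zpowers_le_normalizer x)).toEquiv, Nat.card_zpowers, hx]
  · exact Subtype.ext (LinearMap.congr_fun (he.comm n n.2).eq v).symm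
  · exact Subtype.ext (he.apply_of_mem z.2)

end IsTrivialPartProjection

end TrivialPart

/-! ### Simplicity of the module and of its Green correspondents -/

section TrivialPart

variable {p : ℕ} [Fact p.Prime] {k : Type*} [Field k] [CharP k p] {G : Type u} [Group G] [Finite G]
  {V : Type v} [AddCommGroup V] [Module k V] [FiniteDimensional k V] {ρ : Representation k G V}
  {x : G} {e : Module.End k V}

namespace IsTrivialPartProjection

variable (he : IsTrivialPartProjection ρ x e)
include he

-- On L the map 1 - e embeds ker X into the line of b, since a vector fixed by e would lie in L ⊓ im
-- e = 0. So L / X L has dimension at most 1, and e restricted to L factors through it.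
omit [Fact p.Prime] [CharP k p] [Finite G] in
theorem finrank_range_le_one {b : V}
    (hb : LinearMap.ker (ρ x - 1) ⊓ LinearMap.range (ρ x - 1) ≤ k ∙ b) {L : Submodule k V}
    (hL : ∀ v ∈ L, ρ x v ∈ L) (hLe : ∀ z ∈ LinearMap.range e, z ∈ L → z = 0)
    (hsurj : ∀ z ∈ LinearMap.range e, ∃ v ∈ L, e v = z) :
    Module.finrank k (LinearMap.range e) ≤ 1 := by
  let X : Module.End k L := (ρ x - 1).restrict fun v hv => L.sub_mem (hL v hv) hv
  let f : L →ₗ[k] V := e.domRestrict L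
  have h1 : LinearMap.range f = LinearMap.range e := by
    refine le_antisymm ?_ fun z hz => ?_
    · rintro _ ⟨v, rfl⟩
      exact ⟨v, rfl⟩
    · obtain ⟨v, hv, rfl⟩ := hsurj z hz
      exact ⟨⟨v, hv⟩, rfl⟩
  have h2 : LinearMap.range X ≤ LinearMap.ker f := by
    rintro _ ⟨v, rfl⟩
    exact LinearMap.congr_fun he.mul_sub_one v
  let g : LinearMap.ker X →ₗ[k] (k ∙ b) :=
    LinearMap.codRestrict _ ((1 - e) ∘ₗ L.subtype ∘ₗ (LinearMap.ker X).subtype) (by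
      intro v
      have hv : (v : V) ∈ LinearMap.ker (ρ x - 1) := congrArg Subtype.val v.2
      have h : ((v : L) : V) - e v ∈ LinearMap.ker (ρ x - 1) :=
        Submodule.sub_mem _ hv (he.apply_mem_ker _)
      have h' : e (((v : L) : V) - e v) = 0 := by
        rw [map_sub, he.apply_of_mem ⟨_, rfl⟩, sub_self]
      exact hb ⟨h, he.mem_range _ h h'⟩)
  have hg : Function.Injective g := by
    rw [injective_iff_map_eq_zero]
    intro v hv
    have h : ((v : L) : V) - e v = 0 := congrArg Subtype.val hv
    rw [sub_eq_zero] at h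
    exact Subtype.ext (Subtype.ext (hLe _ (by rw [h]; exact ⟨_, rfl⟩) (v : L).2))
  have h3 := LinearMap.finrank_le_finrank_of_injective hg
  have h4 : Module.finrank k (k ∙ b) ≤ 1 := (finrank_span_le_card ({b} : Set V)).trans (by simp)
  have h5 := LinearMap.finrank_range_add_finrank_ker X
  have h6 := LinearMap.finrank_range_add_finrank_ker f
  have h7 := Submodule.finrank_mono h2
  rw [h1] at h6
  omega

/-- As im e is a simple N-module, L ⊓ im e and e(L) are each 0 or im e. If L contains im e, it
contains the image of the invertible Tr e. If e(L) = 0, then Tr e kills L. The remaining case L ⊓ im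
e = 0, e(L) = im e forces rank e ≤ 1. -/
theorem isIrreducible (hρ : IsIndecomposable ρ)
    (hx : orderOf x = p) (hidx : ((Subgroup.zpowers x).index : k) ≠ 0) {b : V}
    (hb : LinearMap.ker (ρ x - 1) ⊓ LinearMap.range (ρ x - 1) ≤ k ∙ b)
    (h2 : 2 ≤ Module.finrank k (LinearMap.range e)) : ρ.IsIrreducible := by
  have := Fintype.ofFinite (Subgroup.zpowers x)
  have := Fintype.ofFinite (G ⧸ Subgroup.zpowers x)
  have he0 : e ≠ 0 := by
    rintro rfl
    rw [LinearMap.range_zero, finrank_bot] at h2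
    omega
  have := hρ.1
  have : Nontrivial (Subrepresentation ρ) :=
    ⟨⟨⊥, ⊤, fun h => bot_ne_top (congrArg Subrepresentation.toSubmodule h)⟩⟩
  have hirr := he.isIrreducible_subrepresentation hρ hx hidx he0
  obtain ⟨y, hy⟩ := (he.isUnit_relTrace hρ hx hidx he0).1
  have hyv (v : V) : (y : Module.End k V) v =
      ∑ c : G ⧸ Subgroup.zpowers x, ρ c.out (e (ρ c.out⁻¹ v)) := by
    rw [hy, relTrace_apply, LinearMap.sum_apply]
    rfl
  have hyy (v : V) : (y : Module.End k V) ((↑y⁻¹ : Module.End k V) v) = v := by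
    rw [← Module.End.mul_apply, Units.mul_inv, Module.End.one_apply]
  have hyy' (v : V) : (↑y⁻¹ : Module.End k V) ((y : Module.End k V) v) = v := by
    rw [← Module.End.mul_apply, Units.inv_mul, Module.End.one_apply]
  refine ⟨fun L => ?_⟩
  let S : Subrepresentation he.subrepresentation.toRepresentation :=
    ⟨L.toSubmodule.comap he.subrepresentation.toSubmodule.subtype,
      fun n _ hv => L.apply_mem_toSubmodule (n : G) hv⟩
  rcases hirr.eq_bot_or_eq_top S with hS | hS
  · let T : Subrepresentation he.subrepresentation.toRepresentation :=
      ⟨(L.toSubmodule.map e).comap he.subrepresentation.toSubmodule.subtype, by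
        rintro n v ⟨w, hw, hwv⟩
        refine ⟨ρ n w, L.apply_mem_toSubmodule (n : G) hw, ?_⟩
        have := LinearMap.congr_fun (he.comm n n.2).eq w
        change _ = ρ n (v : V)
        change e w = v at hwv
        rw [← hwv]
        exact this.symm⟩
    rcases hirr.eq_bot_or_eq_top T with hT | hT
    · left
      refine Subrepresentation.toSubmodule_injective ((Submodule.eq_bot_iff _).2 fun v hv => ?_)
      have hev {w : V} (hw : w ∈ L.toSubmodule) : e w = 0 := by
        have h : (⟨e w, w, rfl⟩ : he.subrepresentation.toSubmodule) ∈ T.toSubmodule := ⟨w, hw, rfl⟩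
        rw [hT] at h
        exact congrArg Subtype.val h
      rw [← hyy' v, hyv]
      simp only [hev (L.apply_mem_toSubmodule _ hv), map_zero, Finset.sum_const_zero]
    · refine absurd (he.finrank_range_le_one hb (L := L.toSubmodule)
        (fun v hv => L.apply_mem_toSubmodule x hv) (fun z hz hzL => ?_) fun z hz => ?_) (by omega)
      · have h : (⟨z, hz⟩ : he.subrepresentation.toSubmodule) ∈ S.toSubmodule := hzL
        rw [hS] at h
        exact congrArg Subtype.val h
      · have h : (⟨z, hz⟩ : he.subrepresentation.toSubmodule) ∈ T.toSubmodule := by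
          rw [hT]
          exact Submodule.mem_top
        exact h
  · right
    refine Subrepresentation.toSubmodule_injective (eq_top_iff.2 fun v _ => ?_)
    have heL (w : V) : e w ∈ L.toSubmodule := by
      have h : (⟨e w, w, rfl⟩ : he.subrepresentation.toSubmodule) ∈ S.toSubmodule := by
        rw [hS]
        exact Submodule.mem_top
      exact h
    rw [← hyy v, hyv]
    exact Submodule.sum_mem _ fun c _ => L.apply_mem_toSubmodule _ (heL _)

theorem isIrreducible_of_isGreenCorrespondent (hρ : IsIndecomposable ρ)
    (hx : orderOf x = p) (hidx : ((Subgroup.zpowers x).index : k) ≠ 0) {b : V}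
    (hb : LinearMap.ker (ρ x - 1) ⊓ LinearMap.range (ρ x - 1) ≤ k ∙ b) (hX : ρ x ≠ 1)
    (he0 : e ≠ 0) {W : Type w} [AddCommGroup W] [Module k W]
    {τ : Representation k (Subgroup.normalizer (Subgroup.zpowers x : Set G)) W}
    (hτ : IsGreenCorrespondent (Subgroup.zpowers x) ρ τ) : τ.IsIrreducible := by
  let N := Subgroup.normalizer (Subgroup.zpowers x : Set G)
  let Q : Subgroup N := (Subgroup.zpowers x).subgroupOf N
  have := Fintype.ofFinite (Subgroup.zpowers x)
  have := Fintype.ofFinite Q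
  have hidxQ : (Q.index : k) ≠ 0 := natCast_relIndex_ne_zero hidx (zpowers_le_normalizer x)
  let x' : N := ⟨x, zpowers_le_normalizer x (Subgroup.mem_zpowers x)⟩
  obtain ⟨-, hind, hvert, i, r, hri⟩ := hτ
  have hi : Function.Injective i := Function.LeftInverse.injective hri
  have : FiniteDimensional k W := Module.Finite.of_injective i.toLinearMap hi
  have hiN (n : N) (v : W) : i (τ n v) = ρ n (i v) := i.isIntertwining _ _ n v
  have hrN (n : N) (v : V) : r (ρ n v) = τ n (r v) := r.isIntertwining _ _ n v
  -- Otherwise minimality of the vertex would put x in the trivial subgroup.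
  have hbot : ¬ IsRelativelyProjective ⊥ τ := by
    intro h
    have hx1 : x' ∈ (⊥ : Subgroup N) := hvert.2 h bot_le (Subgroup.mem_zpowers x)
    have : x = 1 := congrArg Subtype.val (Subgroup.mem_bot.1 hx1)
    rw [this, orderOf_one] at hx
    exact (Fact.out : p.Prime).one_lt.ne hx
  let f : Module.End k V := i.toLinearMap ∘ₗ r.toLinearMap
  have hf (v : V) : f v = i (r v) := rfl
  have hfi (w : W) : f (i w) = i w := by rw [hf, hri]
  have hff : IsIdempotentElem f := LinearMap.ext fun v => hfi (r v)
  have hfN : ∀ g ∈ N, Commute (ρ g) f := fun g hg => LinearMap.ext fun v => by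
    change ρ g (i (r v)) = i (r (ρ g v))
    rw [hrN ⟨g, hg⟩, hiN]
  have hfX (v : V) : f ((ρ x - 1) v) = (ρ x - 1) (f v) := by
    have := ((hfN x x'.2).sub_left (Commute.one_left f)).eq
    exact (LinearMap.congr_fun this v).symm
  have hfXj (j : ℕ) (v : V) : f (((ρ x - 1) ^ j) v) = ((ρ x - 1) ^ j) (f v) := by
    have := (((hfN x x'.2).sub_left (Commute.one_left f)).pow_left j).eq
    exact (LinearMap.congr_fun this v).symm
  rcases hρ.conjNorm_zpowers_or_isUnit_relTrace hx hidx hff hfN with ⟨c, hc⟩ | ⟨-, c, hc⟩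
  -- If f is the trace of c, then r c i has trace 1 on τ, making τ projective relative to the
  -- trivial subgroup.
  · refine absurd (isRelativelyProjective_bot_of_conjNorm hidxQ
      (φ := r.toLinearMap ∘ₗ c ∘ₗ i.toLinearMap) ?_) hbot
    refine LinearMap.ext fun w => ?_
    rw [conjNorm_apply, LinearMap.sum_apply, Module.End.one_apply]
    conv_rhs => rw [← hri w, ← hri w, ← hf, hc, conjNorm_apply, LinearMap.sum_apply, map_sum]
    refine Fintype.sum_equiv
      (Subgroup.subgroupOfEquivOfLe (zpowers_le_normalizer x)).toEquiv _ _ fun n => ?_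
    change τ n (r (c (i (τ (n : N)⁻¹ w)))) = r (ρ (n : N) (c (ρ (n : G)⁻¹ (i w))))
    rw [hrN, hiN]
    rfl
  -- An injective idempotent is 1, so τ would be all of M restricted to N. Then e would be an
  -- equivariant idempotent of an indecomposable module, hence 0 or 1; the latter gives X = 0
  -- because e X = 0.
  · have hker : ∃ v, v ≠ 0 ∧ f v = 0 := by
      by_contra! h
      have hf1 (v : V) : f v = v := by
        by_contra hv
        refine h (f v - v) (sub_ne_zero.2 hv) ?_
        rw [map_sub, sub_eq_zero]
        exact hfi (r v)
      have hε : IsIdempotentElem (r.toLinearMap ∘ₗ e ∘ₗ i.toLinearMap) :=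
        LinearMap.ext fun w => by
          change r (e (i (r (e (i w))))) = r (e (i w))
          rw [← hf, hf1, he.apply_of_mem ⟨_, rfl⟩]
      have hεN (n : N) : Commute (τ n) (r.toLinearMap ∘ₗ e ∘ₗ i.toLinearMap) :=
        LinearMap.ext fun w => by
          change τ n (r (e (i w))) = r (e (i (τ n w)))
          rw [hiN, ← hrN]
          congr 1
          exact LinearMap.congr_fun (he.comm n n.2).eq (i w)
      rcases hind.eq_zero_or_eq_one hεN hε with h0 | h1
      · refine he0 (LinearMap.ext fun v => ?_)
        have h2 : r (e (i (r v))) = 0 := LinearMap.congr_fun h0 (r v)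
        rw [← hf, hf1] at h2
        rw [← hf1 (e v), hf, h2, map_zero]
        rfl
      · refine hX (LinearMap.ext fun v => ?_)
        have h2 : r (e (i (r ((ρ x - 1) v)))) = r ((ρ x - 1) v) := LinearMap.congr_fun h1 _
        rw [← hf, hf1, he.apply_of_mem_range ⟨v, rfl⟩, map_zero] at h2
        rw [← sub_eq_zero]
        change (ρ x - 1) v = 0
        rw [← hf1 ((ρ x - 1) v), hf, ← h2, map_zero]
    obtain ⟨v, hv0, hfv⟩ := hker
    obtain ⟨j, hj0, hj⟩ := exists_pow_apply_mem_ker (isNilpotent_sub_one (ρ := ρ) hx) hv0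
    have hfj : f (((ρ x - 1) ^ j) v) = 0 := by rw [hfXj, hfv, map_zero]
    have hmem := mem_range_pow_of_conjNorm hx hc hj (by
      rw [LinearMap.sub_apply, hfj, sub_zero, Module.End.one_apply])
    -- The kernel of f contains a nonzero fixed vector, which the norm 1 - f puts into im X. It
    -- spans the line ker X ⊓ im X, so f kills that line.
    have hfd {d : V} (hd : d ∈ LinearMap.ker (ρ x - 1) ⊓ LinearMap.range (ρ x - 1)) :
        f d = 0 := by
      obtain ⟨s, hs⟩ := Submodule.mem_span_singleton.1 (hb ⟨hj, range_pow_sub_one_le hmem⟩)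
      obtain ⟨t, ht⟩ := Submodule.mem_span_singleton.1 (hb hd)
      rw [← hs] at hj0 hfj
      rw [map_smul] at hfj
      rw [← ht, map_smul, (smul_eq_zero.1 hfj).resolve_left (left_ne_zero_of_smul hj0), smul_zero]
    -- Otherwise some power of X would carry X (i w) to a nonzero vector of that line, which f fixes
    -- and kills. So U acts trivially on τ and Maschke's theorem applies.
    have htriv (w : W) : (ρ x - 1) (i w) = 0 := by
      by_contra hw
      obtain ⟨l, hl0, hl⟩ := exists_pow_apply_mem_ker (isNilpotent_sub_one (ρ := ρ) hx) hw
      have hlr : ((ρ x - 1) ^ l) ((ρ x - 1) (i w)) ∈ LinearMap.range (ρ x - 1) :=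
        pow_apply_mem (X := ρ x - 1) (fun w _ => LinearMap.mem_range_self (ρ x - 1) w) l
          (LinearMap.mem_range_self (ρ x - 1) (i w))
      have h := hfd ⟨hl, hlr⟩
      rw [hfXj, hfX, hfi] at h
      exact hl0 h
    refine hind.isIrreducible_of_trivial Q hidxQ fun n hn => LinearMap.ext fun w => hi ?_
    rw [hiN]
    exact forall_mem_zpowers_apply_eq_iff.2 (htriv w) n hn

end IsTrivialPartProjection

end TrivialPart

theorem free_asModule_of_equiv {k : Type*} [Field k] {H : Type*} [Group H] {V : Type*}
    [AddCommGroup V] [Module k V] {ρ : Representation k H V} {n : ℕ} (hn : n = 0)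
    (φ : ρ.Equiv ((Representation.leftRegular k H).prod
      (Representation.trivial k H (Fin n → k)))) : Module.Free k[H] ρ.asModule := by
  subst hn
  let f : Representation.IntertwiningMap ρ (Representation.leftRegular k H) :=
    ⟨LinearMap.fst k _ _ ∘ₗ φ.toLinearMap, fun g => LinearMap.ext fun v =>
      congrArg Prod.fst (φ.toIntertwiningMap.isIntertwining _ _ g v)⟩
  have hf : Function.Bijective f := by
    constructor
    · exact fun v w h => φ.toLinearEquiv.injective (Prod.ext h (Subsingleton.elim _ _))
    · intro c
      obtain ⟨v, hv⟩ := φ.toLinearEquiv.surjective (c, 0)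
      exact ⟨v, congrArg Prod.fst hv⟩
  exact Module.Free.of_equiv ((LinearEquiv.ofBijective
    (Representation.IntertwiningMap.equivLinearMapAsModule ρ _ f) hf).trans
      Representation.ofMulActionSelfAsModuleEquiv).symm

end MinActive

end

theorem proposition3p4 {p : ℕ} [Fact p.Prime] (hp : p ≠ 2)
    {G : Type u} [Group G] (hG : MinActive.InClassG p G)
    (x : G) (hx : orderOf x = p) (U : Subgroup G) (hU : U = Subgroup.zpowers x)
    {M : Type v} [AddCommGroup M] [Module (ZMod p) M] [FiniteDimensional (ZMod p) M]
    (ρ : Representation (ZMod p) G M)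
    (hind : MinActive.IsIndecomposable ρ)
    (hmin : MinActive.IsMinimallyActive x ρ)
    (hfaith : Function.Injective (MinActive.res U ρ)) :
    ((Module.finrank (ZMod p) M < p ∧ MinActive.IsIndecomposable (MinActive.res U ρ)) ∨
      (Module.finrank (ZMod p) M = p ∧ MinActive.IsIndecomposable (MinActive.res U ρ) ∧
        Module.Free (ZMod p)[U] (MinActive.res U ρ).asModule ∧
        Module.Projective (ZMod p)[G] ρ.asModule) ∨
      (p < Module.finrank (ZMod p) M ∧ MinActive.IsTrivialSource ρ ∧
        ∃ a : ℕ, Nonempty ((MinActive.res U ρ).Equiv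
          ((Representation.leftRegular (ZMod p) U).prod
            (Representation.trivial (ZMod p) U (Fin a → ZMod p)))))) ∧
    (MinActive.IsTrivialSource ρ ↔ p ≤ Module.finrank (ZMod p) M) ∧
    (p + 2 ≤ Module.finrank (ZMod p) M →
      ρ.IsIrreducible ∧ MinActive.IsAbsolutelyIrreducible ρ) ∧
    (ρ.IsIrreducible → MinActive.IsTrivialSource ρ →
      ∃ (n : ℕ) (Λ : Representation ℤ_[p] G (Fin n → ℤ_[p])),
        MinActive.IsReductionModP Λ ρ ∧
        (MinActive.extendScalars ℚ_[p] Λ).IsIrreducible ∧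
        MinActive.IsAbsolutelyIrreducible (MinActive.extendScalars ℚ_[p] Λ) ∧
        MinActive.CharacterExtendsBrauer Λ ρ) ∧
    (p < Module.finrank (ZMod p) M →
      (∃ (V : Type v) (_ : AddCommGroup V) (_ : Module (ZMod p) V)
        (τ : Representation (ZMod p) (Subgroup.normalizer (U : Set G)) V),
        MinActive.IsGreenCorrespondent U ρ τ) ∧
      ∀ (V : Type v) [AddCommGroup V] [Module (ZMod p) V]
        (τ : Representation (ZMod p) (Subgroup.normalizer (U : Set G)) V),
        MinActive.IsGreenCorrespondent U ρ τ → τ.IsIrreducible) := by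
  subst hU
  have := hG.1
  have := Fintype.ofFinite (Subgroup.zpowers x)
  have := hind.1
  have hp2 := (Fact.out : p.Prime).two_le
  have hX : ρ x ≠ 1 := by
    intro h
    have h1 := @hfaith ⟨x, Subgroup.mem_zpowers x⟩ 1 (h.trans (map_one _).symm)
    have h2 : x = 1 := congrArg Subtype.val h1
    rw [h2, orderOf_one] at hx
    omega
  have hidx : ((Subgroup.zpowers x).index : ZMod p) ≠ 0 := fun h =>
    hG.not_dvd_index hx ((CharP.cast_eq_zero_iff (ZMod p) p _).1 h)
  obtain ⟨b, hb⟩ := hmin.exists_ker_inf_range_le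
  obtain ⟨e, he⟩ := MinActive.exists_isTrivialPartProjection ρ x hidx
  have hker (he0 : e = 0) : LinearMap.ker (ρ x - 1) ≤ (ZMod p) ∙ b := fun v hv =>
    hb ⟨hv, he.mem_range v hv (by rw [he0]; rfl)⟩
  have hrank : e = 0 ↔ Module.finrank (ZMod p) (LinearMap.range e) = 0 := by
    rw [Submodule.finrank_eq_zero, LinearMap.range_eq_bot]
  -- Now the rank of X is at most p - 2 and, since e = 0, the nullity is at most 1.
  have hsmall (h : (ρ x - 1) ^ (p - 1) = 0) : e = 0 ∧ Module.finrank (ZMod p) M < p := by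
    have he0 : e = 0 := by
      by_contra he0
      exact he.pow_sub_one_ne_zero hind hx hidx hX he0 h
    have h1 := MinActive.finrank_range_le (X := ρ x - 1) (r := p - 2)
      (by rwa [show p - 2 + 1 = p - 1 by omega]) hb
    have h2 := he.finrank_ker hb
    rw [hrank.1 he0] at h2
    have h3 := LinearMap.finrank_range_add_finrank_ker (ρ x - 1)
    exact ⟨he0, by omega⟩
  have hproj (he0 : e = 0) (h : (ρ x - 1) ^ (p - 1) ≠ 0) :
      ∃ φ, MinActive.conjNorm ρ (Subgroup.zpowers x) φ = 1 :=
    MinActive.exists_conjNorm_eq_one hx (hker he0) h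
  have hts (h : (ρ x - 1) ^ (p - 1) ≠ 0) : MinActive.IsTrivialSource ρ := by
    by_cases he0 : e = 0
    · obtain ⟨φ, hφ⟩ := hproj he0 h
      exact hind.isTrivialSource_of_isRelativelyProjective_bot
        (MinActive.isRelativelyProjective_bot_of_conjNorm hidx hφ)
    · exact he.isTrivialSource hind hx hidx he0
  -- If the norm vanished, ker X ⊓ im X would be 0 in a summand of a permutation module, contrary to
  -- faithfulness.
  have hpow (h : MinActive.IsTrivialSource ρ) : (ρ x - 1) ^ (p - 1) ≠ 0 := by
    obtain ⟨P, -, -, hP⟩ := h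
    intro h
    obtain ⟨v, hv, hv0⟩ := MinActive.exists_mem_ker_inf_range hx hX
    exact hv0 (MinActive.eq_zero_of_isSummand_ind_trivial hP hx
      ((MinActive.norm_zpowers_eq hx).trans h) hv)
  refine ⟨?_, ⟨fun h => ?_, fun h => hts fun h0 => ?_⟩, fun h => ?_, fun hirr h => ?_, fun h => ?_⟩
  · by_cases h : (ρ x - 1) ^ (p - 1) = 0
    · exact Or.inl ⟨(hsmall h).2, MinActive.isIndecomposable_res_zpowers hx (hker (hsmall h).1)⟩
    · obtain ⟨h1, ⟨φ⟩⟩ := he.exists_equiv hx hb h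
      by_cases he0 : e = 0
      · obtain ⟨ψ, hψ⟩ := hproj he0 h
        have h2 := hrank.1 he0
        exact Or.inr (Or.inl ⟨by omega, MinActive.isIndecomposable_res_zpowers hx (hker he0),
          MinActive.free_asModule_of_equiv h2 φ, MinActive.projective_of_conjNorm hidx hψ⟩)
      · have h2 := mt hrank.2 he0
        exact Or.inr (Or.inr ⟨by omega, hts h, _, ⟨φ⟩⟩)
  · have h1 := (he.exists_equiv hx hb (hpow h)).1
    omega
  · have h1 := (hsmall h0).2
    omega
  · have h0 : (ρ x - 1) ^ (p - 1) ≠ 0 := fun h0 => by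
      have := (hsmall h0).2
      omega
    have h1 := (he.exists_equiv hx hb h0).1
    have hirr := he.isIrreducible hind hx hidx hb (by omega)
    exact ⟨hirr, MinActive.isAbsolutelyIrreducible_of_span_eq_top
      (MinActive.span_range_eq_top_of_pow_ne_zero hirr hx hb h0)⟩
  · have hspan := MinActive.span_range_eq_top_of_pow_ne_zero hirr hx hb (hpow h)
    obtain ⟨P, -, -, hP⟩ := h
    exact MinActive.exists_lift_of_isSummand_ind_trivial hirr hspan hP
  · have h0 : (ρ x - 1) ^ (p - 1) ≠ 0 := fun h0 => by
      have := (hsmall h0).2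
      omega
    have h1 := (he.exists_equiv hx hb h0).1
    have he0 : e ≠ 0 := fun he0 => by
      have := hrank.1 he0
      omega
    exact ⟨⟨_, _, _, _, he.isGreenCorrespondent hind hx hidx he0⟩, fun V _ _ τ hτ =>
      he.isIrreducible_of_isGreenCorrespondent hind hx hidx hb hX he0 hτ⟩
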